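/- **Setting.** Let $\mathcal S,\mathcal A$ be measurable spaces and let $W=(S_0,A_0,Y_0,S_1)$ take values in $\mathcal S\times\mathcal A\times\mathbb R\times\mathcal S$. Fix $\gamma\in[0,1]$, a policy with density $\pi(a\mid s)$ with respect to a $\sigma$-finite measure $\nu$ on $\mathcal A$, and $V^\pi(h)(s)=\int h(a,s)\pi(a\mid s)\,\nu(da)$. Let $\lambda$ be a measure on state-action pairs and $\mathcal P$ a set of probability laws $P$ of $W$ with $E_P[Y_0^2]<\infty$ such that $\lambda$ dominates the law of $(A_0,S_0)$ and the law of $(A_1,S_1)$, $A_1\sim\pi(\cdot\mid S_1)$. Let $H\subseteq L^\infty(\lambda)$ be a linear subspace and let $q\mapsto m(\cdot,\cdot,q)$ be linear from $L^\infty(\lambda)$ to measurable functions of $(s,a)$ modulo $\lambda$-null sets. Write $\langle\cdot,\cdot\rangle_P,\|\cdot\|_P$ for the inner product and norm of $L^2(P_{A_0,S_0})$, $\overline H_P$ for the closure of $H$ in it, $Pf=E_P[f(W)]$, $r_P(a,s)=E_P[Y_0\mid A_0=a,S_0=s]$, and $\mathcal T_P(h)(a,s)=h(a,s)-\gamma E_P[V^\pi(h)(S_1)\mid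 A_0=a,S_0=s]$. A subscript $0$ stands for $P_0$. **Condition (C1) at $P$.** (i) $m(S_0,A_0,q)$ is $P$-integrable for all $q\in H$, and for some $C<\infty$, $|E_P[m(S_0,A_0,q)]|\le C\|q\|_P$ for all $q\in H$. (ii) $\mathcal T_P:(H,\|\cdot\|_P)\to L^2(P_{A_0,S_0})$ is continuous and its extension to $\overline H_P$ has a continuous inverse on its range. On $\overline H_P$, the maps $\mathcal T_P$ and $q\mapsto E_P[m(S_0,A_0,q)]$ are extended by continuity (values in $L^2(P_{A_0,S_0})$ and $\mathbb R$), and so are $\gamma V^\pi$ and $m$ (values in $L^1(P_{S_1})$ and $L^1(P_{A_0,S_0})$) where such $L^1$-limits along sequences of $H$ exist. Let $q_{P,H}=\arg\min_{q\in\overline H_P}E_P[\{Y_0-\mathcal T_P(q)(A_0,S_0)\}^2]$, $\Psi_H(P)=E_P[m(S_0,A_0,q_{P,H})]$, and let $\alpha_{P,H}\in\overline H_P$ be the Riesz representer: $\langle\mathcal T_P(\alpha_{P,H}),\mathcal T_P(h)\rangle_P=E_P[m(S_0,A_0,h)]$ for all $h\in H$. Put $$\begin{aligned}\varphi^*_{P,H}(s,a,y,s')={}&\mathcal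 T_P(\alpha_{P,H})(a,s)\{y+\gamma V^\pi(q_{P,H})(s')-q_{P,H}(a,s)\}\\&+\{\alpha_{P,H}(a,s)-\gamma V^\pi(\alpha_{P,H})(s')-\mathcal T_P(\alpha_{P,H})(a,s)\}\{r_P(a,s)-\mathcal T_P(q_{P,H})(a,s)\}\\&+m(s,a,q_{P,H})-\Psi_H(P).\end{aligned}$$ **Paths.** A regular submodel of $\mathcal P$ through $P_0$ with score $\varphi\in L^\infty(P_0)$ is a family $(P_\varepsilon)_{\varepsilon\in\mathbb R}$, equal to $P_0$ at $\varepsilon=0$, such that for small $\varepsilon$ one has $P_\varepsilon\in\mathcal P$ and $P_\varepsilon\ll P_0$, and $\|\varepsilon^{-1}(dP_\varepsilon/dP_0-1)-\varphi\|_{L^\infty(P_0)}\to0$ as $\varepsilon\to0$. A parameter $\Psi$ is pathwise differentiable at $P_0$ with efficient influence function $g$ if $g\in L^2(P_0)$ has mean zero, $\frac{d}{d\varepsilon}\Psi(P_\varepsilon)|_{\varepsilon=0}=E_{P_0}[g\varphi]$ for every regular submodel, and $g$ lies in the $L^2(P_0)$-closed linear span of the scores. The model is nonparametric at $P_0$ if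 for every bounded measurable $\varphi$ with $P_0\varphi=0$ the law $(1+\varepsilon\varphi)\,dP_0$ is in $\mathcal P$ for all small $|\varepsilon|$. **Theorem.** (a) If $P\in\mathcal P$ satisfies (C1) at $P$, then $\alpha_{P,H}$ exists and $\Psi_H(P)$ is well defined. Now let $P_0\in\mathcal P$, let $\mathcal P$ be nonparametric at $P_0$, and let (C1) hold at every $P\in\mathcal P$ in some Hellinger neighborhood of $P_0$. (b) $\varphi^*_{0,H}$ exists as an element of $L^1(P_0)$, and $\frac{d}{d\varepsilon}\Psi_H(P_\varepsilon)|_{\varepsilon=0}=E_{P_0}[\varphi^*_{0,H}\varphi]$ for every regular submodel. If $\varphi^*_{0,H}$ has finite variance, then $\Psi_H$ is pathwise differentiable at $P_0$ with efficient influence function $\varphi^*_{0,H}$. (c) Let $\overline P\in\mathcal P$ be such that $\varphi^*_{\overline P,H}$ exists and makes sense under $P_0$: fixed versions of $q_{\overline P,H}$ and $\alpha_{\overline P,H}$ also represent elements of $\overline H_{P_0}$, fixed functions represent $\gamma V^\pi(q_{\overline P,H})$, $\gamma V^\pi(\alpha_{\overline P,H})$, $m(\cdot,\cdot,q_{\overline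 P,H})$ for both laws, and the versions of $\mathcal T_{\overline P}(\alpha_{\overline P,H}),\mathcal T_{\overline P}(q_{\overline P,H}),r_{\overline P}$ used are in $L^2(P_{0,A_0,S_0})$. Then $\varphi^*_{\overline P,H}$ is $P_0$-integrable and $\Psi_H(\overline P)-\Psi_H(P_0)=-P_0\varphi^*_{\overline P,H}+R^*_H(\overline P,P_0)$, where $$R^*_H(\overline P,P_0)=\langle\mathcal T_{\overline P}(\alpha_{\overline P,H})-\mathcal T_0(\alpha_{0,H}),\mathcal T_0(q_{0,H}-q_{\overline P,H})\rangle_{P_0}+\langle(\mathcal T_{\overline P}-\mathcal T_0)(\alpha_{\overline P,H}),\,r_0-r_{\overline P}+\mathcal T_{\overline P}(q_{\overline P,H})-\mathcal T_0(q_{0,H})\rangle_{P_0}.$$ (d) Assume only $P_0\in\mathcal P$ and (C1) at $P_0$. Let $\widehat q,\widehat\alpha\in H$, $\widehat r\in L^\infty(\lambda)$, let $\widehat{\mathcal T}:L^\infty(\lambda)\to L^\infty(\lambda)$ be any map, and let $\widehat P\in\mathcal P$ satisfy $\mathcal T_{\widehat P}(\widehat q)=r_{\widehat P}$ $\widehat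 P$-a.e.; put $\widehat\psi=E_{\widehat P}[m(S_0,A_0,\widehat q)]$ (this is $\Psi_H(\widehat P)$ if (C1) holds at $\widehat P$) and $$\widehat\varphi^*=\widehat{\mathcal T}(\widehat\alpha)(a,s)\{y+\gamma V^\pi(\widehat q)(s')-\widehat q(a,s)\}+\{\widehat\alpha(a,s)-\gamma V^\pi(\widehat\alpha)(s')-\widehat{\mathcal T}(\widehat\alpha)(a,s)\}\{\widehat r(a,s)-\widehat{\mathcal T}(\widehat q)(a,s)\}+m(s,a,\widehat q)-\widehat\psi.$$ Then $\widehat\varphi^*$ is $P_0$-integrable and $$\begin{aligned}\widehat\psi-\Psi_H(P_0)=-P_0\widehat\varphi^*&+\langle\mathcal T_0(\widehat\alpha)-\mathcal T_0(\alpha_{0,H}),\mathcal T_0(q_{0,H})-\mathcal T_0(\widehat q)\rangle_{P_0}+\langle\widehat{\mathcal T}(\widehat\alpha)-\mathcal T_0(\widehat\alpha),r_0-\widehat r\rangle_{P_0}\\&+\langle\widehat{\mathcal T}(\widehat\alpha)-\mathcal T_0(\widehat\alpha),\widehat{\mathcal T}(\widehat q)-\mathcal T_0(\widehat q)\rangle_{P_0}.\end{aligned}$$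 -/

import Mathlib

open MeasureTheory Filter Topology
open scoped ENNReal

noncomputable section

/-- One observed transition `(S₀, A₀, Y₀, S₁)`. -/
abbrev Transition (𝒮 𝒜 : Type*) := 𝒮 × 𝒜 × ℝ × 𝒮

/-- The state-action pair `(S₀, A₀)` of a transition. -/
def stateAction {𝒮 𝒜 : Type*} (w : Transition 𝒮 𝒜) : 𝒮 × 𝒜 := (w.1, w.2.1)

/-- The reward `Y₀` of a transition. -/
def outcome {𝒮 𝒜 : Type*} (w : Transition 𝒮 𝒜) : ℝ := w.2.2.1

/-- The next state `S₁` of a transition. -/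
def nextState {𝒮 𝒜 : Type*} (w : Transition 𝒮 𝒜) : 𝒮 := w.2.2.2

section General

variable {𝒮 𝒜 : Type*} [MeasurableSpace 𝒮] [MeasurableSpace 𝒜]

/-- The law of `(S₀, A₀)` under `P`. -/
def saLaw (P : Measure (Transition 𝒮 𝒜)) : Measure (𝒮 × 𝒜) := P.map stateAction

/-- The law of `S₁` under `P`. -/
def nextLaw (P : Measure (Transition 𝒮 𝒜)) : Measure 𝒮 := P.map nextState

/-- The norm of `L²(P_{A₀,S₀})`. -/
def saNorm (P : Measure (Transition 𝒮 𝒜)) (f : 𝒮 × 𝒜 → ℝ) : ℝ :=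
  (eLpNorm f 2 (saLaw P)).toReal

theorem exists_condMean (P : Measure (Transition 𝒮 𝒜)) (f : Transition 𝒮 𝒜 → ℝ) :
    ∃ g : 𝒮 × 𝒜 → ℝ, StronglyMeasurable g ∧
      P[f | MeasurableSpace.comap stateAction inferInstance] = g ∘ stateAction :=
  stronglyMeasurable_condExp.exists_eq_measurable_comp

/-- The regression function `(s, a) ↦ E_P[f(W) | S₀ = s, A₀ = a]`. -/
def condMean (P : Measure (Transition 𝒮 𝒜)) (f : Transition 𝒮 𝒜 → ℝ) : 𝒮 × 𝒜 → ℝ :=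
  (exists_condMean P f).choose

/-- The reward function `r_P(a, s) = E_P[Y₀ | A₀ = a, S₀ = s]`. -/
def rewardFn (P : Measure (Transition 𝒮 𝒜)) : 𝒮 × 𝒜 → ℝ := condMean P outcome

/-- The Hellinger distance, computed with the dominating measure `P + Q`. -/
def hellingerDist {Ω : Type*} [MeasurableSpace Ω] (P Q : Measure Ω) : ℝ :=
  Real.sqrt ((1 / 2) * ∫ x, (Real.sqrt ((P.rnDeriv (P + Q) x).toReal)
    - Real.sqrt ((Q.rnDeriv (P + Q) x).toReal)) ^ 2 ∂(P + Q))

/-- `ε ↦ P ε` is a regular submodel of `𝓜` through `P₀` with (bounded) score `φ`: for small `ε`,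
`P ε` lies in `𝓜` and has a density with respect to `P₀`, and these densities are differentiable
at `ε = 0` in `L^∞(P₀)`, with derivative `φ`. -/
structure IsRegularSubmodel {Ω : Type*} [MeasurableSpace Ω] (𝓜 : Set (Measure Ω)) (P₀ : Measure Ω)
    (P : ℝ → Measure Ω) (φ : Ω → ℝ) : Prop where
  base : P 0 = P₀
  score_bounded : MemLp φ ∞ P₀
  mem : ∀ᶠ ε in 𝓝 (0 : ℝ), P ε ∈ 𝓜
  dominated : ∀ᶠ ε in 𝓝 (0 : ℝ), P ε ≪ P₀
  differentiable : Tendsto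
    (fun ε : ℝ => eLpNorm (fun w => (((P ε).rnDeriv P₀ w).toReal - 1) / ε - φ w) ∞ P₀)
    (𝓝[≠] 0) (𝓝 0)

/-- `𝓜` is nonparametric at `P₀`: every bounded direction of mean zero may be followed within `𝓜`
for a short time. -/
def IsNonparametricAt {Ω : Type*} [MeasurableSpace Ω] (𝓜 : Set (Measure Ω)) (P₀ : Measure Ω) :
    Prop :=
  ∀ φ : Ω → ℝ, Measurable φ → (∃ M : ℝ, ∀ w, |φ w| ≤ M) → ∫ w, φ w ∂P₀ = 0 →
    ∃ δ : ℝ, 0 < δ ∧ ∀ ε : ℝ, |ε| < δ →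
      P₀.withDensity (fun w => ENNReal.ofReal (1 + ε * φ w)) ∈ 𝓜

/-- `g` represents the derivative of `Ψ` at `P₀` along every regular submodel. -/
def RepresentsDerivative {Ω : Type*} [MeasurableSpace Ω] (𝓜 : Set (Measure Ω))
    (Ψ : Measure Ω → ℝ) (P₀ : Measure Ω) (g : Ω → ℝ) : Prop :=
  ∀ (P : ℝ → Measure Ω) (φ : Ω → ℝ), IsRegularSubmodel 𝓜 P₀ P φ →
    HasDerivAt (fun ε => Ψ (P ε)) (∫ w, g w * φ w ∂P₀) 0

/-- `Ψ : 𝓜 → ℝ` is pathwise differentiable at `P₀` with efficient influence function `g`: `g` is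
square integrable with mean zero, it represents the pathwise derivative, and it lies in the tangent
space, the `L²(P₀)`-closed linear span of the scores of the regular submodels. -/
structure IsEfficientInfluenceFunction {Ω : Type*} [MeasurableSpace Ω] (𝓜 : Set (Measure Ω))
    (Ψ : Measure Ω → ℝ) (P₀ : Measure Ω) (g : Ω → ℝ) : Prop where
  memLp : MemLp g 2 P₀
  mean_zero : ∫ w, g w ∂P₀ = 0
  derivative : RepresentsDerivative 𝓜 Ψ P₀ g
  mem_tangentSpace : ∀ δ : ℝ, 0 < δ →
    ∃ φ ∈ Submodule.span ℝ {φ : Ω → ℝ | ∃ P : ℝ → Measure Ω, IsRegularSubmodel 𝓜 P₀ P φ},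
      eLpNorm (g - φ) 2 P₀ < ENNReal.ofReal δ

end General

/-- The fixed ingredients of the estimation problem: the discount factor `γ`, the target policy
given by its density `π(a | s)` with respect to `ν`, the dominating measure `dom` on state-action
pairs, the working model `H`, a linear subspace of `L^∞(dom)`, and the linear map
`q ↦ m(·, ·, q)`. -/
structure BellmanProblem (𝒮 𝒜 : Type*) [MeasurableSpace 𝒮] [MeasurableSpace 𝒜] where
  γ : ℝ
  γ_nonneg : 0 ≤ γ
  γ_le_one : γ ≤ 1
  ν : Measure 𝒜
  sigmaFinite_ν : SigmaFinite ν
  π : 𝒮 → 𝒜 → ℝ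
  measurable_π : Measurable (Function.uncurry π)
  π_nonneg : ∀ s a, 0 ≤ π s a
  lintegral_π : ∀ s, ∫⁻ a, ENNReal.ofReal (π s a) ∂ν = 1
  dom : Measure (𝒮 × 𝒜)
  H : Submodule ℝ (Lp ℝ ∞ dom)
  m : Lp ℝ ∞ dom →ₗ[ℝ] ((𝒮 × 𝒜) →ₘ[dom] ℝ)

/-- The nuisance functions that enter the influence function: the representer `α`, its Bellman image
`Tα` and its discounted next-state value `Vα` (that is `γ V^π(α)`), the same for the projection `q`,
the function `mq = m(·, ·, q)`, and the reward function `r`. -/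
structure NuisanceFns (𝒮 𝒜 : Type*) where
  α : 𝒮 × 𝒜 → ℝ
  Tα : 𝒮 × 𝒜 → ℝ
  Vα : 𝒮 → ℝ
  q : 𝒮 × 𝒜 → ℝ
  Tq : 𝒮 × 𝒜 → ℝ
  Vq : 𝒮 → ℝ
  mq : 𝒮 × 𝒜 → ℝ
  r : 𝒮 × 𝒜 → ℝ

/-- The function `φ*(s, a, y, s')` built from nuisance functions `η` and the centering `ψ`. -/
def influenceFn {𝒮 𝒜 : Type*} (η : NuisanceFns 𝒮 𝒜) (ψ : ℝ) (w : Transition 𝒮 𝒜) : ℝ :=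
  η.Tα (stateAction w) * (outcome w + η.Vq (nextState w) - η.q (stateAction w))
    + (η.α (stateAction w) - η.Vα (nextState w) - η.Tα (stateAction w))
      * (η.r (stateAction w) - η.Tq (stateAction w))
    + η.mq (stateAction w) - ψ

namespace BellmanProblem

variable {𝒮 𝒜 : Type*} [MeasurableSpace 𝒮] [MeasurableSpace 𝒜] (B : BellmanProblem 𝒮 𝒜)

/-- The value function `V^π(h)(s) = ∫ h(a, s) π(a | s) ν(da)`. -/
def value (h : 𝒮 × 𝒜 → ℝ) (s : 𝒮) : ℝ := ∫ a, h (s, a) * B.π s a ∂B.ν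

/-- The Bellman operator
`T_P(h)(a, s) = h(a, s) - γ E_P[V^π(h)(S₁) | A₀ = a, S₀ = s]`. -/
def bellman (P : Measure (Transition 𝒮 𝒜)) (h : Lp ℝ ∞ B.dom) (z : 𝒮 × 𝒜) : ℝ :=
  h z - B.γ * condMean P (fun w => B.value h (nextState w)) z

/-- The law of `(S₁, A₁)` when `S₁` is drawn from `P` and `A₁` from `π(· | S₁)`. -/
def nextPairLaw (P : Measure (Transition 𝒮 𝒜)) : Measure (𝒮 × 𝒜) :=
  ((nextLaw P).prod B.ν).withDensity (fun z => ENNReal.ofReal (B.π z.1 z.2))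

/-- `𝓜` is a statistical model for the problem: its elements are probability measures under which
the reward is square integrable and the state-action pairs `(S₀, A₀)` and `(S₁, A₁)` are dominated
by `dom`. -/
structure IsModel (𝓜 : Set (Measure (Transition 𝒮 𝒜))) : Prop where
  isProbabilityMeasure : ∀ P ∈ 𝓜, IsProbabilityMeasure P
  outcome_memLp : ∀ P ∈ 𝓜, MemLp outcome 2 P
  saLaw_dominated : ∀ P ∈ 𝓜, saLaw P ≪ B.dom
  nextPairLaw_dominated : ∀ P ∈ 𝓜, B.nextPairLaw P ≪ B.dom

/-- The sequence `h` in `H` converges to `f` in `L²(P_{A₀,S₀})`. The functions `f` for which there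
is such a sequence make up the closure of `H` in `L²(P_{A₀,S₀})`. -/
def Approximates (P : Measure (Transition 𝒮 𝒜)) (h : ℕ → Lp ℝ ∞ B.dom) (f : 𝒮 × 𝒜 → ℝ) : Prop :=
  (∀ n, h n ∈ B.H) ∧ MemLp f 2 (saLaw P) ∧
    Tendsto (fun n => eLpNorm (fun z => h n z - f z) 2 (saLaw P)) atTop (𝓝 0)

/-- `f` is in the closure of `H` and `t = T_P(f)`, where `T_P` is extended from `H` to the closure
by continuity, with values in `L²(P_{A₀,S₀})`. -/
def BellmanExt (P : Measure (Transition 𝒮 𝒜)) (f t : 𝒮 × 𝒜 → ℝ) : Prop :=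
  ∃ h : ℕ → Lp ℝ ∞ B.dom, B.Approximates P h f ∧ MemLp t 2 (saLaw P) ∧
    Tendsto (fun n => eLpNorm (fun z => B.bellman P (h n) z - t z) 2 (saLaw P)) atTop (𝓝 0)

/-- `f` is in the closure of `H` and `c = E_P[m(S₀, A₀, f)]`, where the functional
`q ↦ E_P[m(S₀, A₀, q)]` is extended from `H` to the closure by continuity. -/
def MeanExt (P : Measure (Transition 𝒮 𝒜)) (f : 𝒮 × 𝒜 → ℝ) (c : ℝ) : Prop :=
  ∃ h : ℕ → Lp ℝ ∞ B.dom, B.Approximates P h f ∧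
    Tendsto (fun n => ∫ z, B.m (h n) z ∂(saLaw P)) atTop (𝓝 c)

/-- `f` is in the closure of `H` and `g = m(·, ·, f)`, where `q ↦ m(·, ·, q)` is extended from `H`
by continuity, with values in `L¹(P_{A₀,S₀})`. -/
def IntegrandExt (P : Measure (Transition 𝒮 𝒜)) (f g : 𝒮 × 𝒜 → ℝ) : Prop :=
  ∃ h : ℕ → Lp ℝ ∞ B.dom, B.Approximates P h f ∧ Integrable g (saLaw P) ∧
    Tendsto (fun n => eLpNorm (fun z => B.m (h n) z - g z) 1 (saLaw P)) atTop (𝓝 0)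

/-- `f` is in the closure of `H` and `v = γ V^π(f)`, where `q ↦ γ V^π(q)` is extended from `H` by
continuity, with values in `L¹(P_{S₁})`. -/
def ValueExt (P : Measure (Transition 𝒮 𝒜)) (f : 𝒮 × 𝒜 → ℝ) (v : 𝒮 → ℝ) : Prop :=
  ∃ h : ℕ → Lp ℝ ∞ B.dom, B.Approximates P h f ∧ Integrable v (nextLaw P) ∧
    Tendsto (fun n => eLpNorm (fun s => B.γ * B.value (h n) s - v s) 1 (nextLaw P)) atTop (𝓝 0)

/-- Functional continuity and bounded inverse at `P`. For the linear operator `T_P`, continuity on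
`(H, ‖·‖_P)` and continuity of the inverse of its extension are the two norm bounds. -/
structure ConditionAt (P : Measure (Transition 𝒮 𝒜)) : Prop where
  functional_integrable : ∀ q ∈ B.H, Integrable (B.m q) (saLaw P)
  functional_continuous : ∃ C : ℝ, ∀ q ∈ B.H, |∫ z, B.m q z ∂(saLaw P)| ≤ C * saNorm P q
  bellman_continuous : ∃ C : ℝ, ∀ h ∈ B.H, saNorm P (B.bellman P h) ≤ C * saNorm P h
  bounded_inverse : ∃ c : ℝ, 0 < c ∧
    ∀ f t : 𝒮 × 𝒜 → ℝ, B.BellmanExt P f t → c * saNorm P f ≤ saNorm P t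

/-- The condition holds at all `P` in the model that are in a Hellinger neighborhood of `P₀`. -/
def ConditionNear (𝓜 : Set (Measure (Transition 𝒮 𝒜))) (P₀ : Measure (Transition 𝒮 𝒜)) : Prop :=
  ∃ δ : ℝ, 0 < δ ∧ ∀ P ∈ 𝓜, hellingerDist P P₀ < δ → B.ConditionAt P

/-- `q` minimizes `E_P[(Y₀ - T_P(q)(A₀, S₀))²]` over the closure of `H`, and `t = T_P(q)`. -/
def IsBellmanProjection (P : Measure (Transition 𝒮 𝒜)) (q t : 𝒮 × 𝒜 → ℝ) : Prop :=
  B.BellmanExt P q t ∧ ∀ q' t' : 𝒮 × 𝒜 → ℝ, B.BellmanExt P q' t' →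
    ∫ w, (outcome w - t (stateAction w)) ^ 2 ∂P ≤ ∫ w, (outcome w - t' (stateAction w)) ^ 2 ∂P

/-- `α` is the Riesz representer: it is in the closure of `H`, `t = T_P(α)`, and
`⟨T_P(α), T_P(h)⟩_P = E_P[m(S₀, A₀, h)]` for all `h ∈ H`. -/
def IsRieszRepresenter (P : Measure (Transition 𝒮 𝒜)) (α t : 𝒮 × 𝒜 → ℝ) : Prop :=
  B.BellmanExt P α t ∧
    ∀ h ∈ B.H, ∫ z, t z * B.bellman P h z ∂(saLaw P) = ∫ z, B.m h z ∂(saLaw P)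

/-- `ψ = E_P[m(S₀, A₀, q_{P,H})]`. -/
def IsTargetValue (P : Measure (Transition 𝒮 𝒜)) (ψ : ℝ) : Prop :=
  ∃ q t : 𝒮 × 𝒜 → ℝ, B.IsBellmanProjection P q t ∧ B.MeanExt P q ψ

/-- The parameter `Ψ_H(P) = E_P[m(S₀, A₀, q_{P,H})]`. -/
def target (P : Measure (Transition 𝒮 𝒜)) : ℝ := Classical.epsilon (B.IsTargetValue P)

/-- `η` consists of (versions of) the nuisance functions of `P`. -/
structure IsNuisance (P : Measure (Transition 𝒮 𝒜)) (η : NuisanceFns 𝒮 𝒜) : Prop where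
  riesz : B.IsRieszRepresenter P η.α η.Tα
  value_α : B.ValueExt P η.α η.Vα
  projection : B.IsBellmanProjection P η.q η.Tq
  value_q : B.ValueExt P η.q η.Vq
  integrand_q : B.IntegrandExt P η.q η.mq
  reward : η.r =ᵐ[saLaw P] rewardFn P

/-- The nuisance functions given by estimates `α̂, q̂, r̂` in `L^∞` and a map `T̂` on `L^∞`. -/
def estimatedNuisance (T : Lp ℝ ∞ B.dom → Lp ℝ ∞ B.dom) (α q r : Lp ℝ ∞ B.dom) :
    NuisanceFns 𝒮 𝒜 where
  α := α
  Tα := T α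
  Vα := fun s => B.γ * B.value α s
  q := q
  Tq := T q
  Vq := fun s => B.γ * B.value q s
  mq := B.m q
  r := r

end BellmanProblem

end

/-! The right coordinate is the Bellman image. By (C1), T_P is bounded above and below on H for the
L²(P_{A₀,S₀}) norm, so its extension to the closure of H has closed range. The function q_{P,H} is
the preimage of the projection of r_P onto that range. The functional h ↦ E_P[m(h)], read as a
functional of T_P(h), is bounded, so Riesz yields T_P(α). Hence Ψ_H(P) = ⟨T_P(α), T_P(q)⟩_P, along
whichever sequence the extension is computed (`meanExt_iff`, `target_eq`).

Continuity of γV^π and m into L¹ is not assumed: it is forced by the neighborhood. For g = m(h) or g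
= s·γV^π(h), (C1) at a nearby Q bounds only the signed mean E_Q[g]. In a nonparametric model Q can
be (1+εψ)P for any bounded centered ψ, so E_P[ψg] is bounded for each bounded ψ, and the uniform
boundedness principle bounds E_P|g| (`exists_integral_abs_le`, `ConditionNear.strongCondition`).
Consequently γV^π extends to the closure, its products with L² functions of (A₀,S₀) are integrable,
and T_P(f) is still the conditional mean of f − γV^π(f) in the weak sense
(`StrongCondition.isWeakBellman`).

Given these weak identities, the expansions (c) and (d) are bilinear algebra (`vonMises_expansion`).
The Riesz identity turns the mean of m(q) into ⟨T₀(α₀), T₀(q)⟩, and the normal equation makes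
⟨T₀(α), r₀ − T₀(q₀)⟩ vanish.

For the derivative, neither q nor α is differentiated along the path. Instead Ψ(Q) − Ψ(P) −
E_Q[φ*_P] is shown to be O(η²), where η bounds |dQ/dP − 1|
(`StrongCondition.exists_quadratic_bound`). Each gain of a factor η comes from one remark: a
function of P-mean zero has Q-mean at most η times its L¹(P) norm. It gives T_P − T_Q = O(η), and
then the normal equation of q_Q, rewritten with T_P in place of T_Q, holds up to second order after
the correction in `crossTerm`. Tested at q_Q − q_P, it yields ‖q_Q − q_P‖ = O(η); tested at α, it
yields the expansion. Finally, bounded centered functions are scores and are dense among the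
centered L² functions, which gives efficiency. -/

section Basics

variable {𝒮 𝒜 : Type*} [MeasurableSpace 𝒮] [MeasurableSpace 𝒜]

/-! ### Marginal laws of a transition -/

theorem measurable_stateAction : Measurable (stateAction : Transition 𝒮 𝒜 → 𝒮 × 𝒜) := by
  unfold stateAction; fun_prop

theorem measurable_nextState : Measurable (nextState : Transition 𝒮 𝒜 → 𝒮) := by
  unfold nextState; fun_prop

instance isProbabilityMeasure_saLaw (P : Measure (Transition 𝒮 𝒜)) [IsProbabilityMeasure P] :
    IsProbabilityMeasure (saLaw P) :=
  Measure.isProbabilityMeasure_map measurable_stateAction.aemeasurable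

instance isProbabilityMeasure_nextLaw (P : Measure (Transition 𝒮 𝒜)) [IsProbabilityMeasure P] :
    IsProbabilityMeasure (nextLaw P) :=
  Measure.isProbabilityMeasure_map measurable_nextState.aemeasurable

theorem stateAction_quasi (P : Measure (Transition 𝒮 𝒜)) :
    Measure.QuasiMeasurePreserving stateAction P (saLaw P) :=
  ⟨measurable_stateAction, Measure.AbsolutelyContinuous.rfl⟩

theorem nextState_quasi (P : Measure (Transition 𝒮 𝒜)) :
    Measure.QuasiMeasurePreserving nextState P (nextLaw P) :=
  ⟨measurable_nextState, Measure.AbsolutelyContinuous.rfl⟩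

theorem integral_saLaw (P : Measure (Transition 𝒮 𝒜)) {g : 𝒮 × 𝒜 → ℝ}
    (hg : AEStronglyMeasurable g (saLaw P)) :
    ∫ z, g z ∂(saLaw P) = ∫ w, g (stateAction w) ∂P :=
  integral_map measurable_stateAction.aemeasurable hg

theorem memLp_comp_stateAction {P : Measure (Transition 𝒮 𝒜)} {p : ℝ≥0∞} {g : 𝒮 × 𝒜 → ℝ}
    (hg : MemLp g p (saLaw P)) : MemLp (fun w => g (stateAction w)) p P :=
  (memLp_map_measure_iff hg.1 measurable_stateAction.aemeasurable).1 hg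

theorem integrable_comp_stateAction {P : Measure (Transition 𝒮 𝒜)} {g : 𝒮 × 𝒜 → ℝ}
    (hg : Integrable g (saLaw P)) : Integrable (fun w => g (stateAction w)) P :=
  hg.comp_measurable measurable_stateAction

theorem integrable_comp_nextState {P : Measure (Transition 𝒮 𝒜)} {g : 𝒮 → ℝ}
    (hg : Integrable g (nextLaw P)) : Integrable (fun w => g (nextState w)) P :=
  hg.comp_measurable measurable_nextState

theorem eLpNorm_comp_stateAction {P : Measure (Transition 𝒮 𝒜)} {p : ℝ≥0∞} {g : 𝒮 × 𝒜 → ℝ}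
    (hg : AEStronglyMeasurable g (saLaw P)) :
    eLpNorm (fun w => g (stateAction w)) p P = eLpNorm g p (saLaw P) :=
  (eLpNorm_map_measure hg measurable_stateAction.aemeasurable).symm

/-! ### Regression functions -/

theorem stronglyMeasurable_condMean (P : Measure (Transition 𝒮 𝒜)) (f : Transition 𝒮 𝒜 → ℝ) :
    StronglyMeasurable (condMean P f) :=
  (exists_condMean P f).choose_spec.1

theorem condMean_comp (P : Measure (Transition 𝒮 𝒜)) (f : Transition 𝒮 𝒜 → ℝ) :
    P[f | MeasurableSpace.comap stateAction inferInstance] = condMean P f ∘ stateAction :=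
  (exists_condMean P f).choose_spec.2

theorem memLp_condMean {P : Measure (Transition 𝒮 𝒜)} [IsProbabilityMeasure P]
    {f : Transition 𝒮 𝒜 → ℝ} (hf : MemLp f 2 P) : MemLp (condMean P f) 2 (saLaw P) := by
  refine (memLp_map_measure_iff (stronglyMeasurable_condMean P f).aestronglyMeasurable
    measurable_stateAction.aemeasurable).2 ?_
  rw [← condMean_comp]
  exact hf.condExp (by norm_num)

/-- The pull-out property of conditional expectation, integrated. Only the product `s * f` has to be
integrable; `s` is replaced by a measurable version to make it measurable for the σ-algebra of (S₀,
A₀). -/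
theorem integral_mul_condMean {P : Measure (Transition 𝒮 𝒜)} [IsProbabilityMeasure P]
    {s : 𝒮 × 𝒜 → ℝ} {f : Transition 𝒮 𝒜 → ℝ} (hs : AEStronglyMeasurable s (saLaw P))
    (hf : Integrable f P) (hsf : Integrable (fun w => s (stateAction w) * f w) P) :
    ∫ w, s (stateAction w) * condMean P f (stateAction w) ∂P
      = ∫ w, s (stateAction w) * f w ∂P := by
  have hm : MeasurableSpace.comap (stateAction : Transition 𝒮 𝒜 → 𝒮 × 𝒜) inferInstance
      ≤ (inferInstance : MeasurableSpace (Transition 𝒮 𝒜)) := measurable_stateAction.comap_le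
  have hs' : (fun w => s (stateAction w)) =ᵐ[P] fun w => hs.mk s (stateAction w) :=
    (stateAction_quasi P).ae hs.ae_eq_mk
  have hmk : StronglyMeasurable[MeasurableSpace.comap (stateAction : Transition 𝒮 𝒜 → 𝒮 × 𝒜)
      inferInstance] (fun w : Transition 𝒮 𝒜 => hs.mk s (stateAction w)) :=
    hs.stronglyMeasurable_mk.comp_measurable (comap_measurable _)
  have hint : Integrable ((fun w => hs.mk s (stateAction w)) * f) P := by
    refine hsf.congr ?_
    filter_upwards [hs'] with w hw
    simp [hw]
  have key := condExp_mul_of_stronglyMeasurable_left hmk hint hf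
  calc ∫ w, s (stateAction w) * condMean P f (stateAction w) ∂P
      = ∫ w, ((fun w => hs.mk s (stateAction w))
          * P[f | MeasurableSpace.comap stateAction inferInstance]) w ∂P := by
        refine integral_congr_ae ?_
        filter_upwards [hs'] with w hw
        simp [hw, condMean_comp]
    _ = ∫ w, ((fun w => hs.mk s (stateAction w)) * f) w ∂P := by
        rw [← integral_congr_ae key, integral_condExp hm]
    _ = _ := by
        refine integral_congr_ae ?_
        filter_upwards [hs'] with w hw
        simp [hw]

theorem condMean_congr {P : Measure (Transition 𝒮 𝒜)} {f g : Transition 𝒮 𝒜 → ℝ}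
    (h : f =ᵐ[P] g) : condMean P f =ᵐ[saLaw P] condMean P g := by
  have h1 := condExp_congr_ae (m := MeasurableSpace.comap stateAction inferInstance) h
  rw [condMean_comp, condMean_comp] at h1
  exact (ae_map_iff measurable_stateAction.aemeasurable
    (measurableSet_eq_fun (stronglyMeasurable_condMean P f).measurable
      (stronglyMeasurable_condMean P g).measurable)).2 h1

theorem condMean_add_smul {P : Measure (Transition 𝒮 𝒜)} {f g : Transition 𝒮 𝒜 → ℝ}
    (hf : Integrable f P) (hg : Integrable g P) (x : ℝ) :
    condMean P (fun w => f w + x * g w) =ᵐ[saLaw P]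
      fun z => condMean P f z + x * condMean P g z := by
  have h1 := condExp_add hf (hg.smul x) (MeasurableSpace.comap stateAction inferInstance)
  have h2 := condExp_smul (μ := P) x g (MeasurableSpace.comap stateAction inferInstance)
  have h3 : P[f + x • g | MeasurableSpace.comap stateAction inferInstance]
      = condMean P (fun w => f w + x * g w) ∘ stateAction := condMean_comp _ _
  rw [h3, condMean_comp P f, condMean_comp P (x • g)] at h1
  rw [condMean_comp P (x • g), condMean_comp P g] at h2
  refine (ae_map_iff measurable_stateAction.aemeasurable
    (measurableSet_eq_fun (stronglyMeasurable_condMean P _).measurable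
      ((stronglyMeasurable_condMean P f).measurable.add
        ((stronglyMeasurable_condMean P g).measurable.const_mul x)))).2 ?_
  filter_upwards [h1, h2] with w hw1 hw2
  simp only [Function.comp_apply, Pi.add_apply, Pi.smul_apply, smul_eq_mul] at hw1 hw2
  simp only [hw1, hw2, Pi.add_apply]

end Basics

/-! ### Integrals of products -/

section Products

variable {Ω : Type*} [MeasurableSpace Ω] {μ : Measure Ω}

theorem lintegral_enorm_mul_le {f g : Ω → ℝ} (hf : AEStronglyMeasurable f μ)
    (hg : AEStronglyMeasurable g μ) :
    ∫⁻ x, ‖f x‖ₑ * ‖g x‖ₑ ∂μ ≤ eLpNorm f 2 μ * eLpNorm g 2 μ := by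
  have h := ENNReal.lintegral_mul_le_Lp_mul_Lq μ (Real.HolderConjugate.two_two)
    hf.enorm hg.enorm
  rw [eLpNorm_eq_lintegral_rpow_enorm_toReal (by norm_num) (by norm_num),
    eLpNorm_eq_lintegral_rpow_enorm_toReal (by norm_num) (by norm_num)]
  simpa using h

theorem ae_norm_le_norm_Lp_top (h : Lp ℝ ∞ μ) : ∀ᵐ z ∂μ, ‖h z‖ ≤ ‖h‖ := by
  filter_upwards [ae_le_eLpNormEssSup (f := h) (μ := μ)] with z hz
  rw [Lp.norm_def, eLpNorm_exponent_top, ← toReal_enorm]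
  refine ENNReal.toReal_mono ?_ hz
  rw [← eLpNorm_exponent_top]
  exact Lp.eLpNorm_ne_top h

theorem integral_abs_mul_le {f g : Ω → ℝ} (hf : MemLp f 2 μ) (hg : MemLp g 2 μ) :
    ∫ x, |f x * g x| ∂μ ≤ (eLpNorm f 2 μ).toReal * (eLpNorm g 2 μ).toReal := by
  rw [← ENNReal.toReal_mul]
  have h := lintegral_enorm_mul_le hf.1 hg.1
  have h2 : ∫ x, |f x * g x| ∂μ = (∫⁻ x, ‖f x‖ₑ * ‖g x‖ₑ ∂μ).toReal := by
    rw [integral_eq_lintegral_of_nonneg_ae (Eventually.of_forall fun _ => abs_nonneg _)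
      (by exact (hf.1.mul hg.1).norm)]
    congr 1
    refine lintegral_congr fun x => ?_
    rw [← enorm_mul, ← Real.norm_eq_abs, ofReal_norm]
  rw [h2]
  exact ENNReal.toReal_mono (ENNReal.mul_ne_top hf.2.ne hg.2.ne) h

theorem toReal_eLpNorm_two_sq {f : Ω → ℝ} (hf : MemLp f 2 μ) :
    (eLpNorm f 2 μ).toReal ^ 2 = ∫ x, f x * f x ∂μ := by
  have h := hf.eLpNorm_eq_integral_rpow_norm (by norm_num) (by norm_num)
  have h0 : 0 ≤ ∫ x, f x * f x ∂μ := integral_nonneg fun x => mul_self_nonneg _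
  rw [h, ENNReal.toReal_ofReal (by positivity), ENNReal.toReal_ofNat, ← Real.rpow_natCast,
    ← Real.rpow_mul (by positivity)]
  norm_num
  refine integral_congr_ae (Eventually.of_forall fun x => ?_)
  simp [sq]

end Products

namespace BellmanProblem

variable {𝒮 𝒜 : Type*} [MeasurableSpace 𝒮] [MeasurableSpace 𝒜] (B : BellmanProblem 𝒮 𝒜)

/-! ### Value function and Bellman operator on bounded functions -/

theorem integrable_π (s : 𝒮) : Integrable (B.π s) B.ν := by
  have hm : Measurable (B.π s) := B.measurable_π.comp measurable_prodMk_left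
  refine ⟨hm.aestronglyMeasurable, ?_⟩
  rw [hasFiniteIntegral_iff_ofReal (Eventually.of_forall (B.π_nonneg s)), B.lintegral_π s]
  exact ENNReal.one_lt_top

theorem integral_π (s : 𝒮) : ∫ a, B.π s a ∂B.ν = 1 := by
  rw [integral_eq_lintegral_of_nonneg_ae (Eventually.of_forall (B.π_nonneg s))
    (B.integrable_π s).1, B.lintegral_π s, ENNReal.toReal_one]

theorem stronglyMeasurable_value (h : Lp ℝ ∞ B.dom) : StronglyMeasurable (B.value h) := by
  have := B.sigmaFinite_ν
  exact ((Lp.stronglyMeasurable h).mul B.measurable_π.stronglyMeasurable).integral_prod_right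
    (f := fun s a => h (s, a) * B.π s a)

variable {B} {P : Measure (Transition 𝒮 𝒜)}

/-- The value function sees `h` only where π ≠ 0, and there null sets of `dom` are null for the law
of (S₁, A₁). This makes `value` independent, almost everywhere, of the representative of a class in
L^∞. -/
theorem ae_next_of_ae_dom (hV : B.nextPairLaw P ≪ B.dom)
    {p : 𝒮 × 𝒜 → Prop} (hp : ∀ᵐ z ∂B.dom, p z) :
    ∀ᵐ s ∂(nextLaw P), ∀ᵐ a ∂B.ν, B.π s a ≠ 0 → p (s, a) := by
  have := B.sigmaFinite_ν
  have h1 := hV.ae_le hp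
  unfold nextPairLaw at h1
  have h2 := (ae_withDensity_iff (B.measurable_π.ennreal_ofReal)).1 h1
  filter_upwards [Measure.ae_ae_of_ae_prod h2] with s hs
  filter_upwards [hs] with a ha hne
  refine ha ?_
  simpa using lt_of_le_of_ne (B.π_nonneg s a) (Ne.symm hne)

/-- Averaging against the probability density π(· | s) does not increase the essential supremum. -/
theorem ae_integrable_mul_π (hV : B.nextPairLaw P ≪ B.dom) (h : Lp ℝ ∞ B.dom) :
    ∀ᵐ s ∂(nextLaw P), Integrable (fun a => h (s, a) * B.π s a) B.ν ∧ |B.value h s| ≤ ‖h‖ := by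
  filter_upwards [ae_next_of_ae_dom hV (ae_norm_le_norm_Lp_top h)] with s hs
  have hle : ∀ᵐ a ∂B.ν, ‖h (s, a) * B.π s a‖ ≤ ‖h‖ * B.π s a := by
    filter_upwards [hs] with a ha
    by_cases h0 : B.π s a = 0
    · simp [h0]
    · rw [norm_mul, Real.norm_of_nonneg (B.π_nonneg s a)]
      exact mul_le_mul_of_nonneg_right (ha h0) (B.π_nonneg s a)
  refine ⟨((B.integrable_π s).const_mul ‖h‖).mono' ?_ hle, ?_⟩
  · exact (((Lp.stronglyMeasurable h).measurable.comp measurable_prodMk_left).mul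
      (B.measurable_π.comp measurable_prodMk_left)).aestronglyMeasurable
  · have := norm_integral_le_of_norm_le ((B.integrable_π s).const_mul ‖h‖) hle
    rwa [integral_const_mul, B.integral_π, mul_one] at this

theorem value_add_smul (hV : B.nextPairLaw P ≪ B.dom) (h h' : Lp ℝ ∞ B.dom) (x : ℝ) :
    B.value (h + x • h' : Lp ℝ ∞ B.dom) =ᵐ[nextLaw P] fun s => B.value h s + x * B.value h' s := by
  have h1 : ∀ᵐ z ∂B.dom, (h + x • h' : Lp ℝ ∞ B.dom) z = h z + x * h' z := by
    filter_upwards [Lp.coeFn_add h (x • h'), Lp.coeFn_smul x h'] with z e1 e2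
    rw [e1, Pi.add_apply, e2]; rfl
  filter_upwards [ae_next_of_ae_dom hV h1, ae_integrable_mul_π hV h, ae_integrable_mul_π hV h']
    with s hs hi hi'
  unfold value
  rw [← integral_const_mul, ← integral_add hi.1 (hi'.1.const_mul x)]
  refine integral_congr_ae ?_
  filter_upwards [hs] with a ha
  by_cases h0 : B.π s a = 0
  · simp [h0]
  · rw [ha h0]; ring

theorem memLp_value [IsProbabilityMeasure P] (hV : B.nextPairLaw P ≪ B.dom) (p : ℝ≥0∞)
    (h : Lp ℝ ∞ B.dom) : MemLp (B.value h) p (nextLaw P) :=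
  MemLp.of_bound (B.stronglyMeasurable_value h).aestronglyMeasurable ‖h‖
    ((ae_integrable_mul_π hV h).mono fun _ hs => hs.2)

theorem memLp_value_next [IsProbabilityMeasure P] (hV : B.nextPairLaw P ≪ B.dom) (p : ℝ≥0∞)
    (h : Lp ℝ ∞ B.dom) : MemLp (fun w => B.value h (nextState w)) p P :=
  MemLp.of_bound ((B.stronglyMeasurable_value h).measurable.comp
      measurable_nextState).aestronglyMeasurable ‖h‖
    (((nextState_quasi P).ae (ae_integrable_mul_π hV h)).mono fun _ hs => hs.2)

theorem memLp_coe [IsProbabilityMeasure P] (hD : saLaw P ≪ B.dom) (p : ℝ≥0∞) (h : Lp ℝ ∞ B.dom) :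
    MemLp h p (saLaw P) :=
  MemLp.of_bound (Lp.stronglyMeasurable h).aestronglyMeasurable ‖h‖ (hD.ae_le (ae_norm_le_norm_Lp_top h))

theorem memLp_bellman [IsProbabilityMeasure P] (hD : saLaw P ≪ B.dom)
    (hV : B.nextPairLaw P ≪ B.dom) (h : Lp ℝ ∞ B.dom) : MemLp (B.bellman P h) 2 (saLaw P) :=
  (memLp_coe hD 2 h).sub ((memLp_condMean (memLp_value_next hV 2 h)).const_mul B.γ)

theorem coe_add_smul (hD : saLaw P ≪ B.dom) (h h' : Lp ℝ ∞ B.dom) (x : ℝ) :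
    ((h + x • h' : Lp ℝ ∞ B.dom) : 𝒮 × 𝒜 → ℝ) =ᵐ[saLaw P] fun z => h z + x * h' z := by
  filter_upwards [hD.ae_le (Lp.coeFn_add h (x • h')), hD.ae_le (Lp.coeFn_smul x h')] with z e1 e2
  rw [e1, Pi.add_apply, e2]; rfl

theorem bellman_add_smul [IsProbabilityMeasure P] (hD : saLaw P ≪ B.dom)
    (hV : B.nextPairLaw P ≪ B.dom) (h h' : Lp ℝ ∞ B.dom) (x : ℝ) :
    B.bellman P (h + x • h') =ᵐ[saLaw P] fun z => B.bellman P h z + x * B.bellman P h' z := by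
  have h1 := condMean_congr ((nextState_quasi P).ae (value_add_smul hV h h' x))
  have h2 := condMean_add_smul ((memLp_value_next hV 1 h).integrable le_rfl)
    ((memLp_value_next hV 1 h').integrable le_rfl) x
  filter_upwards [h1, h2, coe_add_smul hD h h' x] with z e1 e2 e3
  simp only [bellman, e1, e2, e3]
  ring

theorem m_add_smul (hD : saLaw P ≪ B.dom) (h h' : Lp ℝ ∞ B.dom) (x : ℝ) :
    (B.m (h + x • h') : 𝒮 × 𝒜 → ℝ) =ᵐ[saLaw P] fun z => B.m h z + x * B.m h' z := by
  rw [map_add, map_smul]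
  filter_upwards [hD.ae_le (AEEqFun.coeFn_add (B.m h) (x • B.m h')),
    hD.ae_le (AEEqFun.coeFn_smul x (B.m h'))] with z e1 e2
  simp [e1, e2]

/-- Testing the Bellman operator against functions of the current state-action pair. -/
theorem integral_mul_bellman [IsProbabilityMeasure P] (hD : saLaw P ≪ B.dom)
    (hV : B.nextPairLaw P ≪ B.dom) (h : Lp ℝ ∞ B.dom) {s : 𝒮 × 𝒜 → ℝ}
    (hs : MemLp s 2 (saLaw P)) :
    ∫ w, s (stateAction w) * B.bellman P h (stateAction w) ∂P
      = ∫ w, s (stateAction w) * (h (stateAction w) - B.γ * B.value h (nextState w)) ∂P := by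
  have hs' := memLp_comp_stateAction hs
  have hh := memLp_comp_stateAction (memLp_coe hD 2 h)
  have hv := memLp_value_next hV 2 h
  have hc := memLp_comp_stateAction (memLp_condMean hv)
  have i1 := hs'.integrable_mul hh
  have i2 := (hs'.integrable_mul hv).const_mul B.γ
  have i3 := (hs'.integrable_mul hc).const_mul B.γ
  have key := integral_mul_condMean hs.1 (hv.integrable (by norm_num)) (hs'.integrable_mul hv)
  calc ∫ w, s (stateAction w) * B.bellman P h (stateAction w) ∂P
      = ∫ w, s (stateAction w) * h (stateAction w)
          - B.γ * (s (stateAction w)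
            * condMean P (fun w => B.value h (nextState w)) (stateAction w)) ∂P := by
        refine integral_congr_ae (Eventually.of_forall fun w => ?_)
        simp only [bellman]; ring
    _ = ∫ w, s (stateAction w) * h (stateAction w)
          - B.γ * (s (stateAction w) * B.value h (nextState w)) ∂P := by
        rw [integral_sub, integral_sub, integral_const_mul, integral_const_mul, key]
        exacts [i1, i2, i1, i3]
    _ = _ := by
        refine integral_congr_ae (Eventually.of_forall fun w => ?_)
        simp only; ring

end BellmanProblem

/-! ### Limits in Lebesgue spaces, for functions -/

section Limits

variable {Ω : Type*} [MeasurableSpace Ω] {μ : Measure Ω} {p : ℝ≥0∞}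

/-- Completeness of L^p, phrased for functions. The Cauchy bound `e n + e m` is the shape in which
the triangle inequality through a known limit delivers it. -/
theorem exists_eLpNorm_limit (hp : 1 ≤ p) {F : ℕ → Ω → ℝ} (hF : ∀ n, MemLp (F n) p μ)
    {e : ℕ → ℝ≥0∞} (he : Tendsto e atTop (𝓝 0))
    (h : ∀ n m, eLpNorm (fun z => F n z - F m z) p μ ≤ e n + e m) :
    ∃ t : Ω → ℝ, MemLp t p μ ∧
      Tendsto (fun n => eLpNorm (fun z => F n z - t z) p μ) atTop (𝓝 0) := by
  have : Fact (1 ≤ p) := ⟨hp⟩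
  have hc : CauchySeq fun n => (hF n).toLp := by
    rw [EMetric.cauchySeq_iff]
    intro ε hε
    have h2 : 0 < ε / 2 := ENNReal.half_pos hε.ne'
    obtain ⟨N, hN⟩ := eventually_atTop.1 (he.eventually (gt_mem_nhds h2))
    refine ⟨N, fun m hm n hn => ?_⟩
    rw [Lp.edist_toLp_toLp]
    calc _ ≤ e m + e n := h m n
      _ < ε / 2 + ε / 2 := ENNReal.add_lt_add (hN m hm) (hN n hn)
      _ = ε := ENNReal.add_halves ε
  obtain ⟨ℓ, hℓ⟩ := cauchySeq_tendsto_of_complete hc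
  refine ⟨ℓ, Lp.memLp ℓ, ?_⟩
  rw [← Lp.toLp_coeFn ℓ (Lp.memLp ℓ)] at hℓ
  exact (Lp.tendsto_Lp_iff_tendsto_eLpNorm'' F hF ℓ (Lp.memLp ℓ)).1 hℓ

theorem tendsto_eLpNorm_add_smul (hp : 1 ≤ p) {F F' G : ℕ → Ω → ℝ} {t t' : Ω → ℝ} {x : ℝ}
    (hF : ∀ n, MemLp (F n) p μ) (hF' : ∀ n, MemLp (F' n) p μ) (ht : MemLp t p μ)
    (ht' : MemLp t' p μ) (hG : ∀ n, G n =ᵐ[μ] fun z => F n z + x * F' n z)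
    (h : Tendsto (fun n => eLpNorm (fun z => F n z - t z) p μ) atTop (𝓝 0))
    (h' : Tendsto (fun n => eLpNorm (fun z => F' n z - t' z) p μ) atTop (𝓝 0)) :
    Tendsto (fun n => eLpNorm (fun z => G n z - (t z + x * t' z)) p μ) atTop (𝓝 0) := by
  have hlim : Tendsto (fun n => eLpNorm (fun z => F n z - t z) p μ
      + ‖x‖ₑ * eLpNorm (fun z => F' n z - t' z) p μ) atTop (𝓝 0) := by
    simpa using h.add (ENNReal.Tendsto.const_mul h' (Or.inr enorm_ne_top))
  refine tendsto_of_tendsto_of_tendsto_of_le_of_le tendsto_const_nhds hlim (fun _ => bot_le)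
    fun n => ?_
  have e1 : (fun z => G n z - (t z + x * t' z))
      =ᵐ[μ] (fun z => F n z - t z) + x • (fun z => F' n z - t' z) := by
    filter_upwards [hG n] with z hz
    simp only [hz, Pi.add_apply, Pi.smul_apply, smul_eq_mul]; ring
  rw [eLpNorm_congr_ae e1]
  refine (eLpNorm_add_le ((hF n).sub ht).1 (((hF' n).sub ht').1.const_smul x) hp).trans ?_
  rw [eLpNorm_const_smul]
  rfl

theorem eLpNorm_le_add_sub (hp : 1 ≤ p) {f g : Ω → ℝ} (hf : MemLp f p μ) (hg : MemLp g p μ) :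
    eLpNorm f p μ ≤ eLpNorm g p μ + eLpNorm (fun z => g z - f z) p μ := by
  have h := eLpNorm_sub_le hg.1 (hg.sub hf).1 hp
  rwa [sub_sub_cancel] at h

theorem eLpNorm_sub_comm' (f g : Ω → ℝ) :
    eLpNorm (fun z => f z - g z) p μ = eLpNorm (fun z => g z - f z) p μ :=
  eLpNorm_sub_comm f g p μ

theorem eLpNorm_sub_le_add (hp : 1 ≤ p) {f g k : Ω → ℝ} (hf : MemLp f p μ) (hg : MemLp g p μ)
    (hk : MemLp k p μ) : eLpNorm (fun z => f z - g z) p μ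
      ≤ eLpNorm (fun z => f z - k z) p μ + eLpNorm (fun z => g z - k z) p μ := by
  have h := eLpNorm_sub_le (hf.sub hk).1 (hg.sub hk).1 hp
  rwa [sub_sub_sub_cancel_right] at h

theorem integrable_mul_of_memLp_two {s t : Ω → ℝ} (hs : MemLp s 2 μ) (ht : MemLp t 2 μ) :
    Integrable (fun x => s x * t x) μ :=
  hs.integrable_mul ht

theorem integral_mul_saLaw {𝒮 𝒜 : Type*} [MeasurableSpace 𝒮] [MeasurableSpace 𝒜]
    {P : Measure (Transition 𝒮 𝒜)} {s t : 𝒮 × 𝒜 → ℝ} (hs : MemLp s 2 (saLaw P))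
    (ht : MemLp t 2 (saLaw P)) :
    ∫ z, s z * t z ∂(saLaw P) = ∫ w, s (stateAction w) * t (stateAction w) ∂P :=
  integral_saLaw P (hs.1.mul ht.1)

theorem abs_integral_mul_le {s t : Ω → ℝ} (hs : MemLp s 2 μ) (ht : MemLp t 2 μ) :
    |∫ x, s x * t x ∂μ| ≤ (eLpNorm s 2 μ).toReal * (eLpNorm t 2 μ).toReal :=
  abs_integral_le_integral_abs.trans (integral_abs_mul_le hs ht)

theorem tendsto_integral_mul {s t : Ω → ℝ} {F : ℕ → Ω → ℝ} (hs : MemLp s 2 μ) (ht : MemLp t 2 μ)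
    (hF : ∀ n, MemLp (F n) 2 μ)
    (h : Tendsto (fun n => eLpNorm (fun z => F n z - t z) 2 μ) atTop (𝓝 0)) :
    Tendsto (fun n => ∫ x, s x * F n x ∂μ) atTop (𝓝 (∫ x, s x * t x ∂μ)) := by
  rw [tendsto_iff_dist_tendsto_zero]
  have h1 : Tendsto (fun n => (eLpNorm s 2 μ).toReal
      * (eLpNorm (fun z => F n z - t z) 2 μ).toReal) atTop (𝓝 0) := by
    simpa using ((ENNReal.tendsto_toReal ENNReal.zero_ne_top).comp h).const_mul
      (eLpNorm s 2 μ).toReal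
  refine squeeze_zero (fun _ => dist_nonneg) (fun n => ?_) h1
  rw [Real.dist_eq, ← integral_sub (integrable_mul_of_memLp_two hs (hF n))
    (integrable_mul_of_memLp_two hs ht)]
  simp_rw [← mul_sub]
  exact abs_integral_mul_le hs ((hF n).sub ht)

end Limits

namespace BellmanProblem

variable {𝒮 𝒜 : Type*} [MeasurableSpace 𝒮] [MeasurableSpace 𝒜] {B : BellmanProblem 𝒮 𝒜}
  {P : Measure (Transition 𝒮 𝒜)} {Ω : Type*} [MeasurableSpace Ω]

/-- The requirements that a model makes of a single law. -/
structure IsLaw (B : BellmanProblem 𝒮 𝒜) (P : Measure (Transition 𝒮 𝒜)) : Prop where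
  prob : IsProbabilityMeasure P
  memLp_outcome : MemLp outcome 2 P
  dom : saLaw P ≪ B.dom
  next : B.nextPairLaw P ≪ B.dom

theorem IsModel.isLaw {𝓜 : Set (Measure (Transition 𝒮 𝒜))} (h : B.IsModel 𝓜) (hP : P ∈ 𝓜) :
    B.IsLaw P :=
  ⟨h.isProbabilityMeasure P hP, h.outcome_memLp P hP, h.saLaw_dominated P hP,
    h.nextPairLaw_dominated P hP⟩

/-! ### Extension by continuity from the working model to its closure -/

/-- `t` is the value at `f` of the extension by continuity of the map `N` on the working model. -/
def ExtRel (B : BellmanProblem 𝒮 𝒜) (P : Measure (Transition 𝒮 𝒜)) (N : Lp ℝ ∞ B.dom → Ω → ℝ)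
    (p : ℝ≥0∞) (μ : Measure Ω) (f : 𝒮 × 𝒜 → ℝ) (t : Ω → ℝ) : Prop :=
  ∃ h : ℕ → Lp ℝ ∞ B.dom, B.Approximates P h f ∧ MemLp t p μ ∧
    Tendsto (fun n => eLpNorm (fun z => N (h n) z - t z) p μ) atTop (𝓝 0)

/-- `N` is (up to null sets) linear on the working model, with values in `L^p(μ)`. -/
structure IsLinOn (B : BellmanProblem 𝒮 𝒜) (N : Lp ℝ ∞ B.dom → Ω → ℝ)
    (p : ℝ≥0∞) (μ : Measure Ω) : Prop where
  one_le : 1 ≤ p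
  memLp : ∀ h ∈ B.H, MemLp (N h) p μ
  add_smul : ∀ (h h' : Lp ℝ ∞ B.dom) (x : ℝ), N (h + x • h') =ᵐ[μ] fun z => N h z + x * N h' z

/-- `N` is bounded on the working model with respect to the norm of `L²(P_{A₀,S₀})`. -/
def IsBddOn (B : BellmanProblem 𝒮 𝒜) (P : Measure (Transition 𝒮 𝒜)) (N : Lp ℝ ∞ B.dom → Ω → ℝ)
    (p : ℝ≥0∞) (μ : Measure Ω) (C : ℝ≥0∞) : Prop :=
  C ≠ ∞ ∧ ∀ h ∈ B.H, eLpNorm (N h) p μ ≤ C * eLpNorm h 2 (saLaw P)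

section Ext

variable {N : Lp ℝ ∞ B.dom → Ω → ℝ} {p C : ℝ≥0∞} {μ : Measure Ω} {f f' : 𝒮 × 𝒜 → ℝ} {t t' : Ω → ℝ}
  {h : ℕ → Lp ℝ ∞ B.dom}

theorem IsLaw.isLinOn_coe (hP : B.IsLaw P) :
    B.IsLinOn (fun h => (h : 𝒮 × 𝒜 → ℝ)) 2 (saLaw P) :=
  have := hP.prob
  ⟨by norm_num, fun h _ => memLp_coe hP.dom 2 h, coe_add_smul hP.dom⟩

theorem IsLaw.isLinOn_bellman (hP : B.IsLaw P) : B.IsLinOn (B.bellman P) 2 (saLaw P) :=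
  have := hP.prob
  ⟨by norm_num, fun h _ => memLp_bellman hP.dom hP.next h, bellman_add_smul hP.dom hP.next⟩

theorem IsLaw.isLinOn_value (hP : B.IsLaw P) :
    B.IsLinOn (fun h s => B.γ * B.value h s) 1 (nextLaw P) := by
  have := hP.prob
  refine ⟨le_rfl, fun h _ => (memLp_value hP.next 1 h).const_mul B.γ, fun h h' x => ?_⟩
  filter_upwards [value_add_smul hP.next h h' x] with s hs
  rw [hs]; ring

theorem ConditionAt.isLinOn_m (hP : B.IsLaw P) (hc : B.ConditionAt P) :
    B.IsLinOn (fun h => (B.m h : 𝒮 × 𝒜 → ℝ)) 1 (saLaw P) :=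
  ⟨le_rfl, fun h hh => memLp_one_iff_integrable.2 (hc.functional_integrable h hh),
    m_add_smul hP.dom⟩

theorem IsLinOn.sub (hN : B.IsLinOn N p μ) (h h' : Lp ℝ ∞ B.dom) :
    N (h - h') =ᵐ[μ] fun z => N h z - N h' z := by
  have := hN.add_smul h h' (-1)
  rw [neg_one_smul, ← sub_eq_add_neg] at this
  filter_upwards [this] with z hz
  rw [hz]; ring

theorem Approximates.add_smul (hP : B.IsLaw P) {h' : ℕ → Lp ℝ ∞ B.dom}
    (hf : B.Approximates P h f) (hf' : B.Approximates P h' f') (x : ℝ) :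
    B.Approximates P (fun n => h n + x • h' n) (fun z => f z + x * f' z) :=
  ⟨fun n => B.H.add_mem (hf.1 n) (B.H.smul_mem x (hf'.1 n)), hf.2.1.add (hf'.2.1.const_mul x),
    tendsto_eLpNorm_add_smul (by norm_num) (fun n => hP.isLinOn_coe.memLp _ (hf.1 n))
      (fun n => hP.isLinOn_coe.memLp _ (hf'.1 n)) hf.2.1 hf'.2.1
      (fun n => hP.isLinOn_coe.add_smul _ _ x) hf.2.2 hf'.2.2⟩

theorem ExtRel.add_smul (hP : B.IsLaw P) (hN : B.IsLinOn N p μ) (hf : B.ExtRel P N p μ f t)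
    (hf' : B.ExtRel P N p μ f' t') (x : ℝ) :
    B.ExtRel P N p μ (fun z => f z + x * f' z) (fun z => t z + x * t' z) := by
  obtain ⟨h, ha, ht, hl⟩ := hf
  obtain ⟨h', ha', ht', hl'⟩ := hf'
  exact ⟨_, ha.add_smul hP ha' x, ht.add (ht'.const_mul x),
    tendsto_eLpNorm_add_smul hN.one_le (fun n => hN.memLp _ (ha.1 n))
      (fun n => hN.memLp _ (ha'.1 n)) ht ht' (fun n => hN.add_smul _ _ x) hl hl'⟩

theorem ExtRel.sub (hP : B.IsLaw P) (hN : B.IsLinOn N p μ) (hf : B.ExtRel P N p μ f t)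
    (hf' : B.ExtRel P N p μ f' t') :
    B.ExtRel P N p μ (fun z => f z - f' z) (fun z => t z - t' z) := by
  simpa only [neg_one_mul, ← sub_eq_add_neg] using hf.add_smul hP hN hf' (-1)

theorem ExtRel.of_mem (hP : B.IsLaw P) (hN : B.IsLinOn N p μ) {g : Lp ℝ ∞ B.dom} (hg : g ∈ B.H) :
    B.ExtRel P N p μ g (N g) :=
  ⟨fun _ => g, ⟨fun _ => hg, hP.isLinOn_coe.memLp g hg, by simp⟩, hN.memLp g hg, by simp⟩

theorem ExtRel.eLpNorm_le (hP : B.IsLaw P) (hN : B.IsLinOn N p μ) (hC : B.IsBddOn P N p μ C)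
    (hf : B.ExtRel P N p μ f t) : eLpNorm t p μ ≤ C * eLpNorm f 2 (saLaw P) := by
  obtain ⟨h, ha, ht, hl⟩ := hf
  have hlim : Tendsto (fun n => C * (eLpNorm f 2 (saLaw P)
      + eLpNorm (fun z => h n z - f z) 2 (saLaw P)) + eLpNorm (fun z => N (h n) z - t z) p μ)
      atTop (𝓝 (C * eLpNorm f 2 (saLaw P))) := by
    simpa using (ENNReal.Tendsto.const_mul (tendsto_const_nhds.add ha.2.2) (Or.inr hC.1)).add hl
  refine ge_of_tendsto' hlim fun n => ?_
  refine (eLpNorm_le_add_sub hN.one_le ht (hN.memLp _ (ha.1 n))).trans ?_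
  gcongr
  refine (hC.2 _ (ha.1 n)).trans ?_
  gcongr
  rw [eLpNorm_sub_comm']
  exact eLpNorm_le_add_sub (by norm_num) (hP.isLinOn_coe.memLp _ (ha.1 n)) ha.2.1

/-- A bounded map carries Cauchy sequences to Cauchy sequences. The limit is taken along the given
sequence, so several maps can be extended along a common one. -/
theorem Approximates.exists_limit (hP : B.IsLaw P) (hN : B.IsLinOn N p μ)
    (hC : B.IsBddOn P N p μ C) (ha : B.Approximates P h f) :
    ∃ t, MemLp t p μ ∧ Tendsto (fun n => eLpNorm (fun z => N (h n) z - t z) p μ) atTop (𝓝 0) := by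
  have he := ENNReal.Tendsto.const_mul ha.2.2 (Or.inr hC.1)
  rw [mul_zero] at he
  refine exists_eLpNorm_limit hN.one_le (fun n => hN.memLp _ (ha.1 n)) he fun n m => ?_
  rw [← eLpNorm_congr_ae (hN.sub (h n) (h m)), ← mul_add]
  refine (hC.2 _ (B.H.sub_mem (ha.1 n) (ha.1 m))).trans ?_
  gcongr
  rw [eLpNorm_congr_ae (hP.isLinOn_coe.sub (h n) (h m))]
  exact eLpNorm_sub_le_add (by norm_num) (hP.isLinOn_coe.memLp _ (ha.1 n))
    (hP.isLinOn_coe.memLp _ (ha.1 m)) ha.2.1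

theorem Approximates.exists_extRel (hP : B.IsLaw P) (hN : B.IsLinOn N p μ)
    (hC : B.IsBddOn P N p μ C) (ha : B.Approximates P h f) : ∃ t, B.ExtRel P N p μ f t := by
  obtain ⟨t, ht⟩ := ha.exists_limit hP hN hC
  exact ⟨t, h, ha, ht⟩

/-- The difference of two values is a value of the extension at f − f = 0, so boundedness makes its
norm zero. -/
theorem ExtRel.ae_eq (hP : B.IsLaw P) (hN : B.IsLinOn N p μ) (hC : B.IsBddOn P N p μ C)
    (hf : B.ExtRel P N p μ f t) (hf' : B.ExtRel P N p μ f t') : t =ᵐ[μ] t' := by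
  have h1 := (hf.sub hP hN hf').eLpNorm_le hP hN hC
  obtain ⟨_, _, ht, _⟩ := hf
  obtain ⟨_, _, ht', _⟩ := hf'
  have h0 : eLpNorm (fun z => t z - t' z) p μ = 0 := by simpa using h1
  replace h0 := (eLpNorm_eq_zero_iff (ht.sub ht').1 (zero_lt_one.trans_le hN.one_le).ne').1 h0
  filter_upwards [h0] with z hz
  exact sub_eq_zero.1 hz

end Ext

theorem ConditionAt.exists_isBddOn_bellman (hP : B.IsLaw P) (hc : B.ConditionAt P) :
    ∃ C, B.IsBddOn P (B.bellman P) 2 (saLaw P) C := by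
  obtain ⟨C, hC⟩ := hc.bellman_continuous
  refine ⟨ENNReal.ofReal (max C 0), ENNReal.ofReal_ne_top, fun h hh => ?_⟩
  have h1 := (hP.isLinOn_bellman.memLp h hh).2.ne
  have h2 := (hP.isLinOn_coe.memLp h hh).2.ne
  rw [← ENNReal.toReal_le_toReal h1 (ENNReal.mul_ne_top ENNReal.ofReal_ne_top h2),
    ENNReal.toReal_mul, ENNReal.toReal_ofReal (le_max_right _ _)]
  exact (hC h hh).trans (mul_le_mul_of_nonneg_right (le_max_left _ _) ENNReal.toReal_nonneg)

theorem ConditionAt.exists_inverse_bound (hP : B.IsLaw P) (hc : B.ConditionAt P) :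
    ∃ C : ℝ≥0∞, C ≠ ∞ ∧ ∀ h ∈ B.H,
      eLpNorm h 2 (saLaw P) ≤ C * eLpNorm (B.bellman P h) 2 (saLaw P) := by
  obtain ⟨c, hc0, hC⟩ := hc.bounded_inverse
  refine ⟨ENNReal.ofReal c⁻¹, ENNReal.ofReal_ne_top, fun h hh => ?_⟩
  have h1 := (hP.isLinOn_bellman.memLp h hh).2.ne
  have h2 := (hP.isLinOn_coe.memLp h hh).2.ne
  rw [← ENNReal.toReal_le_toReal h2 (ENNReal.mul_ne_top ENNReal.ofReal_ne_top h1),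
    ENNReal.toReal_mul, ENNReal.toReal_ofReal (inv_nonneg.2 hc0.le), inv_mul_eq_div,
    le_div_iff₀' hc0]
  exact hC _ _ (ExtRel.of_mem hP hP.isLinOn_bellman hh)

/-- The range of the extended operator is closed: the lower bound on T_P makes the preimages of a
convergent sequence of images Cauchy. -/
theorem ConditionAt.exists_approximates (hP : B.IsLaw P) (hc : B.ConditionAt P)
    {h : ℕ → Lp ℝ ∞ B.dom} (hh : ∀ n, h n ∈ B.H) {t : 𝒮 × 𝒜 → ℝ} (ht : MemLp t 2 (saLaw P))
    (hl : Tendsto (fun n => eLpNorm (fun z => B.bellman P (h n) z - t z) 2 (saLaw P))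
      atTop (𝓝 0)) : ∃ f, B.Approximates P h f := by
  obtain ⟨C, hC, hb⟩ := hc.exists_inverse_bound hP
  have he := ENNReal.Tendsto.const_mul hl (Or.inr hC)
  rw [mul_zero] at he
  obtain ⟨f, hf⟩ := exists_eLpNorm_limit (p := 2) (by norm_num)
    (fun n => hP.isLinOn_coe.memLp _ (hh n)) he fun n m => by
      rw [← eLpNorm_congr_ae (hP.isLinOn_coe.sub (h n) (h m)), ← mul_add]
      refine (hb _ (B.H.sub_mem (hh n) (hh m))).trans ?_
      gcongr
      rw [eLpNorm_congr_ae (hP.isLinOn_bellman.sub (h n) (h m))]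
      exact eLpNorm_sub_le_add (by norm_num) (hP.isLinOn_bellman.memLp _ (hh n))
        (hP.isLinOn_bellman.memLp _ (hh m)) ht
  exact ⟨f, hh, hf⟩

end BellmanProblem

/-! ### Quadratic expansions and the reward regression -/

theorem integral_sub_mul_sq {Ω : Type*} [MeasurableSpace Ω] {μ : Measure Ω} {u v : Ω → ℝ}
    (hu : MemLp u 2 μ) (hv : MemLp v 2 μ) (x : ℝ) :
    ∫ w, (u w - x * v w) ^ 2 ∂μ
      = ∫ w, u w * u w ∂μ - 2 * x * ∫ w, v w * u w ∂μ + x ^ 2 * ∫ w, v w * v w ∂μ := by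
  have i1 := integrable_mul_of_memLp_two hu hu
  have i2 := (integrable_mul_of_memLp_two hv hu).const_mul (2 * x)
  have i3 := (integrable_mul_of_memLp_two hv hv).const_mul (x ^ 2)
  have i4 : Integrable (fun w => u w * u w - 2 * x * (v w * u w)) μ := i1.sub i2
  rw [← integral_const_mul, ← integral_const_mul, ← integral_sub i1 i2, ← integral_add i4 i3]
  refine integral_congr_ae (Eventually.of_forall fun w => ?_)
  simp only; ring

theorem eq_zero_of_forall_quadratic_nonneg {a b : ℝ} (ha : 0 ≤ a)
    (h : ∀ x : ℝ, 0 ≤ -(2 * x * b) + x ^ 2 * a) : b = 0 := by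
  -- The quadratic is minimal at b/a. Using a + 1 avoids the case a = 0 and still makes the value
  -- negative unless b = 0.
  have h1 := h (b / (a + 1))
  have h2 : -(2 * (b / (a + 1)) * b) + (b / (a + 1)) ^ 2 * a
      = -(b ^ 2 * ((a + 2) / (a + 1) ^ 2)) := by
    field_simp; ring
  rw [h2] at h1
  have h3 : 0 < (a + 2) / (a + 1) ^ 2 := by positivity
  have h4 : b ^ 2 = 0 := by nlinarith [sq_nonneg b]
  exact pow_eq_zero_iff (two_ne_zero) |>.1 h4

namespace BellmanProblem

variable {𝒮 𝒜 : Type*} [MeasurableSpace 𝒮] [MeasurableSpace 𝒜] {B : BellmanProblem 𝒮 𝒜}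
  {P : Measure (Transition 𝒮 𝒜)}

theorem IsLaw.memLp_rewardFn (hP : B.IsLaw P) : MemLp (rewardFn P) 2 (saLaw P) :=
  have := hP.prob
  memLp_condMean hP.memLp_outcome

theorem IsLaw.integral_mul_rewardFn (hP : B.IsLaw P) {s : 𝒮 × 𝒜 → ℝ} (hs : MemLp s 2 (saLaw P)) :
    ∫ w, s (stateAction w) * rewardFn P (stateAction w) ∂P
      = ∫ w, s (stateAction w) * outcome w ∂P :=
  have := hP.prob
  integral_mul_condMean hs.1 (hP.memLp_outcome.integrable (by norm_num))
    (integrable_mul_of_memLp_two (memLp_comp_stateAction hs) hP.memLp_outcome)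

/-! ### Projection -/

/-- First-order condition of least squares: perturbing q by x·f leaves a quadratic in x that is
nonnegative for every x, so its linear coefficient vanishes. -/
theorem IsBellmanProjection.orthogonal (hP : B.IsLaw P) {q t f t' : 𝒮 × 𝒜 → ℝ}
    (hq : B.IsBellmanProjection P q t) (hf : B.BellmanExt P f t') :
    ∫ w, t' (stateAction w) * (outcome w - t (stateAction w)) ∂P = 0 := by
  obtain ⟨h, ha, ht', hl⟩ := hf
  have htm : MemLp t 2 (saLaw P) := by obtain ⟨_, _, ht, _⟩ := hq.1; exact ht
  have hv := memLp_comp_stateAction ht'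
  have hu := hP.memLp_outcome.sub (memLp_comp_stateAction htm)
  refine eq_zero_of_forall_quadratic_nonneg (a := ∫ w, t' (stateAction w) * t' (stateAction w) ∂P)
    (integral_nonneg fun w => mul_self_nonneg _) fun x => ?_
  have h1 := hq.2 _ _ (ExtRel.add_smul hP hP.isLinOn_bellman hq.1 ⟨h, ha, ht', hl⟩ x)
  have h2 := integral_sub_mul_sq hu hv x
  have h3 := integral_sub_mul_sq hu hv 0
  simp only [Pi.sub_apply] at h2 h3
  simp only [← sub_sub] at h1
  rw [h2] at h1
  simp only [zero_mul, sub_zero, mul_zero, ne_eq, OfNat.ofNat_ne_zero, not_false_eq_true, zero_pow,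
    add_zero] at h3
  linarith

/-- Orthogonality passes from H to the closure by continuity of the inner product; Pythagoras then
gives minimality. -/
theorem isBellmanProjection_of_orthogonal (hP : B.IsLaw P) {q t : 𝒮 × 𝒜 → ℝ}
    (hq : B.BellmanExt P q t)
    (ho : ∀ h ∈ B.H, ∫ w, B.bellman P h (stateAction w)
      * (outcome w - t (stateAction w)) ∂P = 0) : B.IsBellmanProjection P q t := by
  refine ⟨hq, fun q' t' hq' => ?_⟩
  obtain ⟨h, ha, hd, hl⟩ := ExtRel.sub hP hP.isLinOn_bellman hq' hq
  have htm : MemLp t 2 (saLaw P) := by obtain ⟨_, _, ht, _⟩ := hq; exact ht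
  have hv := memLp_comp_stateAction hd
  have hu := hP.memLp_outcome.sub (memLp_comp_stateAction htm)
  have hlim := tendsto_integral_mul (F := fun n w => B.bellman P (h n) (stateAction w)) hu hv
    (fun n => memLp_comp_stateAction (hP.isLinOn_bellman.memLp _ (ha.1 n))) (by
      refine hl.congr fun n => ?_
      exact (eLpNorm_comp_stateAction ((hP.isLinOn_bellman.memLp _ (ha.1 n)).sub hd).1).symm)
  have h0 : ∫ w, (t' (stateAction w) - t (stateAction w))
      * (outcome w - t (stateAction w)) ∂P = 0 := by
    have := tendsto_nhds_unique hlim (by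
      simpa only [mul_comm, Pi.sub_apply, ho _ (ha.1 _)] using tendsto_const_nhds (x := (0 : ℝ)))
    simpa only [mul_comm, Pi.sub_apply] using this
  have h1 := integral_sub_mul_sq hu hv 1
  have h2 := integral_sub_mul_sq hu hv 0
  have h3 : 0 ≤ ∫ w, (t' (stateAction w) - t (stateAction w))
      * (t' (stateAction w) - t (stateAction w)) ∂P := integral_nonneg fun w => mul_self_nonneg _
  simp only [Pi.sub_apply, one_mul, sub_sub, add_sub_cancel] at h1 h2
  rw [h0] at h1
  rw [h1]
  simp only [zero_mul, add_zero, mul_zero, ne_eq, OfNat.ofNat_ne_zero, not_false_eq_true, zero_pow,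
    sub_zero] at h2 ⊢
  linarith

/-- Subtracting the two normal equations tested at t − t' leaves ‖t − t'‖² = 0. This needs no part
of (C1), and uniqueness of the image is all that the target parameter requires. -/
theorem IsBellmanProjection.ae_eq (hP : B.IsLaw P) {q t q' t' : 𝒮 × 𝒜 → ℝ}
    (hq : B.IsBellmanProjection P q t) (hq' : B.IsBellmanProjection P q' t') :
    t =ᵐ[saLaw P] t' := by
  have hd := ExtRel.sub hP hP.isLinOn_bellman hq.1 hq'.1
  have h1 := hq.orthogonal hP hd
  have h2 := hq'.orthogonal hP hd
  obtain ⟨_, _, ht, _⟩ := hq.1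
  obtain ⟨_, _, ht', _⟩ := hq'.1
  have hdm : MemLp (fun z => t z - t' z) 2 (saLaw P) := ht.sub ht'
  have hdP := memLp_comp_stateAction hdm
  have h3 : (eLpNorm (fun z => t z - t' z) 2 (saLaw P)).toReal ^ 2 = 0 := by
    rw [toReal_eLpNorm_two_sq hdm, integral_mul_saLaw hdm hdm]
    rw [← sub_self (0 : ℝ)]
    nth_rewrite 1 [← h2]
    rw [← h1, ← integral_sub]
    · refine integral_congr_ae (Eventually.of_forall fun w => ?_)
      simp only; ring
    · exact integrable_mul_of_memLp_two hdP (hP.memLp_outcome.sub (memLp_comp_stateAction ht'))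
    · exact integrable_mul_of_memLp_two hdP (hP.memLp_outcome.sub (memLp_comp_stateAction ht))
  have h4 : eLpNorm (fun z => t z - t' z) 2 (saLaw P) = 0 := by
    rcases (ENNReal.toReal_eq_zero_iff _).1 (pow_eq_zero_iff two_ne_zero |>.1 h3) with h | h
    · exact h
    · exact absurd h hdm.2.ne
  filter_upwards [(eLpNorm_eq_zero_iff hdm.1 two_ne_zero).1 h4] with z hz
  exact sub_eq_zero.1 hz

/-! ### Existence of the representer and of the projection -/

/-- The Bellman operator on the working model, as a linear map into `L²(P_{A₀,S₀})`. -/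
noncomputable def bellmanLin (hP : B.IsLaw P) : B.H →ₗ[ℝ] Lp ℝ 2 (saLaw P) :=
  have hN := hP.isLinOn_bellman
  { toFun := fun h => (hN.memLp h h.2).toLp
    map_add' := fun h h' => by
      rw [← MemLp.toLp_add, MemLp.toLp_eq_toLp_iff]
      have := hN.add_smul h h' 1
      rw [one_smul] at this
      filter_upwards [this] with z hz
      simp [hz]
    map_smul' := fun x h => by
      rw [RingHom.id_apply, ← MemLp.toLp_const_smul, MemLp.toLp_eq_toLp_iff]
      -- Homogeneity follows from the single rule for h + x • h', through x • h = h + (x − 1) • h.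
      have := hN.add_smul h h (x - 1)
      rw [sub_smul, one_smul, add_sub_cancel] at this
      filter_upwards [this] with z hz
      simp only [Submodule.coe_smul, hz, Pi.smul_apply, smul_eq_mul]
      ring }

/-- The closure of the image of the working model under the Bellman operator. -/
noncomputable def bellmanRange (hP : B.IsLaw P) : Submodule ℝ (Lp ℝ 2 (saLaw P)) :=
  (LinearMap.range (bellmanLin hP)).topologicalClosure

/-- Each point of the closed range is an actual Bellman image, by the lower bound on T_P; this turns
projections and Riesz vectors in the range into functions in the closure of H. -/
theorem ConditionAt.exists_bellmanExt (hP : B.IsLaw P) (hc : B.ConditionAt P)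
    {ρ : Lp ℝ 2 (saLaw P)} (hρ : ρ ∈ bellmanRange hP) : ∃ f, B.BellmanExt P f ρ := by
  obtain ⟨u, hu, hl⟩ := mem_closure_iff_seq_limit.1 hρ
  choose h hh using hu
  have hl' : Tendsto (fun n => bellmanLin hP (h n)) atTop (𝓝 (Lp.memLp ρ).toLp) := by
    rw [Lp.toLp_coeFn]
    simpa only [hh] using hl
  have hl2 := (Lp.tendsto_Lp_iff_tendsto_eLpNorm'' (fun n => B.bellman P (h n))
    (fun n => hP.isLinOn_bellman.memLp _ (h n).2) ρ (Lp.memLp ρ)).1 hl'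
  obtain ⟨f, hf⟩ := hc.exists_approximates hP (fun n => (h n).2) (Lp.memLp ρ) hl2
  exact ⟨f, _, hf, Lp.memLp ρ, hl2⟩

theorem inner_bellmanLin (hP : B.IsLaw P) (ρ : Lp ℝ 2 (saLaw P)) (h : B.H) :
    inner ℝ ρ (bellmanLin hP h) = ∫ z, ρ z * B.bellman P h z ∂(saLaw P) := by
  rw [L2.inner_def]
  refine integral_congr_ae ?_
  filter_upwards [MemLp.coeFn_toLp (hP.isLinOn_bellman.memLp h h.2)] with z hz
  have hz' : (bellmanLin hP h : Lp ℝ 2 (saLaw P)) z = B.bellman P h z := hz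
  rw [hz']
  simp [mul_comm]

theorem norm_bellmanLin (hP : B.IsLaw P) (h : B.H) :
    ‖bellmanLin hP h‖ = saNorm P (B.bellman P h) :=
  Lp.norm_toLp _ (hP.isLinOn_bellman.memLp h h.2)

/-- The bounds |E m(h)| ≤ C‖h‖ and c‖h‖ ≤ ‖T h‖ make E m(h) a functional of T h, bounded by C/c. It
extends to the closed range, a Hilbert space, where Riesz represents it by some ρ, and α is a
preimage of ρ. -/
theorem ConditionAt.exists_isRieszRepresenter (hP : B.IsLaw P) (hc : B.ConditionAt P) :
    ∃ α t : 𝒮 × 𝒜 → ℝ, B.IsRieszRepresenter P α t := by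
  have hcl : LinearMap.range (bellmanLin hP) ≤ bellmanRange hP :=
    Submodule.le_topologicalClosure _
  have : CompleteSpace (bellmanRange hP) :=
    (Submodule.isClosed_topologicalClosure _).completeSpace_coe
  let e : B.H →ₗ[ℝ] bellmanRange hP := (bellmanLin hP).codRestrict _ fun h => hcl ⟨h, rfl⟩
  have he : DenseRange e := by
    refine Subtype.dense_iff.2 fun x hx => closure_mono ?_ hx
    rintro _ ⟨h, rfl⟩
    exact ⟨e h, ⟨h, rfl⟩, rfl⟩
  have hmi := hc.isLinOn_m hP
  let F : B.H →ₗ[ℝ] ℝ :=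
    { toFun := fun h => ∫ z, B.m h z ∂(saLaw P)
      map_add' := fun h h' => by
        have h1 := hmi.add_smul h h' 1
        rw [one_smul] at h1
        rw [← integral_add (hc.functional_integrable h h.2) (hc.functional_integrable h' h'.2)]
        refine integral_congr_ae ?_
        filter_upwards [h1] with z hz
        rw [Submodule.coe_add, hz, one_mul]
      map_smul' := fun x h => by
        have h1 := hmi.add_smul h h (x - 1)
        rw [sub_smul, one_smul, add_sub_cancel] at h1
        rw [RingHom.id_apply, smul_eq_mul, ← integral_const_mul]
        refine integral_congr_ae ?_
        filter_upwards [h1] with z hz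
        rw [Submodule.coe_smul, hz]; ring }
  have hb : ∃ C, ∀ h, ‖F h‖ ≤ C * ‖e h‖ := by
    obtain ⟨C, hC⟩ := hc.functional_continuous
    obtain ⟨c, hc0, hci⟩ := hc.bounded_inverse
    refine ⟨max C 0 * c⁻¹, fun h => ?_⟩
    have h1 : c * saNorm P h ≤ saNorm P (B.bellman P h) :=
      hci _ _ (ExtRel.of_mem hP hP.isLinOn_bellman h.2)
    have h2 : ‖e h‖ = saNorm P (B.bellman P h) := norm_bellmanLin hP h
    rw [h2, mul_assoc]
    refine (hC h h.2).trans ?_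
    refine (mul_le_mul_of_nonneg_right (le_max_left C 0) ENNReal.toReal_nonneg).trans ?_
    refine mul_le_mul_of_nonneg_left ?_ (le_max_right _ _)
    rwa [inv_mul_eq_div, le_div_iff₀' hc0]
  let ℓ := F.extendOfNorm e
  let ρ := (InnerProductSpace.toDual ℝ (bellmanRange hP)).symm ℓ
  obtain ⟨α, hα⟩ := hc.exists_bellmanExt hP ρ.2
  refine ⟨α, _, hα, fun h hh => ?_⟩
  have h1 : inner ℝ ρ (e ⟨h, hh⟩) = ℓ (e ⟨h, hh⟩) := InnerProductSpace.toDual_symm_apply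
  have h2 : ℓ (e ⟨h, hh⟩) = F ⟨h, hh⟩ := LinearMap.extendOfNorm_eq he hb _
  have h3 := inner_bellmanLin hP (ρ : Lp ℝ 2 (saLaw P)) ⟨h, hh⟩
  rw [← h3]
  exact h1.trans h2

/-- The reward function is projected rather than Y₀, since it lives in the same L² space as the
Bellman images; the pull-out property puts Y₀ back into the normal equations. -/
theorem ConditionAt.exists_isBellmanProjection (hP : B.IsLaw P) (hc : B.ConditionAt P) :
    ∃ q t : 𝒮 × 𝒜 → ℝ, B.IsBellmanProjection P q t := by
  have : CompleteSpace (bellmanRange hP) :=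
    (Submodule.isClosed_topologicalClosure _).completeSpace_coe
  let r := hP.memLp_rewardFn.toLp
  let τ : Lp ℝ 2 (saLaw P) := (bellmanRange hP).starProjection r
  have hτ : τ ∈ bellmanRange hP := Submodule.starProjection_apply_mem _ _
  obtain ⟨q, hq⟩ := hc.exists_bellmanExt hP hτ
  refine ⟨q, τ, isBellmanProjection_of_orthogonal hP hq fun h hh => ?_⟩
  have h1 : inner ℝ (r - τ) (bellmanLin hP ⟨h, hh⟩) = 0 :=
    Submodule.starProjection_inner_eq_zero _ _
      (Submodule.le_topologicalClosure _ ⟨⟨h, hh⟩, rfl⟩)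
  have hbm := hP.isLinOn_bellman.memLp h hh
  have hbP := memLp_comp_stateAction hbm
  have hτP := memLp_comp_stateAction (Lp.memLp τ)
  have hrP := memLp_comp_stateAction hP.memLp_rewardFn
  rw [inner_sub_left, inner_bellmanLin, inner_bellmanLin] at h1
  have h2 : ∫ z, r z * B.bellman P h z ∂(saLaw P)
      = ∫ w, B.bellman P h (stateAction w) * outcome w ∂P := by
    rw [← hP.integral_mul_rewardFn hbm, ← integral_mul_saLaw hbm
      hP.memLp_rewardFn]
    refine integral_congr_ae ?_
    filter_upwards [MemLp.coeFn_toLp hP.memLp_rewardFn] with z hz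
    have hz' : r z = rewardFn P z := hz
    simp only [hz', mul_comm]
  have h3 : ∫ z, τ z * B.bellman P h z ∂(saLaw P)
      = ∫ w, B.bellman P h (stateAction w) * τ (stateAction w) ∂P := by
    rw [← integral_mul_saLaw hbm (Lp.memLp τ)]
    simp only [mul_comm]
  rw [h2, h3] at h1
  rw [← h1, ← integral_sub (integrable_mul_of_memLp_two hbP hP.memLp_outcome)
    (integrable_mul_of_memLp_two hbP hτP)]
  simp only [mul_sub]

/-! ### The target parameter -/

theorem IsRieszRepresenter.memLp {α ρ : 𝒮 × 𝒜 → ℝ} (h : B.IsRieszRepresenter P α ρ) :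
    MemLp ρ 2 (saLaw P) := by
  obtain ⟨_, _, h, _⟩ := h.1; exact h

/-- Along any approximating sequence E m(h_n) = ⟨ρ, T h_n⟩, and T h_n has the limit t whatever the
sequence. So the extended functional is single valued and equals pairing with ρ. -/
theorem meanExt_iff (hP : B.IsLaw P) (hc : B.ConditionAt P) {α ρ f t : 𝒮 × 𝒜 → ℝ} {c : ℝ}
    (hα : B.IsRieszRepresenter P α ρ) (hf : B.BellmanExt P f t) :
    B.MeanExt P f c ↔ c = ∫ z, ρ z * t z ∂(saLaw P) := by
  have key : ∀ (h : ℕ → Lp ℝ ∞ B.dom) (t' : 𝒮 × 𝒜 → ℝ), B.Approximates P h f →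
      MemLp t' 2 (saLaw P) →
      Tendsto (fun n => eLpNorm (fun z => B.bellman P (h n) z - t' z) 2 (saLaw P)) atTop (𝓝 0) →
      Tendsto (fun n => ∫ z, B.m (h n) z ∂(saLaw P)) atTop (𝓝 (∫ z, ρ z * t' z ∂(saLaw P))) := by
    intro h t' ha ht' hl
    simp only [← hα.2 _ (ha.1 _)]
    exact tendsto_integral_mul hα.memLp ht' (fun n => hP.isLinOn_bellman.memLp _ (ha.1 n)) hl
  constructor
  · rintro ⟨h, ha, hl⟩
    obtain ⟨C, hC⟩ := hc.exists_isBddOn_bellman hP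
    obtain ⟨t', ht', hl'⟩ := ha.exists_limit hP hP.isLinOn_bellman hC
    have he : t' =ᵐ[saLaw P] t :=
      ExtRel.ae_eq hP hP.isLinOn_bellman hC ⟨h, ha, ht', hl'⟩ hf
    rw [tendsto_nhds_unique hl (key h t' ha ht' hl')]
    refine integral_congr_ae ?_
    filter_upwards [he] with z hz
    rw [hz]
  · rintro rfl
    obtain ⟨h, ha, ht, hl⟩ := hf
    exact ⟨h, ha, key h t ha ht hl⟩

theorem isTargetValue_iff (hP : B.IsLaw P) (hc : B.ConditionAt P) {α ρ q t : 𝒮 × 𝒜 → ℝ} {ψ : ℝ}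
    (hα : B.IsRieszRepresenter P α ρ) (hq : B.IsBellmanProjection P q t) :
    B.IsTargetValue P ψ ↔ ψ = ∫ z, ρ z * t z ∂(saLaw P) := by
  constructor
  · rintro ⟨q', t', hq', hm⟩
    rw [(meanExt_iff hP hc hα hq'.1).1 hm]
    refine integral_congr_ae ?_
    filter_upwards [hq'.ae_eq hP hq] with z hz
    rw [hz]
  · intro h
    exact ⟨q, t, hq, (meanExt_iff hP hc hα hq.1).2 h⟩

theorem ConditionAt.existsUnique_isTargetValue (hP : B.IsLaw P) (hc : B.ConditionAt P) :
    ∃! ψ : ℝ, B.IsTargetValue P ψ := by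
  obtain ⟨α, ρ, hα⟩ := hc.exists_isRieszRepresenter hP
  obtain ⟨q, t, hq⟩ := hc.exists_isBellmanProjection hP
  exact ⟨_, (isTargetValue_iff hP hc hα hq).2 rfl, fun ψ hψ => (isTargetValue_iff hP hc hα hq).1 hψ⟩

theorem ConditionAt.isTargetValue_target (hP : B.IsLaw P) (hc : B.ConditionAt P) :
    B.IsTargetValue P (B.target P) :=
  Classical.epsilon_spec (hc.existsUnique_isTargetValue hP).exists

theorem target_eq (hP : B.IsLaw P) (hc : B.ConditionAt P) {α ρ q t : 𝒮 × 𝒜 → ℝ}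
    (hα : B.IsRieszRepresenter P α ρ) (hq : B.IsBellmanProjection P q t) :
    B.target P = ∫ w, ρ (stateAction w) * t (stateAction w) ∂P := by
  rw [(isTargetValue_iff hP hc hα hq).1 (hc.isTargetValue_target hP), integral_mul_saLaw hα.memLp]
  obtain ⟨_, _, ht, _⟩ := hq.1
  exact ht

end BellmanProblem

/-! ### Bilinear expansions of L² pairings -/

section Bilinear

variable {Ω : Type*} [MeasurableSpace Ω] {μ : Measure Ω} {a b c d e f : Ω → ℝ}

theorem integral_mul_sub (ha : MemLp a 2 μ) (hc : MemLp c 2 μ) (hd : MemLp d 2 μ) :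
    ∫ x, a x * (c x - d x) ∂μ = ∫ x, a x * c x ∂μ - ∫ x, a x * d x ∂μ := by
  rw [← integral_sub (integrable_mul_of_memLp_two ha hc) (integrable_mul_of_memLp_two ha hd)]
  simp only [mul_sub]

theorem integral_sub_mul (ha : MemLp a 2 μ) (hb : MemLp b 2 μ) (hc : MemLp c 2 μ) :
    ∫ x, (a x - b x) * c x ∂μ = ∫ x, a x * c x ∂μ - ∫ x, b x * c x ∂μ := by
  rw [← integral_sub (integrable_mul_of_memLp_two ha hc) (integrable_mul_of_memLp_two hb hc)]
  simp only [sub_mul]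

theorem integral_sub_mul_sub (ha : MemLp a 2 μ) (hb : MemLp b 2 μ) (hc : MemLp c 2 μ)
    (hd : MemLp d 2 μ) :
    ∫ x, (a x - b x) * (c x - d x) ∂μ = ∫ x, a x * c x ∂μ - ∫ x, a x * d x ∂μ
      - (∫ x, b x * c x ∂μ - ∫ x, b x * d x ∂μ) := by
  rw [← integral_mul_sub ha hc hd, ← integral_mul_sub hb hc hd]
  exact integral_sub_mul (c := fun x => c x - d x) ha hb (hc.sub hd)

theorem integral_sub_mul_sub_add_sub (ha : MemLp a 2 μ) (hb : MemLp b 2 μ) (hc : MemLp c 2 μ)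
    (hd : MemLp d 2 μ) (he : MemLp e 2 μ) (hf : MemLp f 2 μ) :
    ∫ x, (a x - b x) * (c x - d x + e x - f x) ∂μ
      = ∫ x, a x * c x ∂μ - ∫ x, a x * d x ∂μ - (∫ x, b x * c x ∂μ - ∫ x, b x * d x ∂μ)
      + (∫ x, a x * e x ∂μ - ∫ x, a x * f x ∂μ - (∫ x, b x * e x ∂μ - ∫ x, b x * f x ∂μ)) := by
  have i1 : Integrable (fun x => (a x - b x) * (c x - d x)) μ :=
    integrable_mul_of_memLp_two (ha.sub hb) (hc.sub hd)
  have i2 : Integrable (fun x => (a x - b x) * (e x - f x)) μ :=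
    integrable_mul_of_memLp_two (ha.sub hb) (he.sub hf)
  rw [← integral_sub_mul_sub ha hb hc hd, ← integral_sub_mul_sub ha hb he hf, ← integral_add i1 i2]
  refine integral_congr_ae (Eventually.of_forall fun x => ?_)
  simp only; ring

end Bilinear

/-! ### Von Mises expansions -/

namespace BellmanProblem

variable {𝒮 𝒜 : Type*} [MeasurableSpace 𝒮] [MeasurableSpace 𝒜] {B : BellmanProblem 𝒮 𝒜}
  {P : Measure (Transition 𝒮 𝒜)}

/-- In the weak sense, `t` is the conditional mean of `f(A₀, S₀) - v(S₁)` given `(A₀, S₀)`. -/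
structure IsWeakBellman (P : Measure (Transition 𝒮 𝒜)) (f : 𝒮 × 𝒜 → ℝ) (v : 𝒮 → ℝ)
    (t : 𝒮 × 𝒜 → ℝ) : Prop where
  memLp : MemLp f 2 (saLaw P)
  memLp_image : MemLp t 2 (saLaw P)
  integrable : ∀ s, MemLp s 2 (saLaw P) →
    Integrable (fun w => s (stateAction w) * v (nextState w)) P
  integral_eq : ∀ s, MemLp s 2 (saLaw P) →
    ∫ w, s (stateAction w) * (f (stateAction w) - v (nextState w)) ∂P
      = ∫ w, s (stateAction w) * t (stateAction w) ∂P

theorem IsWeakBellman.integrable_sub {f : 𝒮 × 𝒜 → ℝ} {v : 𝒮 → ℝ} {t s : 𝒮 × 𝒜 → ℝ}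
    (h : IsWeakBellman P f v t) (hs : MemLp s 2 (saLaw P)) :
    Integrable (fun w => s (stateAction w) * (f (stateAction w) - v (nextState w))) P := by
  refine ((integrable_mul_of_memLp_two (memLp_comp_stateAction hs)
    (memLp_comp_stateAction h.memLp)).sub (h.integrable s hs)).congr
    (Eventually.of_forall fun w => ?_)
  simp only [Pi.sub_apply]; ring

theorem IsLaw.isWeakBellman (hP : B.IsLaw P) {h : Lp ℝ ∞ B.dom} (hh : h ∈ B.H) :
    IsWeakBellman P h (fun s => B.γ * B.value h s) (B.bellman P h) := by
  have := hP.prob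
  refine ⟨hP.isLinOn_coe.memLp h hh, hP.isLinOn_bellman.memLp h hh, fun s hs => ?_,
    fun s hs => (integral_mul_bellman hP.dom hP.next h hs).symm⟩
  exact integrable_mul_of_memLp_two (memLp_comp_stateAction hs)
    ((memLp_value_next hP.next 2 h).const_mul B.γ)

/-- The mean of the influence function with arbitrary nuisance functions. -/
theorem integral_influenceFn (hP : B.IsLaw P) {η : NuisanceFns 𝒮 𝒜} {T₀α T₀q : 𝒮 × 𝒜 → ℝ} (ψ : ℝ)
    (hα : IsWeakBellman P η.α η.Vα T₀α) (hq : IsWeakBellman P η.q η.Vq T₀q)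
    (hTα : MemLp η.Tα 2 (saLaw P)) (hTq : MemLp η.Tq 2 (saLaw P)) (hr : MemLp η.r 2 (saLaw P))
    (hm : Integrable η.mq (saLaw P)) :
    Integrable (influenceFn η ψ) P ∧
    ∫ w, influenceFn η ψ w ∂P =
      ∫ z, η.Tα z * rewardFn P z ∂(saLaw P) - ∫ z, η.Tα z * T₀q z ∂(saLaw P)
      + ∫ z, (T₀α z - η.Tα z) * (η.r z - η.Tq z) ∂(saLaw P)
      + ∫ z, η.mq z ∂(saLaw P) - ψ := by
  have := hP.prob
  have hu : MemLp (fun z => η.r z - η.Tq z) 2 (saLaw P) := hr.sub hTq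
  have hTαP := memLp_comp_stateAction hTα
  have huP := memLp_comp_stateAction hu
  have i1 := integrable_mul_of_memLp_two hTαP hP.memLp_outcome
  have i2 := hq.integrable_sub hTα
  have i3 := hα.integrable_sub hu
  have i4 := integrable_mul_of_memLp_two huP hTαP
  have i5 := integrable_comp_stateAction hm
  have e : influenceFn η ψ = fun w => η.Tα (stateAction w) * outcome w
      - η.Tα (stateAction w) * (η.q (stateAction w) - η.Vq (nextState w))
      + (η.r (stateAction w) - η.Tq (stateAction w))
        * (η.α (stateAction w) - η.Vα (nextState w))
      - (η.r (stateAction w) - η.Tq (stateAction w)) * η.Tα (stateAction w)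
      + η.mq (stateAction w) - ψ := by
    funext w
    simp only [influenceFn]; ring
  have j1 : Integrable (fun w => η.Tα (stateAction w) * outcome w
      - η.Tα (stateAction w) * (η.q (stateAction w) - η.Vq (nextState w))) P := i1.sub i2
  have j2 : Integrable (fun w => η.Tα (stateAction w) * outcome w
      - η.Tα (stateAction w) * (η.q (stateAction w) - η.Vq (nextState w))
      + (η.r (stateAction w) - η.Tq (stateAction w))
        * (η.α (stateAction w) - η.Vα (nextState w))) P := j1.add i3
  have j3 : Integrable (fun w => η.Tα (stateAction w) * outcome w
      - η.Tα (stateAction w) * (η.q (stateAction w) - η.Vq (nextState w))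
      + (η.r (stateAction w) - η.Tq (stateAction w))
        * (η.α (stateAction w) - η.Vα (nextState w))
      - (η.r (stateAction w) - η.Tq (stateAction w)) * η.Tα (stateAction w)) P := j2.sub i4
  have j4 : Integrable (fun w => η.Tα (stateAction w) * outcome w
      - η.Tα (stateAction w) * (η.q (stateAction w) - η.Vq (nextState w))
      + (η.r (stateAction w) - η.Tq (stateAction w))
        * (η.α (stateAction w) - η.Vα (nextState w))
      - (η.r (stateAction w) - η.Tq (stateAction w)) * η.Tα (stateAction w)
      + η.mq (stateAction w)) P := j3.add i5
  refine ⟨by rw [e]; exact j4.sub (integrable_const ψ), ?_⟩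
  have e1 := hP.integral_mul_rewardFn hTα
  have e2 := hq.integral_eq _ hTα
  have e3 := hα.integral_eq _ hu
  rw [e, integral_sub j4 (integrable_const ψ), integral_add j3 i5, integral_sub j2 i4,
    integral_add j1 i3, integral_sub i1 i2, integral_const, probReal_univ, one_smul, ← e1, e2, e3,
    ← integral_mul_saLaw hTα hP.memLp_rewardFn, ← integral_mul_saLaw hTα hq.memLp_image,
    ← integral_mul_saLaw hu hα.memLp_image, ← integral_mul_saLaw hu hTα, integral_saLaw P hm.1,
    integral_sub_mul (c := fun z => η.r z - η.Tq z) hα.memLp_image hTα hu]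
  simp only [mul_comm]
  ring

/-- The von Mises expansion, with arbitrary nuisance functions. -/
theorem vonMises_expansion (hP : B.IsLaw P) (hc : B.ConditionAt P)
    {α₀ ρ₀ q₀ t₀ : 𝒮 × 𝒜 → ℝ} (hα₀ : B.IsRieszRepresenter P α₀ ρ₀)
    (hq₀ : B.IsBellmanProjection P q₀ t₀)
    {η : NuisanceFns 𝒮 𝒜} {T₀α T₀q : 𝒮 × 𝒜 → ℝ} (ψ : ℝ)
    (hα : IsWeakBellman P η.α η.Vα T₀α) (hq : IsWeakBellman P η.q η.Vq T₀q)
    (hTα : MemLp η.Tα 2 (saLaw P)) (hTq : MemLp η.Tq 2 (saLaw P)) (hr : MemLp η.r 2 (saLaw P))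
    (hm : Integrable η.mq (saLaw P))
    (hmean : ∫ z, η.mq z ∂(saLaw P) = ∫ z, ρ₀ z * T₀q z ∂(saLaw P))
    (hαext : B.BellmanExt P η.α T₀α) :
    ψ - B.target P = -(∫ w, influenceFn η ψ w ∂P)
      + ((∫ z, (η.Tα z - ρ₀ z) * (t₀ z - T₀q z) ∂(saLaw P))
        + ∫ z, (η.Tα z - T₀α z) * (rewardFn P z - η.r z + η.Tq z - t₀ z) ∂(saLaw P)) := by
  have ht₀ : MemLp t₀ 2 (saLaw P) := by obtain ⟨_, _, ht, _⟩ := hq₀.1; exact ht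
  have hr₀ := hP.memLp_rewardFn
  have hT₀α := hα.memLp_image
  -- After expansion both sides differ exactly by ⟨T₀α, r₀ − t₀⟩, which is zero because T₀α is a
  -- Bellman image and t₀ the projection.
  have ho := hq₀.orthogonal hP hαext
  have ho' : ∫ z, T₀α z * rewardFn P z ∂(saLaw P) - ∫ z, T₀α z * t₀ z ∂(saLaw P) = 0 := by
    rw [← ho, integral_mul_saLaw hT₀α hr₀, integral_mul_saLaw hT₀α ht₀,
      hP.integral_mul_rewardFn hT₀α]
    exact (integral_mul_sub (memLp_comp_stateAction hT₀α) hP.memLp_outcome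
      (memLp_comp_stateAction ht₀)).symm
  rw [(integral_influenceFn hP ψ hα hq hTα hTq hr hm).2, hmean, target_eq hP hc hα₀ hq₀,
    ← integral_mul_saLaw hα₀.memLp ht₀, integral_sub_mul_sub hT₀α hTα hr hTq,
    integral_sub_mul_sub hTα hα₀.memLp ht₀ hq.memLp_image,
    integral_sub_mul_sub_add_sub hTα hT₀α hr₀ hr hTq ht₀]
  linarith

/-- The rearrangement of the remainder of the von Mises expansion. -/
theorem vonMises_remainder_eq {μ : Measure (𝒮 × 𝒜)} {Tα ρ₀ t₀ T₀q T₀α r₀ r Tq : 𝒮 × 𝒜 → ℝ}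
    (hTα : MemLp Tα 2 μ) (hρ₀ : MemLp ρ₀ 2 μ) (ht₀ : MemLp t₀ 2 μ) (hT₀q : MemLp T₀q 2 μ)
    (hT₀α : MemLp T₀α 2 μ) (hr₀ : MemLp r₀ 2 μ) (hr : MemLp r 2 μ) (hTq : MemLp Tq 2 μ) :
    (∫ z, (Tα z - ρ₀ z) * (t₀ z - T₀q z) ∂μ)
      + ∫ z, (Tα z - T₀α z) * (r₀ z - r z + Tq z - t₀ z) ∂μ
    = (∫ z, (T₀α z - ρ₀ z) * (t₀ z - T₀q z) ∂μ) + (∫ z, (Tα z - T₀α z) * (r₀ z - r z) ∂μ)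
      + ∫ z, (Tα z - T₀α z) * (Tq z - T₀q z) ∂μ := by
  rw [integral_sub_mul_sub hTα hρ₀ ht₀ hT₀q, integral_sub_mul_sub_add_sub hTα hT₀α hr₀ hr hTq ht₀,
    integral_sub_mul_sub hT₀α hρ₀ ht₀ hT₀q, integral_sub_mul_sub hTα hT₀α hr₀ hr,
    integral_sub_mul_sub hTα hT₀α hTq hT₀q]
  ring

/-- With q and α in H itself, all functions involved are bounded or covered by (C1)(i), and the weak
Bellman identity needs no extension of γV^π. This is why (C1) at P₀ alone suffices. -/
theorem vonMises_estimated {P₀ : Measure (Transition 𝒮 𝒜)} (hP₀ : B.IsLaw P₀)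
    (hc : B.ConditionAt P₀) {α₀ ρ₀ q₀ t₀ : 𝒮 × 𝒜 → ℝ} (hα₀ : B.IsRieszRepresenter P₀ α₀ ρ₀)
    (hq₀ : B.IsBellmanProjection P₀ q₀ t₀) {q α : Lp ℝ ∞ B.dom} (hq : q ∈ B.H) (hα : α ∈ B.H)
    (r : Lp ℝ ∞ B.dom) (T : Lp ℝ ∞ B.dom → Lp ℝ ∞ B.dom) (ψ : ℝ) :
    Integrable (influenceFn (B.estimatedNuisance T α q r) ψ) P₀ ∧
    ψ - B.target P₀ = -(∫ w, influenceFn (B.estimatedNuisance T α q r) ψ w ∂P₀)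
      + ((∫ z, (B.bellman P₀ α z - ρ₀ z) * (t₀ z - B.bellman P₀ q z) ∂(saLaw P₀))
        + (∫ z, (T α z - B.bellman P₀ α z) * (rewardFn P₀ z - r z) ∂(saLaw P₀))
        + ∫ z, (T α z - B.bellman P₀ α z) * (T q z - B.bellman P₀ q z) ∂(saLaw P₀)) := by
  have := hP₀.prob
  have ht₀ : MemLp t₀ 2 (saLaw P₀) := by obtain ⟨_, _, ht, _⟩ := hq₀.1; exact ht
  have hTα := memLp_coe hP₀.dom 2 (T α)
  have hTq := memLp_coe hP₀.dom 2 (T q)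
  have hr := memLp_coe hP₀.dom 2 r
  have hm := hc.functional_integrable q hq
  have wα := hP₀.isWeakBellman hα
  have wq := hP₀.isWeakBellman hq
  refine ⟨(integral_influenceFn (η := B.estimatedNuisance T α q r) hP₀ ψ wα wq hTα hTq hr hm).1, ?_⟩
  rw [← vonMises_remainder_eq hTα hα₀.memLp ht₀ wq.memLp_image wα.memLp_image
    hP₀.memLp_rewardFn hr hTq]
  exact vonMises_expansion (η := B.estimatedNuisance T α q r) hP₀ hc hα₀ hq₀ ψ wα wq hTα hTq hr hm
    (hα₀.2 q hq).symm (ExtRel.of_mem hP₀ hP₀.isLinOn_bellman hα)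

/-- If the reward function is itself a Bellman image, the residual Y₀ − r is orthogonal to all
functions of (A₀, S₀), so q is a projection. -/
theorem ConditionAt.target_eq_of_bellman_eq (hP : B.IsLaw P) (hc : B.ConditionAt P)
    {q : Lp ℝ ∞ B.dom} (hq : q ∈ B.H) (he : B.bellman P q =ᵐ[saLaw P] rewardFn P) :
    B.target P = ∫ z, B.m q z ∂(saLaw P) := by
  have hqe : B.BellmanExt P q (B.bellman P q) := ExtRel.of_mem hP hP.isLinOn_bellman hq
  have hproj : B.IsBellmanProjection P q (B.bellman P q) := by
    refine isBellmanProjection_of_orthogonal hP hqe fun h hh => ?_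
    have hb := hP.isLinOn_bellman.memLp h hh
    have hbP := memLp_comp_stateAction hb
    rw [integral_mul_sub hbP hP.memLp_outcome
      (memLp_comp_stateAction (hP.isLinOn_bellman.memLp q hq)), ← hP.integral_mul_rewardFn hb,
      sub_eq_zero]
    refine integral_congr_ae ?_
    filter_upwards [(stateAction_quasi P).ae he] with w hw
    rw [hw]
  obtain ⟨α, ρ, hα⟩ := hc.exists_isRieszRepresenter hP
  rw [(isTargetValue_iff hP hc hα hproj).1 (hc.isTargetValue_target hP)]
  exact hα.2 q hq

end BellmanProblem

/-! ### Laws with density close to one, and uniform boundedness -/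

section Near

variable {Ω : Type*} [MeasurableSpace Ω] {P Q : Measure Ω} {η : ℝ}

/-- `Q` has a density with respect to `P` that is uniformly within `η` of one. -/
structure IsNear (P Q : Measure Ω) (η : ℝ) : Prop where
  prob : IsProbabilityMeasure P
  prob' : IsProbabilityMeasure Q
  ac : Q ≪ P
  le_half : η ≤ 1 / 2
  dens : ∀ᵐ w ∂P, |(Q.rnDeriv P w).toReal - 1| ≤ η

theorem isNear_refl (P : Measure Ω) [hP : IsProbabilityMeasure P] : IsNear P P 0 := by
  refine ⟨hP, hP, Measure.AbsolutelyContinuous.rfl, by norm_num, ?_⟩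
  filter_upwards [Measure.rnDeriv_self P] with w hw
  simp [hw]

theorem IsNear.nonneg (h : IsNear P Q η) : 0 ≤ η := by
  have := h.prob
  obtain ⟨w, hw⟩ := h.dens.exists
  exact (abs_nonneg _).trans hw

/-- The density lies in [1/2, 3/2]. Together with the reverse comparison, this makes the L² norms of
P and Q equivalent, so H has the same closure under both. -/
theorem IsNear.le_two_smul (h : IsNear P Q η) : Q ≤ (2 : ℝ≥0∞) • P := by
  have := h.prob
  have := h.prob'
  refine Measure.le_iff.2 fun s hs => ?_
  rw [← Measure.setLIntegral_rnDeriv h.ac, Measure.smul_apply, smul_eq_mul, ← setLIntegral_const]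
  refine setLIntegral_mono_ae' hs ?_
  filter_upwards [h.dens, Measure.rnDeriv_ne_top Q P] with w hw hw' _
  rw [← ENNReal.toReal_le_toReal hw' (by norm_num)]
  have := h.le_half
  have := (abs_le.1 hw).2
  simp only [ENNReal.toReal_ofNat]
  linarith

theorem IsNear.ge_two_smul (h : IsNear P Q η) : P ≤ (2 : ℝ≥0∞) • Q := by
  have := h.prob
  have := h.prob'
  refine Measure.le_iff.2 fun s hs => ?_
  rw [Measure.smul_apply, smul_eq_mul, ← Measure.setLIntegral_rnDeriv h.ac,
    ← lintegral_const_mul _ (Measure.measurable_rnDeriv Q P), ← one_mul (P s),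
    ← setLIntegral_const]
  refine setLIntegral_mono_ae' hs ?_
  filter_upwards [h.dens, Measure.rnDeriv_ne_top Q P] with w hw hw' _
  rw [← ENNReal.toReal_le_toReal (by norm_num) (ENNReal.mul_ne_top (by norm_num) hw'),
    ENNReal.toReal_mul]
  have := h.le_half
  have := (abs_le.1 hw).1
  simp only [ENNReal.toReal_ofNat, ENNReal.toReal_one]
  linarith

theorem eLpNorm_le_two_mul {E : Type*} [NormedAddCommGroup E] {p : ℝ≥0∞} (hp : 1 ≤ p)
    (hp' : p ≠ ∞) (h : Q ≤ (2 : ℝ≥0∞) • P) (f : Ω → E) :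
    eLpNorm f p Q ≤ 2 * eLpNorm f p P := by
  refine (eLpNorm_mono_measure f h).trans ?_
  rw [eLpNorm_smul_measure_of_ne_top hp', smul_eq_mul]
  gcongr
  have h1 : (1 / p).toReal ≤ 1 := by
    rw [← ENNReal.toReal_one]
    exact ENNReal.toReal_mono ENNReal.one_ne_top (by simpa using hp)
  calc (2 : ℝ≥0∞) ^ (1 / p).toReal ≤ 2 ^ (1 : ℝ) :=
        ENNReal.rpow_le_rpow_of_exponent_le (by norm_num) h1
    _ = 2 := by simp

theorem memLp_of_le_two_smul {E : Type*} [NormedAddCommGroup E] {p : ℝ≥0∞}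
    (h : Q ≤ (2 : ℝ≥0∞) • P) {f : Ω → E} (hf : MemLp f p P) : MemLp f p Q :=
  (hf.smul_measure (by norm_num)).mono_measure h

theorem IsNear.integrable (h : IsNear P Q η) {f : Ω → ℝ} (hf : Integrable f P) : Integrable f Q :=
  memLp_one_iff_integrable.1 (memLp_of_le_two_smul h.le_two_smul (memLp_one_iff_integrable.2 hf))

theorem IsNear.ae_abs_mul_le (h : IsNear P Q η) (f : Ω → ℝ) :
    ∀ᵐ w ∂P, ‖((Q.rnDeriv P w).toReal - 1) * f w‖ ≤ η * |f w| := by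
  filter_upwards [h.dens] with w hw
  rw [norm_mul]
  exact mul_le_mul_of_nonneg_right hw (abs_nonneg _)

theorem IsNear.integrable_mul (h : IsNear P Q η) {f : Ω → ℝ} (hf : Integrable f P) :
    Integrable (fun w => ((Q.rnDeriv P w).toReal - 1) * f w) P :=
  (hf.abs.const_mul η).mono' ((((Measure.measurable_rnDeriv Q P).ennreal_toReal.sub_const
    1).aestronglyMeasurable).mul hf.1) (h.ae_abs_mul_le f)

theorem IsNear.integral_sub (h : IsNear P Q η) {f : Ω → ℝ} (hf : Integrable f P) :
    ∫ w, f w ∂Q - ∫ w, f w ∂P = ∫ w, ((Q.rnDeriv P w).toReal - 1) * f w ∂P := by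
  have := h.prob
  have := h.prob'
  have h1 : ∫ w, (((Q.rnDeriv P w).toReal - 1) * f w + f w) ∂P = ∫ w, f w ∂Q := by
    rw [← integral_rnDeriv_smul h.ac]
    refine integral_congr_ae (Eventually.of_forall fun w => ?_)
    simp only [smul_eq_mul]; ring
  rw [← h1, integral_add (h.integrable_mul hf) hf]
  ring

/-- The source of all gains of a factor η below: a function of mean zero under P has mean at most
η·E_P|f| under Q. -/
theorem IsNear.abs_integral_sub_le (h : IsNear P Q η) {f : Ω → ℝ} (hf : Integrable f P) :
    |∫ w, f w ∂Q - ∫ w, f w ∂P| ≤ η * ∫ w, |f w| ∂P := by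
  rw [h.integral_sub hf, ← integral_const_mul]
  exact norm_integral_le_of_norm_le (hf.abs.const_mul η) (h.ae_abs_mul_le f)

theorem IsNear.integral_abs_le (h : IsNear P Q η) {f : Ω → ℝ} (hf : Integrable f P) :
    ∫ w, |f w| ∂Q ≤ 2 * ∫ w, |f w| ∂P := by
  have h1 := (abs_le.1 (h.abs_integral_sub_le hf.abs)).2
  have h2 : 0 ≤ ∫ w, |f w| ∂P := integral_nonneg fun w => abs_nonneg _
  simp only [abs_abs] at h1
  nlinarith [h.le_half]

theorem IsNear.integral_mul_self_le (h : IsNear P Q η) {f : Ω → ℝ} (hf : MemLp f 2 P) :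
    ∫ w, f w * f w ∂P ≤ 2 * ∫ w, f w * f w ∂Q := by
  have h1 := (abs_le.1 (h.abs_integral_sub_le (integrable_mul_of_memLp_two hf hf))).1
  have h2 : 0 ≤ ∫ w, f w * f w ∂P := integral_nonneg fun w => mul_self_nonneg _
  simp only [abs_mul_self] at h1
  nlinarith [h.le_half]

/-- Factor x − y = (√x − √y)(√x + √y) and use |√x − √y| ≤ √x + √y. -/
theorem sq_sqrt_sub_sqrt_le {x y : ℝ} (hx : 0 ≤ x) (hy : 0 ≤ y) : (√x - √y) ^ 2 ≤ |x - y| := by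
  have h1 : x - y = (√x - √y) * (√x + √y) := by
    nlinarith [Real.mul_self_sqrt hx, Real.mul_self_sqrt hy]
  rw [h1, abs_mul, ← sq_abs, sq]
  refine mul_le_mul_of_nonneg_left ?_ (abs_nonneg _)
  rw [abs_of_nonneg (add_nonneg (Real.sqrt_nonneg x) (Real.sqrt_nonneg y))]
  exact abs_le.2 ⟨by linarith [Real.sqrt_nonneg x, Real.sqrt_nonneg y],
    by linarith [Real.sqrt_nonneg x, Real.sqrt_nonneg y]⟩

/-- The squared Hellinger distance is at most half of ∫|dQ − dP|, hence at most η/2. -/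
theorem IsNear.hellingerDist_lt (h : IsNear P Q η) {δ : ℝ} (hδ : 0 < δ) (hη : η < δ ^ 2) :
    hellingerDist Q P < δ := by
  have := h.prob
  have := h.prob'
  have hη0 := h.nonneg
  have hPQ : P ≪ Q + P := Measure.AbsolutelyContinuous.rfl.add_right' _
  have hd : ∀ᵐ w ∂(Q + P), |(Q.rnDeriv P w).toReal - 1| ≤ η :=
    ae_add_measure_iff.2 ⟨h.ac.ae_le h.dens, h.dens⟩
  have hbound : ∀ᵐ w ∂(Q + P), (√((Q.rnDeriv (Q + P) w).toReal)
      - √((P.rnDeriv (Q + P) w).toReal)) ^ 2 ≤ η * (P.rnDeriv (Q + P) w).toReal := by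
    filter_upwards [hd, Measure.rnDeriv_mul_rnDeriv (κ := Q + P) h.ac] with w hw hw'
    refine (sq_sqrt_sub_sqrt_le ENNReal.toReal_nonneg ENNReal.toReal_nonneg).trans ?_
    rw [← hw', Pi.mul_apply, ENNReal.toReal_mul, ← sub_one_mul, abs_mul,
      abs_of_nonneg (ENNReal.toReal_nonneg (a := P.rnDeriv (Q + P) w))]
    exact mul_le_mul_of_nonneg_right hw ENNReal.toReal_nonneg
  have hint : ∫ w, (√((Q.rnDeriv (Q + P) w).toReal)
      - √((P.rnDeriv (Q + P) w).toReal)) ^ 2 ∂(Q + P) ≤ η := by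
    refine (integral_mono_of_nonneg (Eventually.of_forall fun w => sq_nonneg _)
      (Measure.integrable_toReal_rnDeriv.const_mul η) hbound).trans ?_
    rw [integral_const_mul, Measure.integral_toReal_rnDeriv hPQ, probReal_univ, mul_one]
  unfold hellingerDist
  rw [Real.sqrt_lt' hδ]
  linarith

theorem isNear_withDensity [hP : IsProbabilityMeasure P] {φ : Ω → ℝ} (hφ : Measurable φ)
    (hb : ∀ w, |φ w| ≤ η) (hη : η ≤ 1 / 2)
    (hQ : IsProbabilityMeasure (P.withDensity fun w => ENNReal.ofReal (1 + φ w))) :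
    IsNear P (P.withDensity fun w => ENNReal.ofReal (1 + φ w)) η ∧
    ∀ᵐ w ∂P, ((P.withDensity fun w => ENNReal.ofReal (1 + φ w)).rnDeriv P w).toReal - 1 = φ w := by
  have h1 : ∀ᵐ w ∂P,
      ((P.withDensity fun w => ENNReal.ofReal (1 + φ w)).rnDeriv P w).toReal - 1 = φ w := by
    filter_upwards [Measure.rnDeriv_withDensity P (f := fun w => ENNReal.ofReal (1 + φ w))
      (by fun_prop)] with w hw
    have := (abs_le.1 (hb w)).1
    rw [hw, ENNReal.toReal_ofReal (by linarith)]
    ring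
  refine ⟨⟨hP, hQ, withDensity_absolutelyContinuous _ _, hη, ?_⟩, h1⟩
  filter_upwards [h1] with w hw
  rw [hw]
  exact hb w

/-- A form of the uniform boundedness principle: functions that are bounded against each bounded
measurable function are bounded in `L¹`. -/
theorem exists_integral_abs_le [IsProbabilityMeasure P] {ι : Type*} {g : ι → Ω → ℝ} {N : ι → ℝ}
    (hg : ∀ i, Integrable (g i) P) (hN : ∀ i, 0 ≤ N i)
    (h : ∀ ψ : Ω → ℝ, Measurable ψ → (∃ M : ℝ, ∀ w, |ψ w| ≤ M) →
      ∃ C : ℝ, ∀ i, |∫ w, ψ w * g i w ∂P| ≤ C * N i) :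
    ∃ C : ℝ, ∀ i, ∫ w, |g i w| ∂P ≤ C * N i := by
  have hint : ∀ (i : ι) (ψ : Lp ℝ ∞ P), Integrable (fun w => ψ w * g i w) P := fun i ψ =>
    (hg i).bdd_mul (c := ‖ψ‖) (Lp.stronglyMeasurable ψ).aestronglyMeasurable
      (ae_norm_le_norm_Lp_top ψ)
  -- Dividing by N i turns the hypothesis into pointwise boundedness of functionals on L^∞. If N i =
  -- 0, the convention 0⁻¹ = 0 makes Λ i zero, so such indices need a separate argument at the end.
  let Λ : ι → Lp ℝ ∞ P →L[ℝ] ℝ := fun i => LinearMap.mkContinuous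
    { toFun := fun ψ => (N i)⁻¹ * ∫ w, ψ w * g i w ∂P
      map_add' := fun ψ ψ' => by
        rw [← mul_add, ← integral_add (hint i ψ) (hint i ψ')]
        congr 1
        refine integral_congr_ae ?_
        filter_upwards [Lp.coeFn_add ψ ψ'] with w hw
        rw [hw, Pi.add_apply, add_mul]
      map_smul' := fun x ψ => by
        have e : ∫ w, (x • ψ : Lp ℝ ∞ P) w * g i w ∂P = x * ∫ w, ψ w * g i w ∂P := by
          rw [← integral_const_mul]
          refine integral_congr_ae ?_
          filter_upwards [Lp.coeFn_smul x ψ] with w hw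
          rw [hw, Pi.smul_apply, smul_eq_mul, mul_assoc]
        rw [RingHom.id_apply, smul_eq_mul, e, mul_left_comm] }
    ((N i)⁻¹ * ∫ w, |g i w| ∂P) (fun ψ => by
      simp only [LinearMap.coe_mk, AddHom.coe_mk]
      rw [norm_mul, Real.norm_of_nonneg (inv_nonneg.2 (hN i)), mul_assoc]
      refine mul_le_mul_of_nonneg_left ?_ (inv_nonneg.2 (hN i))
      rw [mul_comm, ← integral_const_mul]
      refine norm_integral_le_of_norm_le ((hg i).abs.const_mul _) ?_
      filter_upwards [ae_norm_le_norm_Lp_top ψ] with w hw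
      rw [norm_mul]
      exact mul_le_mul_of_nonneg_right hw (abs_nonneg _))
  have hΛ : ∀ i ψ, Λ i ψ = (N i)⁻¹ * ∫ w, ψ w * g i w ∂P := fun i ψ => rfl
  have hpt : ∀ ψ, ∃ C, ∀ i, ‖Λ i ψ‖ ≤ C := fun ψ => by
    -- The hypothesis asks for a bound at every point; truncating at ±‖ψ‖ changes ψ only on a null
    -- set.
    obtain ⟨C, hC⟩ := h (fun w => max (-‖ψ‖) (min (ψ w) ‖ψ‖))
      (measurable_const.max ((Lp.stronglyMeasurable ψ).measurable.min measurable_const))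
      ⟨‖ψ‖, fun w => abs_le.2 ⟨le_max_left _ _,
        max_le (by linarith [norm_nonneg ψ]) (min_le_right _ _)⟩⟩
    refine ⟨|C|, fun i => ?_⟩
    have e : ∫ w, ψ w * g i w ∂P = ∫ w, max (-‖ψ‖) (min (ψ w) ‖ψ‖) * g i w ∂P := by
      refine integral_congr_ae ?_
      filter_upwards [ae_norm_le_norm_Lp_top ψ] with w hw
      rw [Real.norm_eq_abs, abs_le] at hw
      rw [min_eq_left hw.2, max_eq_right hw.1]
    rw [hΛ, e, norm_mul, Real.norm_of_nonneg (inv_nonneg.2 (hN i))]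
    rcases (hN i).eq_or_lt with h0 | h0
    · rw [← h0]; simp
    · rw [inv_mul_eq_div, div_le_iff₀ h0]
      exact (hC i).trans (mul_le_mul_of_nonneg_right (le_abs_self C) h0.le)
  obtain ⟨C', hC'⟩ := banach_steinhaus hpt
  refine ⟨C', fun i => ?_⟩
  let σ : Ω → ℝ := fun w => if 0 ≤ (hg i).1.mk (g i) w then 1 else -1
  have hσm : Measurable σ := Measurable.ite
    (measurableSet_le measurable_const (hg i).1.stronglyMeasurable_mk.measurable)
    measurable_const measurable_const
  have hσb : ∀ w, |σ w| ≤ 1 := fun w => by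
    by_cases h0 : 0 ≤ (hg i).1.mk (g i) w <;> simp [σ, h0]
  have hσ : ∀ᵐ w ∂P, σ w * g i w = |g i w| := by
    filter_upwards [(hg i).1.ae_eq_mk] with w hw
    by_cases h0 : 0 ≤ (hg i).1.mk (g i) w
    · simp only [σ, h0, if_true, one_mul]
      rw [abs_of_nonneg (hw ▸ h0)]
    · simp only [σ, h0, if_false, neg_mul, one_mul]
      rw [abs_of_neg (hw ▸ not_le.1 h0)]
  -- The L¹ norm is reached by testing at the sign σ of g i. When N i = 0 the hypothesis at σ
  -- already gives zero; otherwise the uniform operator bound applies, as σ has norm at most one.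
  rcases (hN i).eq_or_lt with h0 | h0
  · obtain ⟨C, hC⟩ := h σ hσm ⟨1, hσb⟩
    have := hC i
    rw [integral_congr_ae hσ, ← h0, mul_zero] at this
    rw [← h0, mul_zero]
    exact (le_abs_self _).trans this
  · have hσL : MemLp σ ∞ P := MemLp.of_bound hσm.aestronglyMeasurable 1 (Eventually.of_forall hσb)
    have hσn : ‖hσL.toLp‖ ≤ 1 := by
      have := Lp.norm_le_of_ae_bound (f := hσL.toLp) zero_le_one (by
        filter_upwards [hσL.coeFn_toLp] with w hw
        rw [hw]; exact hσb w)
      simpa using this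
    have h1 : Λ i hσL.toLp = (N i)⁻¹ * ∫ w, |g i w| ∂P := by
      rw [hΛ, ← integral_congr_ae hσ]
      congr 1
      refine integral_congr_ae ?_
      filter_upwards [hσL.coeFn_toLp] with w hw
      rw [hw]
    have h2 : Λ i hσL.toLp ≤ C' := by
      refine (le_abs_self _).trans (((Λ i).le_opNorm _).trans ?_)
      have h3 := hC' i
      nlinarith [norm_nonneg (Λ i), norm_nonneg hσL.toLp]
    rw [h1, inv_mul_eq_div, div_le_iff₀ h0] at h2
    exact h2

end Near

/-! ### State-action norms under comparable laws -/

section Near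

variable {𝒮 𝒜 : Type*} [MeasurableSpace 𝒮] [MeasurableSpace 𝒜] {P Q : Measure (Transition 𝒮 𝒜)}
  {η : ℝ}

theorem saLaw_le_two_smul (h : Q ≤ (2 : ℝ≥0∞) • P) : saLaw Q ≤ (2 : ℝ≥0∞) • saLaw P := by
  unfold saLaw
  rw [← Measure.map_smul]
  exact Measure.map_mono h measurable_stateAction

theorem saNorm_nonneg (P : Measure (Transition 𝒮 𝒜)) (f : 𝒮 × 𝒜 → ℝ) : 0 ≤ saNorm P f :=
  ENNReal.toReal_nonneg

theorem saNorm_le_two_mul (h : Q ≤ (2 : ℝ≥0∞) • P) {f : 𝒮 × 𝒜 → ℝ} (hf : MemLp f 2 (saLaw P)) :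
    saNorm Q f ≤ 2 * saNorm P f := by
  have h1 := eLpNorm_le_two_mul (p := 2) (by norm_num) (by norm_num) (saLaw_le_two_smul h) f
  have h2 := ENNReal.toReal_mono (ENNReal.mul_ne_top (by norm_num) hf.2.ne) h1
  rwa [ENNReal.toReal_mul, ENNReal.toReal_ofNat] at h2

theorem toReal_eLpNorm_comp_stateAction {f : 𝒮 × 𝒜 → ℝ} (hf : MemLp f 2 (saLaw P)) :
    (eLpNorm (fun w => f (stateAction w)) 2 P).toReal = saNorm P f := by
  rw [eLpNorm_comp_stateAction hf.1]; rfl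

theorem integral_abs_mul_le_saNorm {f g : 𝒮 × 𝒜 → ℝ} (hf : MemLp f 2 (saLaw P))
    (hg : MemLp g 2 (saLaw P)) :
    ∫ w, |f (stateAction w) * g (stateAction w)| ∂P ≤ saNorm P f * saNorm P g := by
  rw [← toReal_eLpNorm_comp_stateAction hf, ← toReal_eLpNorm_comp_stateAction hg]
  exact integral_abs_mul_le (memLp_comp_stateAction hf) (memLp_comp_stateAction hg)

theorem saNorm_sq {f : 𝒮 × 𝒜 → ℝ} (hf : MemLp f 2 (saLaw P)) :
    saNorm P f ^ 2 = ∫ w, f (stateAction w) * f (stateAction w) ∂P := by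
  rw [← toReal_eLpNorm_comp_stateAction hf, toReal_eLpNorm_two_sq (memLp_comp_stateAction hf)]

end Near

/-! ### From (C1) in a neighborhood to L¹ bounds -/

namespace BellmanProblem

variable {𝒮 𝒜 : Type*} [MeasurableSpace 𝒮] [MeasurableSpace 𝒜] {B : BellmanProblem 𝒮 𝒜}
  {P : Measure (Transition 𝒮 𝒜)} {𝓜 : Set (Measure (Transition 𝒮 𝒜))}

theorem ConditionNear.conditionAt (hP : B.IsLaw P) (hc : B.ConditionNear 𝓜 P) (hm : P ∈ 𝓜) :
    B.ConditionAt P := by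
  have := hP.prob
  obtain ⟨δ, hδ, h⟩ := hc
  exact h P hm ((isNear_refl P).hellingerDist_lt hδ (by positivity))

/-- In a nonparametric model, each bounded centered direction leads to laws that satisfy the
condition. -/
theorem exists_perturbation (h𝓜 : B.IsModel 𝓜) (hm : P ∈ 𝓜) (hnp : IsNonparametricAt 𝓜 P)
    (hc : B.ConditionNear 𝓜 P) {φ : Transition 𝒮 𝒜 → ℝ} (hφ : Measurable φ) {M : ℝ}
    (hM : ∀ w, |φ w| ≤ M) (h0 : ∫ w, φ w ∂P = 0) :
    ∃ ε : ℝ, 0 < ε ∧ ∃ Q ∈ 𝓜, B.ConditionAt Q ∧ ∃ η, IsNear P Q η ∧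
      ∀ᵐ w ∂P, (Q.rnDeriv P w).toReal - 1 = ε * φ w := by
  have := h𝓜.isProbabilityMeasure P hm
  obtain ⟨δ, hδ, hmem⟩ := hnp φ hφ ⟨M, hM⟩ h0
  obtain ⟨δ', hδ', hcond⟩ := hc
  -- The value 1/2 is required by `IsNear`, and δ'²/2 places Q in the Hellinger ball. In ε, the
  -- bound δ/2 keeps Q in the model and η/(|M| + 1) ensures |εφ| ≤ η.
  let η : ℝ := min (1 / 2) (δ' ^ 2 / 2)
  have hη : 0 < η := by positivity
  let ε : ℝ := min (δ / 2) (η / (|M| + 1))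
  have hε : 0 < ε := lt_min (by positivity) (by positivity)
  have hb : ∀ w, |ε * φ w| ≤ η := fun w => by
    rw [abs_mul, abs_of_pos hε]
    calc ε * |φ w| ≤ η / (|M| + 1) * (|M| + 1) := by
          refine mul_le_mul (min_le_right _ _) ?_ (abs_nonneg _) (by positivity)
          linarith [hM w, le_abs_self M]
      _ = η := by field_simp
  have hεδ : |ε| < δ := by
    rw [abs_of_pos hε]
    exact (min_le_left _ _).trans_lt (by linarith)
  have hQ := hmem ε hεδ
  obtain ⟨hn, hd⟩ := isNear_withDensity (P := P) (hφ.const_mul ε) hb (min_le_left _ _)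
    (h𝓜.isProbabilityMeasure _ hQ)
  refine ⟨ε, hε, _, hQ, hcond _ hQ (hn.hellingerDist_lt hδ' ?_), η, hn, hd⟩
  exact (min_le_right _ _).trans_lt (by linarith [sq_pos_of_pos hδ'])

/-- Tested against s(A₀,S₀), γV^π(h) acts as h − T_P(h), so Cauchy–Schwarz and continuity of T_P
apply. This bounds the signed integral only, since conditioning loses the absolute value. -/
theorem ConditionAt.exists_value_bound (hP : B.IsLaw P) (hc : B.ConditionAt P) :
    ∃ C : ℝ, 0 ≤ C ∧ ∀ s, MemLp s 2 (saLaw P) → ∀ h ∈ B.H,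
      |∫ w, s (stateAction w) * (B.γ * B.value h (nextState w)) ∂P|
        ≤ C * (saNorm P s * saNorm P h) := by
  obtain ⟨C, hC⟩ := hc.bellman_continuous
  refine ⟨1 + max C 0, by positivity, fun s hs h hh => ?_⟩
  have hw := hP.isWeakBellman hh
  have hsP := memLp_comp_stateAction hs
  have e : ∫ w, s (stateAction w) * (B.γ * B.value h (nextState w)) ∂P
      = ∫ w, s (stateAction w) * h (stateAction w) ∂P
        - ∫ w, s (stateAction w) * B.bellman P h (stateAction w) ∂P := by
    rw [← hw.integral_eq s hs, ← integral_sub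
      (integrable_mul_of_memLp_two hsP (memLp_comp_stateAction hw.memLp)) (hw.integrable_sub hs)]
    refine integral_congr_ae (Eventually.of_forall fun w => ?_)
    simp only; ring
  have h1 := abs_integral_le_integral_abs.trans (integral_abs_mul_le_saNorm hs hw.memLp)
  have h2 := abs_integral_le_integral_abs.trans (integral_abs_mul_le_saNorm hs hw.memLp_image)
  have h3 : saNorm P (B.bellman P h) ≤ max C 0 * saNorm P h :=
    (hC h hh).trans (mul_le_mul_of_nonneg_right (le_max_left _ _) (saNorm_nonneg _ _))
  rw [e]
  have h4 := abs_sub (∫ w, s (stateAction w) * h (stateAction w) ∂P)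
    (∫ w, s (stateAction w) * B.bellman P h (stateAction w) ∂P)
  have h5 := mul_le_mul_of_nonneg_left h3 (saNorm_nonneg P s)
  linarith

/-- The condition at `P`, together with the bounds in `L¹` that it implies when it holds in a
neighborhood of `P` in a nonparametric model. -/
structure StrongCondition (B : BellmanProblem 𝒮 𝒜) (P : Measure (Transition 𝒮 𝒜)) : Prop where
  isLaw : B.IsLaw P
  cond : B.ConditionAt P
  value_bound : ∃ C : ℝ, 0 ≤ C ∧ ∀ s, MemLp s 2 (saLaw P) → ∀ h ∈ B.H,
    ∫ w, |s (stateAction w) * (B.γ * B.value h (nextState w))| ∂P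
      ≤ C * (saNorm P s * saNorm P h)
  m_bound : ∃ C : ℝ, 0 ≤ C ∧ ∀ h ∈ B.H, ∫ w, |B.m h (stateAction w)| ∂P ≤ C * saNorm P h

/-- Bounds that hold for the integrals under all laws of a nonparametric model near `P` hold for the
integrals of the absolute values. -/
theorem exists_integral_abs_le_of_near (h𝓜 : B.IsModel 𝓜) (hm : P ∈ 𝓜)
    (hnp : IsNonparametricAt 𝓜 P) (hc : B.ConditionNear 𝓜 P) {ι : Type*}
    {g : ι → Transition 𝒮 𝒜 → ℝ} {N : ι → ℝ} (hg : ∀ i, Integrable (g i) P) (hN : ∀ i, 0 ≤ N i)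
    (hb : ∀ Q ∈ 𝓜, B.ConditionAt Q → ∀ η, IsNear P Q η →
      ∃ C : ℝ, ∀ i, |∫ w, g i w ∂Q| ≤ C * N i) :
    ∃ C : ℝ, 0 ≤ C ∧ ∀ i, ∫ w, |g i w| ∂P ≤ C * N i := by
  have hP := h𝓜.isLaw hm
  have := hP.prob
  obtain ⟨C₀, hC₀⟩ := hb P hm (hc.conditionAt hP hm) 0 (isNear_refl P)
  suffices h : ∃ C : ℝ, ∀ i, ∫ w, |g i w| ∂P ≤ C * N i by
    obtain ⟨C, hC⟩ := h
    exact ⟨max C 0, le_max_right _ _, fun i =>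
      (hC i).trans (mul_le_mul_of_nonneg_right (le_max_left _ _) (hN i))⟩
  refine exists_integral_abs_le hg hN fun ψ hψ ⟨M, hM⟩ => ?_
  have hψi : Integrable ψ P :=
    Integrable.of_bound hψ.aestronglyMeasurable M (Eventually.of_forall hM)
  have hcent : ∫ w, (ψ w - ∫ w, ψ w ∂P) ∂P = 0 := by
    rw [integral_sub hψi (integrable_const _), integral_const, probReal_univ, one_smul, sub_self]
  obtain ⟨ε, hε, Q, hQ, hcQ, η, hn, hd⟩ := exists_perturbation h𝓜 hm hnp hc
    (φ := fun w => ψ w - ∫ w, ψ w ∂P) (hψ.sub_const _) (M := M + |∫ w, ψ w ∂P|)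
    (fun w => (abs_sub _ _).trans (add_le_add_left (hM w) _)) hcent
  obtain ⟨C₁, hC₁⟩ := hb Q hQ hcQ η hn
  refine ⟨ε⁻¹ * (C₁ + C₀) + |∫ w, ψ w ∂P| * C₀, fun i => ?_⟩
  have hψg : Integrable (fun w => ψ w * g i w) P :=
    (hg i).bdd_mul hψ.aestronglyMeasurable (Eventually.of_forall hM)
  -- Q has density 1 + ε(ψ − E_P ψ), so E_P[ψ g] can be solved for in terms of the signed means of g
  -- under P and Q, both of which are bounded by hypothesis.
  have e1 : ∫ w, g i w ∂Q - ∫ w, g i w ∂P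
      = ε * (∫ w, ψ w * g i w ∂P - (∫ w, ψ w ∂P) * ∫ w, g i w ∂P) := by
    rw [hn.integral_sub (hg i), ← integral_const_mul, ← integral_sub hψg ((hg i).const_mul _),
      ← integral_const_mul]
    refine integral_congr_ae ?_
    filter_upwards [hd] with w hw
    rw [hw]; ring
  have e2 : ∫ w, ψ w * g i w ∂P
      = ε⁻¹ * (∫ w, g i w ∂Q - ∫ w, g i w ∂P) + (∫ w, ψ w ∂P) * ∫ w, g i w ∂P := by
    rw [e1]; field_simp; ring
  rw [e2]
  have h1 := abs_sub (∫ w, g i w ∂Q) (∫ w, g i w ∂P)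
  calc _ ≤ |ε⁻¹ * (∫ w, g i w ∂Q - ∫ w, g i w ∂P)| + |(∫ w, ψ w ∂P) * ∫ w, g i w ∂P| :=
        abs_add_le _ _
    _ ≤ ε⁻¹ * (C₁ * N i + C₀ * N i) + |∫ w, ψ w ∂P| * (C₀ * N i) := by
        rw [abs_mul, abs_mul, abs_of_pos (inv_pos.2 hε)]
        gcongr
        · linarith [hC₁ i, hC₀ i]
        · exact hC₀ i
    _ = _ := by ring

/-- The uniform boundedness argument is run over all pairs (s, h) with weight ‖s‖‖h‖, and over all h
in H with weight ‖h‖. The factors 4 and 2 convert the norms under Q into norms under P. -/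
theorem ConditionNear.strongCondition (h𝓜 : B.IsModel 𝓜) (hm : P ∈ 𝓜)
    (hnp : IsNonparametricAt 𝓜 P) (hc : B.ConditionNear 𝓜 P) : B.StrongCondition P := by
  have hP := h𝓜.isLaw hm
  have hcP := hc.conditionAt hP hm
  refine ⟨hP, hcP, ?_, ?_⟩
  · obtain ⟨C, hC0, hC⟩ := exists_integral_abs_le_of_near h𝓜 hm hnp hc
      (ι := {x : (𝒮 × 𝒜 → ℝ) × Lp ℝ ∞ B.dom // MemLp x.1 2 (saLaw P) ∧ x.2 ∈ B.H})
      (g := fun x w => x.1.1 (stateAction w) * (B.γ * B.value x.1.2 (nextState w)))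
      (N := fun x => saNorm P x.1.1 * saNorm P x.1.2)
      (fun x => (hP.isWeakBellman x.2.2).integrable _ x.2.1)
      (fun x => mul_nonneg (saNorm_nonneg _ _) (saNorm_nonneg _ _)) (fun Q hQ hcQ η hn => by
        obtain ⟨C, hC0, hC⟩ := hcQ.exists_value_bound (h𝓜.isLaw hQ)
        refine ⟨C * 4, fun x => ?_⟩
        refine (hC _ (memLp_of_le_two_smul (saLaw_le_two_smul hn.le_two_smul) x.2.1) _
          x.2.2).trans ?_
        have h1 := saNorm_le_two_mul hn.le_two_smul x.2.1
        have h2 := saNorm_le_two_mul hn.le_two_smul (hP.isLinOn_coe.memLp _ x.2.2)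
        rw [mul_assoc]
        refine mul_le_mul_of_nonneg_left ?_ hC0
        have := mul_le_mul h1 h2 (saNorm_nonneg _ _) (by linarith [saNorm_nonneg P x.1.1])
        linarith)
    exact ⟨C, hC0, fun s hs h hh => hC ⟨(s, h), hs, hh⟩⟩
  · obtain ⟨C, hC0, hC⟩ := exists_integral_abs_le_of_near h𝓜 hm hnp hc (ι := B.H)
      (g := fun h w => B.m h (stateAction w)) (N := fun h => saNorm P h)
      (fun h => integrable_comp_stateAction (hcP.functional_integrable h h.2))
      (fun h => saNorm_nonneg _ _) (fun Q hQ hcQ η hn => by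
        obtain ⟨C, hC⟩ := hcQ.functional_continuous
        refine ⟨max C 0 * 2, fun h => ?_⟩
        rw [← integral_saLaw Q (hcQ.functional_integrable h h.2).1]
        refine (hC h h.2).trans ((mul_le_mul_of_nonneg_right (le_max_left C 0)
          (saNorm_nonneg _ _)).trans ?_)
        rw [mul_assoc]
        exact mul_le_mul_of_nonneg_left
          (saNorm_le_two_mul hn.le_two_smul (hP.isLinOn_coe.memLp _ h.2)) (le_max_right _ _))
    exact ⟨C, hC0, fun h hh => hC ⟨h, hh⟩⟩

section Strong

theorem eLpNorm_one_le_of_integral_abs_le {Ω : Type*} [MeasurableSpace Ω] {μ : Measure Ω}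
    {f : Ω → ℝ} {c : ℝ} (hf : Integrable f μ) (h : ∫ x, |f x| ∂μ ≤ c) :
    eLpNorm f 1 μ ≤ ENNReal.ofReal c := by
  rw [eLpNorm_one_eq_lintegral_enorm, ← ofReal_integral_norm_eq_lintegral_enorm hf]
  exact ENNReal.ofReal_le_ofReal h

theorem integral_abs_eq_toReal_eLpNorm_one {Ω : Type*} [MeasurableSpace Ω] {μ : Measure Ω}
    {f : Ω → ℝ} (hf : Integrable f μ) : ∫ x, |f x| ∂μ = (eLpNorm f 1 μ).toReal := by
  rw [eLpNorm_one_eq_lintegral_enorm, ← ofReal_integral_norm_eq_lintegral_enorm hf,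
    ENNReal.toReal_ofReal (integral_nonneg fun _ => norm_nonneg _)]
  rfl

theorem ofReal_saNorm {f : 𝒮 × 𝒜 → ℝ} (hf : MemLp f 2 (saLaw P)) :
    ENNReal.ofReal (saNorm P f) = eLpNorm f 2 (saLaw P) :=
  ENNReal.ofReal_toReal hf.2.ne

variable (hS : B.StrongCondition P)
include hS

theorem StrongCondition.exists_isBddOn_m :
    ∃ C, B.IsBddOn P (fun h => (B.m h : 𝒮 × 𝒜 → ℝ)) 1 (saLaw P) C := by
  obtain ⟨C, hC0, hC⟩ := hS.m_bound
  refine ⟨ENNReal.ofReal C, ENNReal.ofReal_ne_top, fun h hh => ?_⟩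
  have hi := hS.cond.functional_integrable h hh
  rw [← ofReal_saNorm (hS.isLaw.isLinOn_coe.memLp h hh), ← ENNReal.ofReal_mul hC0,
    ← eLpNorm_comp_stateAction hi.1]
  exact eLpNorm_one_le_of_integral_abs_le (integrable_comp_stateAction hi) (hC h hh)

/-- The product bound at the constant function s = 1. -/
theorem StrongCondition.exists_isBddOn_value :
    ∃ C, B.IsBddOn P (fun h s => B.γ * B.value h s) 1 (nextLaw P) C := by
  have := hS.isLaw.prob
  obtain ⟨C, hC0, hC⟩ := hS.value_bound
  have h1 : MemLp (fun _ : 𝒮 × 𝒜 => (1 : ℝ)) 2 (saLaw P) := memLp_const 1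
  refine ⟨ENNReal.ofReal (C * saNorm P fun _ => 1), ENNReal.ofReal_ne_top, fun h hh => ?_⟩
  have hi := hS.isLaw.isLinOn_value.memLp h hh
  have hb := hC _ h1 h hh
  have e : eLpNorm (fun s => B.γ * B.value h s) 1 (nextLaw P)
      = eLpNorm (fun w => B.γ * B.value h (nextState w)) 1 P :=
    eLpNorm_map_measure hi.1 measurable_nextState.aemeasurable
  rw [← ofReal_saNorm (hS.isLaw.isLinOn_coe.memLp h hh),
    ← ENNReal.ofReal_mul (mul_nonneg hC0 (saNorm_nonneg _ _)), e, mul_assoc]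
  refine eLpNorm_one_le_of_integral_abs_le
    (integrable_comp_nextState (memLp_one_iff_integrable.1 hi)) ?_
  simpa only [one_mul] using hb

theorem StrongCondition.exists_valueExt {f : 𝒮 × 𝒜 → ℝ} {h : ℕ → Lp ℝ ∞ B.dom}
    (ha : B.Approximates P h f) : ∃ v, B.ValueExt P f v := by
  obtain ⟨C, hC⟩ := hS.exists_isBddOn_value
  obtain ⟨v, hv, hl⟩ := ha.exists_limit hS.isLaw hS.isLaw.isLinOn_value hC
  exact ⟨v, h, ha, memLp_one_iff_integrable.1 hv, hl⟩

theorem StrongCondition.exists_integrandExt {f : 𝒮 × 𝒜 → ℝ} {h : ℕ → Lp ℝ ∞ B.dom}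
    (ha : B.Approximates P h f) : ∃ g, B.IntegrandExt P f g := by
  obtain ⟨C, hC⟩ := hS.exists_isBddOn_m
  obtain ⟨v, hv, hl⟩ := ha.exists_limit hS.isLaw (hS.cond.isLinOn_m hS.isLaw) hC
  exact ⟨v, h, ha, memLp_one_iff_integrable.1 hv, hl⟩

theorem StrongCondition.exists_isNuisance : ∃ η : NuisanceFns 𝒮 𝒜, B.IsNuisance P η := by
  obtain ⟨α, ρ, hα⟩ := hS.cond.exists_isRieszRepresenter hS.isLaw
  obtain ⟨q, t, hq⟩ := hS.cond.exists_isBellmanProjection hS.isLaw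
  obtain ⟨hα', haα, _⟩ := hα.1
  obtain ⟨hq', haq, _⟩ := hq.1
  obtain ⟨vα, hvα⟩ := hS.exists_valueExt haα
  obtain ⟨vq, hvq⟩ := hS.exists_valueExt haq
  obtain ⟨g, hg⟩ := hS.exists_integrandExt haq
  exact ⟨⟨α, ρ, vα, q, t, vq, g, rewardFn P⟩, hα, hvα, hq, hvq, hg, EventuallyEq.rfl⟩

end Strong

theorem Approximates.tendsto_saNorm {f : 𝒮 × 𝒜 → ℝ} {h : ℕ → Lp ℝ ∞ B.dom}
    (ha : B.Approximates P h f) : Tendsto (fun n => saNorm P (fun z => h n z - f z)) atTop (𝓝 0) :=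
  (ENNReal.tendsto_toReal ENNReal.zero_ne_top).comp ha.2.2

theorem ValueExt.sub {f f' : 𝒮 × 𝒜 → ℝ} {v v' : 𝒮 → ℝ} (hP : B.IsLaw P)
    (h : B.ValueExt P f v) (h' : B.ValueExt P f' v') :
    B.ValueExt P (fun z => f z - f' z) (fun s => v s - v' s) := by
  obtain ⟨u, ha, hi, hl⟩ := h
  obtain ⟨u', ha', hi', hl'⟩ := h'
  obtain ⟨k, hk, hm, hl⟩ := ExtRel.sub hP hP.isLinOn_value
    ⟨u, ha, memLp_one_iff_integrable.2 hi, hl⟩ ⟨u', ha', memLp_one_iff_integrable.2 hi', hl'⟩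
  exact ⟨k, hk, memLp_one_iff_integrable.1 hm, hl⟩

theorem IntegrandExt.sub {f f' g g' : 𝒮 × 𝒜 → ℝ} (hP : B.IsLaw P) (hc : B.ConditionAt P)
    (h : B.IntegrandExt P f g) (h' : B.IntegrandExt P f' g') :
    B.IntegrandExt P (fun z => f z - f' z) (fun s => g s - g' s) := by
  obtain ⟨u, ha, hi, hl⟩ := h
  obtain ⟨u', ha', hi', hl'⟩ := h'
  obtain ⟨k, hk, hm, hl⟩ := ExtRel.sub hP (hc.isLinOn_m hP)
    ⟨u, ha, memLp_one_iff_integrable.2 hi, hl⟩ ⟨u', ha', memLp_one_iff_integrable.2 hi', hl'⟩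
  exact ⟨k, hk, memLp_one_iff_integrable.1 hm, hl⟩

theorem valueExt_of_mem (hP : B.IsLaw P) {h : Lp ℝ ∞ B.dom} (hh : h ∈ B.H) :
    B.ValueExt P h (fun s => B.γ * B.value h s) := by
  obtain ⟨k, hk, hm, hl⟩ := ExtRel.of_mem hP hP.isLinOn_value hh
  exact ⟨k, hk, memLp_one_iff_integrable.1 hm, hl⟩

/-- The bound for products with the value function extends to the closure of the working model. -/
theorem ValueExt.product_bound (hP : B.IsLaw P) {C : ℝ} (hC0 : 0 ≤ C)
    (hC : ∀ s, MemLp s 2 (saLaw P) → ∀ h ∈ B.H,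
      ∫ w, |s (stateAction w) * (B.γ * B.value h (nextState w))| ∂P
        ≤ C * (saNorm P s * saNorm P h))
    {f : 𝒮 × 𝒜 → ℝ} {v : 𝒮 → ℝ} (hf : B.ValueExt P f v) {s : 𝒮 × 𝒜 → ℝ}
    (hs : MemLp s 2 (saLaw P)) :
    Integrable (fun w => s (stateAction w) * v (nextState w)) P ∧
      ∫ w, |s (stateAction w) * v (nextState w)| ∂P ≤ C * (saNorm P s * saNorm P f) := by
  obtain ⟨h, ha, hi, hl⟩ := hf
  -- L¹ convergence of the value functions says nothing about products with an unbounded s. An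
  -- almost surely convergent subsequence and Fatou transfer the bound to the limit.
  have hm := tendstoInMeasure_of_tendsto_eLpNorm one_ne_zero
    (fun n => (hP.isLinOn_value.memLp _ (ha.1 n)).1) hi.1 hl
  obtain ⟨ns, hns, hae⟩ := hm.exists_seq_tendsto_ae
  have hae' := (nextState_quasi P).ae hae
  have hmeas : AEStronglyMeasurable (fun w => s (stateAction w) * v (nextState w)) P :=
    (memLp_comp_stateAction hs).1.mul (integrable_comp_nextState hi).1
  have hle : eLpNorm (fun w => s (stateAction w) * v (nextState w)) 1 P
      ≤ ENNReal.ofReal C * (eLpNorm s 2 (saLaw P) * eLpNorm f 2 (saLaw P)) := by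
    refine (Lp.eLpNorm_lim_le_liminf_eLpNorm (p := 1)
      (f := fun k w => s (stateAction w) * (B.γ * B.value (h (ns k)) (nextState w)))
      (fun k => ((hP.isWeakBellman (ha.1 _)).integrable s hs).1) _ ?_).trans ?_
    · filter_upwards [hae'] with w hw
      exact hw.const_mul _
    · have hlim : Tendsto (fun k => ENNReal.ofReal C * (eLpNorm s 2 (saLaw P)
          * (eLpNorm f 2 (saLaw P) + eLpNorm (fun z => h (ns k) z - f z) 2 (saLaw P))))
          atTop (𝓝 (ENNReal.ofReal C * (eLpNorm s 2 (saLaw P) * eLpNorm f 2 (saLaw P)))) := by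
        refine ENNReal.Tendsto.const_mul (ENNReal.Tendsto.const_mul ?_ (Or.inr hs.2.ne))
          (Or.inr ENNReal.ofReal_ne_top)
        simpa using tendsto_const_nhds.add (ha.2.2.comp hns.tendsto_atTop)
      rw [← hlim.liminf_eq]
      refine liminf_le_liminf (Eventually.of_forall fun k => ?_)
      have hhm := hP.isLinOn_coe.memLp _ (ha.1 (ns k))
      refine (eLpNorm_one_le_of_integral_abs_le ((hP.isWeakBellman (ha.1 _)).integrable s hs)
        (hC s hs _ (ha.1 _))).trans ?_
      rw [ENNReal.ofReal_mul hC0, ENNReal.ofReal_mul (saNorm_nonneg _ _), ofReal_saNorm hs,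
        ofReal_saNorm hhm]
      gcongr
      rw [eLpNorm_sub_comm']
      exact eLpNorm_le_add_sub (by norm_num) hhm ha.2.1
  have hfin : ENNReal.ofReal C * (eLpNorm s 2 (saLaw P) * eLpNorm f 2 (saLaw P)) ≠ ∞ :=
    ENNReal.mul_ne_top ENNReal.ofReal_ne_top (ENNReal.mul_ne_top hs.2.ne ha.2.1.2.ne)
  have hint : Integrable (fun w => s (stateAction w) * v (nextState w)) P :=
    memLp_one_iff_integrable.1 ⟨hmeas, hle.trans_lt hfin.lt_top⟩
  refine ⟨hint, ?_⟩
  rw [integral_abs_eq_toReal_eLpNorm_one hint]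
  refine (ENNReal.toReal_mono hfin hle).trans_eq ?_
  rw [ENNReal.toReal_mul, ENNReal.toReal_mul, ENNReal.toReal_ofReal hC0]
  rfl

/-- The identity holds on H and is passed to the limit along the sequence defining v. The terms with
γV^π(h_n) − v converge by the product bound: convergence in L¹ alone would not suffice for s merely
in L². -/
theorem StrongCondition.isWeakBellman (hS : B.StrongCondition P) {f t : 𝒮 × 𝒜 → ℝ} {v : 𝒮 → ℝ}
    (hf : B.BellmanExt P f t) (hv : B.ValueExt P f v) : IsWeakBellman P f v t := by
  have hP := hS.isLaw
  obtain ⟨C, hC0, hC⟩ := hS.value_bound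
  have hv' := hv
  obtain ⟨h, ha, -, -⟩ := hv
  have htm : MemLp t 2 (saLaw P) := by obtain ⟨_, _, h, _⟩ := hf; exact h
  refine ⟨ha.2.1, htm, fun s hs => (hv'.product_bound hP hC0 hC hs).1, fun s hs => ?_⟩
  obtain ⟨D, hD⟩ := hS.cond.exists_isBddOn_bellman hP
  obtain ⟨t', ht', hl'⟩ := ha.exists_limit hP hP.isLinOn_bellman hD
  have hae : t' =ᵐ[saLaw P] t :=
    ExtRel.ae_eq hP hP.isLinOn_bellman hD ⟨h, ha, ht', hl'⟩ hf
  have e : ∫ w, s (stateAction w) * t (stateAction w) ∂P = ∫ z, s z * t' z ∂(saLaw P) := by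
    rw [← integral_mul_saLaw hs htm]
    refine integral_congr_ae ?_
    filter_upwards [hae] with z hz
    rw [hz]
  rw [e]
  refine tendsto_nhds_unique ?_
    (tendsto_integral_mul hs ht' (fun n => hP.isLinOn_bellman.memLp _ (ha.1 n)) hl')
  have hsP := memLp_comp_stateAction hs
  have hfP := memLp_comp_stateAction ha.2.1
  rw [tendsto_iff_dist_tendsto_zero]
  have hlim : Tendsto (fun n => (saNorm P s + C * saNorm P s)
      * saNorm P (fun z => h n z - f z)) atTop (𝓝 0) := by
    simpa only [mul_zero] using ha.tendsto_saNorm.const_mul (saNorm P s + C * saNorm P s)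
  refine squeeze_zero (fun _ => dist_nonneg) (fun n => ?_) hlim
  have hw := hP.isWeakBellman (ha.1 n)
  have hd : MemLp (fun z => h n z - f z) 2 (saLaw P) := hw.memLp.sub ha.2.1
  have hb := ((valueExt_of_mem hP (ha.1 n)).sub hP hv').product_bound hP hC0 hC hs
  have i1 := integrable_mul_of_memLp_two hsP (memLp_comp_stateAction hd)
  have i2 : Integrable (fun w => s (stateAction w) * (f (stateAction w) - v (nextState w))) P := by
    refine ((integrable_mul_of_memLp_two hsP hfP).sub
      (hv'.product_bound hP hC0 hC hs).1).congr (Eventually.of_forall fun w => ?_)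
    simp only [Pi.sub_apply]; ring
  have e2 : ∫ z, s z * B.bellman P (h n) z ∂(saLaw P)
      - ∫ w, s (stateAction w) * (f (stateAction w) - v (nextState w)) ∂P
      = ∫ w, s (stateAction w) * (h n (stateAction w) - f (stateAction w)) ∂P
        - ∫ w, s (stateAction w)
          * (B.γ * B.value (h n) (nextState w) - v (nextState w)) ∂P := by
    rw [integral_mul_saLaw hs hw.memLp_image, ← hw.integral_eq s hs,
      ← integral_sub (hw.integrable_sub hs) i2, ← integral_sub i1 hb.1]
    refine integral_congr_ae (Eventually.of_forall fun w => ?_)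
    simp only; ring
  rw [Real.dist_eq, e2]
  refine (abs_sub _ _).trans ?_
  have b1 := abs_integral_le_integral_abs.trans (integral_abs_mul_le_saNorm hs hd)
  have b2 := abs_integral_le_integral_abs.trans hb.2
  linarith

/-- Convergence of m(h_n) in L¹ implies convergence of the means, so the mean of the extended
integrand is the extended functional. -/
theorem IntegrandExt.integral_eq (hP : B.IsLaw P) (hc : B.ConditionAt P) {α ρ f t g : 𝒮 × 𝒜 → ℝ}
    (hα : B.IsRieszRepresenter P α ρ) (hf : B.BellmanExt P f t) (hg : B.IntegrandExt P f g) :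
    ∫ z, g z ∂(saLaw P) = ∫ z, ρ z * t z ∂(saLaw P) := by
  refine (meanExt_iff hP hc hα hf).1 ?_
  obtain ⟨h, ha, hi, hl⟩ := hg
  exact ⟨h, ha, tendsto_integral_of_L1' g hi.1
    (Eventually.of_forall fun n => hc.functional_integrable _ (ha.1 n)) hl⟩

end BellmanProblem

/-! ### Bounds on the closure and comparison of nearby laws -/

namespace BellmanProblem

variable {𝒮 𝒜 : Type*} [MeasurableSpace 𝒮] [MeasurableSpace 𝒜] {B : BellmanProblem 𝒮 𝒜}
  {P Q : Measure (Transition 𝒮 𝒜)} {𝓜 : Set (Measure (Transition 𝒮 𝒜))}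
  {f f' t t' g g' : 𝒮 × 𝒜 → ℝ} {v v' : 𝒮 → ℝ} {A η : ℝ}

/-- The extensions by continuity of the three maps of the problem, at a common argument. -/
structure IsExt (B : BellmanProblem 𝒮 𝒜) (P : Measure (Transition 𝒮 𝒜)) (f t : 𝒮 × 𝒜 → ℝ)
    (v : 𝒮 → ℝ) (g : 𝒮 × 𝒜 → ℝ) : Prop where
  bellman : B.BellmanExt P f t
  value : B.ValueExt P f v
  integrand : B.IntegrandExt P f g

theorem IsExt.memLp (h : B.IsExt P f t v g) : MemLp f 2 (saLaw P) := by
  obtain ⟨_, ha, _⟩ := h.bellman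
  exact ha.2.1

theorem IsExt.memLp_image (h : B.IsExt P f t v g) : MemLp t 2 (saLaw P) := by
  obtain ⟨_, _, ht, _⟩ := h.bellman
  exact ht

theorem IsExt.integrable (h : B.IsExt P f t v g) : Integrable (fun w => g (stateAction w)) P := by
  obtain ⟨_, _, hg, _⟩ := h.integrand
  exact integrable_comp_stateAction hg

theorem IsExt.sub (hP : B.IsLaw P) (hc : B.ConditionAt P) (h : B.IsExt P f t v g)
    (h' : B.IsExt P f' t' v' g') :
    B.IsExt P (fun z => f z - f' z) (fun z => t z - t' z) (fun s => v s - v' s)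
      (fun z => g z - g' z) :=
  ⟨ExtRel.sub hP hP.isLinOn_bellman h.bellman h'.bellman, h.value.sub hP h'.value,
    h.integrand.sub hP hc h'.integrand⟩

theorem isExt_of_mem (hP : B.IsLaw P) (hc : B.ConditionAt P) {h : Lp ℝ ∞ B.dom} (hh : h ∈ B.H) :
    B.IsExt P h (B.bellman P h) (fun s => B.γ * B.value h s) (B.m h) := by
  refine ⟨ExtRel.of_mem hP hP.isLinOn_bellman hh, valueExt_of_mem hP hh, ?_⟩
  obtain ⟨k, hk, hm, hl⟩ := ExtRel.of_mem hP (hc.isLinOn_m hP) hh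
  exact ⟨k, hk, memLp_one_iff_integrable.1 hm, hl⟩

/-- Bounds for the extensions, with a common constant. -/
structure ExtBounds (B : BellmanProblem 𝒮 𝒜) (P : Measure (Transition 𝒮 𝒜)) (A : ℝ) : Prop where
  strong : B.StrongCondition P
  nonneg : 0 ≤ A
  residual : ∀ f v s, B.ValueExt P f v → MemLp f 2 (saLaw P) → MemLp s 2 (saLaw P) →
    ∫ w, |s (stateAction w) * (f (stateAction w) - v (nextState w))| ∂P
      ≤ A * (saNorm P s * saNorm P f)
  image : ∀ f t, B.BellmanExt P f t → saNorm P t ≤ A * saNorm P f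
  inverse : ∀ f t, B.BellmanExt P f t → saNorm P f ≤ A * saNorm P t
  integrand : ∀ f g, B.IntegrandExt P f g → ∫ w, |g (stateAction w)| ∂P ≤ A * saNorm P f

theorem StrongCondition.exists_extBounds (hS : B.StrongCondition P) : ∃ A, B.ExtBounds P A := by
  have hP := hS.isLaw
  obtain ⟨C₁, hC₁0, hC₁⟩ := hS.value_bound
  obtain ⟨C₂, hC₂, hb₂⟩ := hS.cond.exists_isBddOn_bellman hP
  obtain ⟨C₃, hC₃, hb₃⟩ := hS.exists_isBddOn_m
  obtain ⟨c, hc0, hc⟩ := hS.cond.bounded_inverse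
  have n₂ : 0 ≤ C₂.toReal := ENNReal.toReal_nonneg
  have n₃ : 0 ≤ C₃.toReal := ENNReal.toReal_nonneg
  have n₄ : 0 ≤ c⁻¹ := by positivity
  -- The sum dominates each separate constant; the 1 is Cauchy–Schwarz for the part s·f of the
  -- residual bound.
  refine ⟨1 + C₁ + C₂.toReal + C₃.toReal + c⁻¹, hS, by positivity, fun f v s hv hf hs => ?_,
    fun f t hf => ?_, fun f t hf => ?_, fun f g hg => ?_⟩
  · obtain ⟨hi, hb⟩ := hv.product_bound hP hC₁0 hC₁ hs
    have h1 := integral_abs_mul_le_saNorm hs hf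
    have i1 := integrable_mul_of_memLp_two (memLp_comp_stateAction hs) (memLp_comp_stateAction hf)
    have hn : 0 ≤ saNorm P s * saNorm P f := mul_nonneg (saNorm_nonneg _ _) (saNorm_nonneg _ _)
    calc ∫ w, |s (stateAction w) * (f (stateAction w) - v (nextState w))| ∂P
        ≤ ∫ w, (|s (stateAction w) * f (stateAction w)|
            + |s (stateAction w) * v (nextState w)|) ∂P := by
          refine integral_mono_of_nonneg (Eventually.of_forall fun _ => abs_nonneg _)
            (i1.abs.add hi.abs) (Eventually.of_forall fun w => ?_)
          simp only [mul_sub]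
          exact abs_sub _ _
      _ ≤ saNorm P s * saNorm P f + C₁ * (saNorm P s * saNorm P f) := by
          rw [integral_add i1.abs hi.abs]
          exact add_le_add h1 hb
      _ ≤ _ := by nlinarith
  · have h1 := ExtRel.eLpNorm_le hP hP.isLinOn_bellman ⟨hC₂, hb₂⟩ hf
    have h2 : MemLp f 2 (saLaw P) := by obtain ⟨_, ha, _⟩ := hf; exact ha.2.1
    have h3 := ENNReal.toReal_mono (ENNReal.mul_ne_top hC₂ h2.2.ne) h1
    rw [ENNReal.toReal_mul] at h3
    refine (show saNorm P t ≤ C₂.toReal * saNorm P f from h3).trans ?_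
    exact mul_le_mul_of_nonneg_right (by linarith) (saNorm_nonneg _ _)
  · have h1 := hc f t hf
    have h2 : saNorm P f ≤ c⁻¹ * saNorm P t := by rwa [inv_mul_eq_div, le_div_iff₀' hc0]
    exact h2.trans (mul_le_mul_of_nonneg_right (by linarith) (saNorm_nonneg _ _))
  · obtain ⟨h, ha, hi, hl⟩ := hg
    have h1 := ExtRel.eLpNorm_le hP (hS.cond.isLinOn_m hP) ⟨hC₃, hb₃⟩
      ⟨h, ha, memLp_one_iff_integrable.2 hi, hl⟩
    have h3 := ENNReal.toReal_mono (ENNReal.mul_ne_top hC₃ ha.2.1.2.ne) h1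
    rw [ENNReal.toReal_mul, ← eLpNorm_comp_stateAction hi.1,
      ← integral_abs_eq_toReal_eLpNorm_one (integrable_comp_stateAction hi)] at h3
    refine (show _ ≤ C₃.toReal * saNorm P f from h3).trans ?_
    exact mul_le_mul_of_nonneg_right (by linarith) (saNorm_nonneg _ _)

/-- The part of `t(A₀, S₀)` that is not explained by `f(A₀, S₀) - v(S₁)`. -/
def resid (f t : 𝒮 × 𝒜 → ℝ) (v : 𝒮 → ℝ) (w : Transition 𝒮 𝒜) : ℝ :=
  t (stateAction w) - (f (stateAction w) - v (nextState w))

theorem ExtBounds.isWeakBellman (hA : B.ExtBounds P A) (h : B.IsExt P f t v g) :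
    IsWeakBellman P f v t :=
  hA.strong.isWeakBellman h.bellman h.value

/-- The residual has conditional mean zero given (A₀, S₀), in the weak sense. Under a nearby law its
products with s therefore have mean of order η‖s‖‖f‖. -/
theorem ExtBounds.resid_spec (hA : B.ExtBounds P A) (h : B.IsExt P f t v g) {s : 𝒮 × 𝒜 → ℝ}
    (hs : MemLp s 2 (saLaw P)) :
    Integrable (fun w => s (stateAction w) * resid f t v w) P ∧
    ∫ w, s (stateAction w) * resid f t v w ∂P = 0 ∧
    ∫ w, |s (stateAction w) * resid f t v w| ∂P ≤ 2 * A * (saNorm P s * saNorm P f) := by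
  have hw := hA.isWeakBellman h
  have i1 := integrable_mul_of_memLp_two (memLp_comp_stateAction hs)
    (memLp_comp_stateAction h.memLp_image)
  have i2 := hw.integrable_sub hs
  have e : (fun w => s (stateAction w) * resid f t v w) = fun w =>
      s (stateAction w) * t (stateAction w)
      - s (stateAction w) * (f (stateAction w) - v (nextState w)) := by
    funext w; simp only [resid]; ring
  have i3 : Integrable (fun w => s (stateAction w) * resid f t v w) P := by
    rw [e]; exact i1.sub i2
  refine ⟨i3, ?_, ?_⟩
  · rw [e, integral_sub i1 i2, hw.integral_eq s hs, sub_self]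
  · calc ∫ w, |s (stateAction w) * resid f t v w| ∂P
        ≤ ∫ w, (|s (stateAction w) * t (stateAction w)|
            + |s (stateAction w) * (f (stateAction w) - v (nextState w))|) ∂P := by
          refine integral_mono_of_nonneg (Eventually.of_forall fun _ => abs_nonneg _)
            (i1.abs.add i2.abs) (Eventually.of_forall fun w => ?_)
          have := congrFun e w
          simp only at this ⊢
          rw [this]
          exact abs_sub _ _
      _ ≤ saNorm P s * (A * saNorm P f) + A * (saNorm P s * saNorm P f) := by
          rw [integral_add i1.abs i2.abs]
          refine add_le_add ?_ (hA.residual f v s h.value h.memLp hs)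
          exact (integral_abs_mul_le_saNorm hs h.memLp_image).trans
            (mul_le_mul_of_nonneg_left (hA.image f t h.bellman) (saNorm_nonneg _ _))
      _ = _ := by ring

/-! ### Nearby laws -/

theorem Approximates.of_near {h : ℕ → Lp ℝ ∞ B.dom} (hn : P ≤ (2 : ℝ≥0∞) • Q)
    (ha : B.Approximates Q h f) : B.Approximates P h f := by
  have hs := saLaw_le_two_smul hn
  refine ⟨ha.1, memLp_of_le_two_smul hs ha.2.1, ?_⟩
  have hlim := ENNReal.Tendsto.const_mul ha.2.2 (Or.inr (by norm_num : (2 : ℝ≥0∞) ≠ ∞))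
  rw [mul_zero] at hlim
  exact tendsto_of_tendsto_of_tendsto_of_le_of_le tendsto_const_nhds hlim (fun _ => bot_le)
    fun n => eLpNorm_le_two_mul (by norm_num) (by norm_num) hs _

/-- The projection under a nearby law, expressed through the extensions at `P`. -/
theorem ExtBounds.exists_projection_near (hA : B.ExtBounds P A) (hn : IsNear P Q η)
    (hQ : B.IsLaw Q) (hcQ : B.ConditionAt Q) :
    ∃ q t v g, B.IsExt P q t v g ∧ B.target Q = ∫ w, g (stateAction w) ∂Q ∧
      ∀ h ∈ B.H, ∫ w, B.bellman Q h (stateAction w)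
        * (outcome w - (q (stateAction w) - v (nextState w))) ∂Q = 0 := by
  have hS := hA.strong
  have hP := hS.isLaw
  -- The sequence that computes the target under Q also defines the extensions at P, so the mean of
  -- g under Q is exactly Ψ(Q).
  obtain ⟨q, tQ, hq, h, ha, hl⟩ := hcQ.isTargetValue_target hQ
  have ha' := ha.of_near hn.ge_two_smul
  obtain ⟨C₂, hC₂⟩ := hS.cond.exists_isBddOn_bellman hP
  obtain ⟨t, ht⟩ := ha'.exists_extRel hP hP.isLinOn_bellman hC₂
  obtain ⟨v, hv⟩ := hS.exists_valueExt ha'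
  obtain ⟨C₃, hC₃⟩ := hS.exists_isBddOn_m
  obtain ⟨g, hg, hlg⟩ := ha'.exists_limit hP (hS.cond.isLinOn_m hP) hC₃
  have hgi := memLp_one_iff_integrable.1 hg
  have hext : B.IsExt P q t v g := ⟨ht, hv, h, ha', hgi, hlg⟩
  have hwk := hA.isWeakBellman hext
  refine ⟨q, t, v, g, hext, ?_, fun k hk => ?_⟩
  · have hsQ := saLaw_le_two_smul hn.le_two_smul
    have hgQ := memLp_of_le_two_smul hsQ hg
    rw [← integral_saLaw Q hgQ.1]
    refine tendsto_nhds_unique hl (tendsto_integral_of_L1' g (memLp_one_iff_integrable.1 hgQ).1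
      (Eventually.of_forall fun n => hcQ.functional_integrable _ (ha.1 n)) ?_)
    have hlim := ENNReal.Tendsto.const_mul hlg (Or.inr (by norm_num : (2 : ℝ≥0∞) ≠ ∞))
    rw [mul_zero] at hlim
    exact tendsto_of_tendsto_of_tendsto_of_le_of_le tendsto_const_nhds hlim (fun _ => bot_le)
      fun n => eLpNorm_le_two_mul le_rfl (by norm_num) hsQ _
  · have horth := hq.orthogonal hQ (ExtRel.of_mem hQ hQ.isLinOn_bellman hk)
    obtain ⟨u, hau, htQ, hlu⟩ := hq.1
    have hkm := hQ.isLinOn_bellman.memLp k hk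
    have hkP := memLp_of_le_two_smul (saLaw_le_two_smul hn.ge_two_smul) hkm
    have hau' := hau.of_near hn.ge_two_smul
    have i1 := hn.integrable (hwk.integrable_sub hkP)
    -- No L¹ bounds are available at Q, so T_Q(q) is identified with q − v through P: along
    -- approximants u_n, the error is bounded under P by a multiple of ‖u_n − q‖_P, and under Q by
    -- twice that.
    have e : ∫ w, B.bellman Q k (stateAction w) * tQ (stateAction w) ∂Q
        = ∫ w, B.bellman Q k (stateAction w) * (q (stateAction w) - v (nextState w)) ∂Q := by
      rw [← integral_mul_saLaw hkm htQ]
      refine (tendsto_nhds_unique ?_ (tendsto_integral_mul hkm htQ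
        (fun n => hQ.isLinOn_bellman.memLp _ (hau.1 n)) hlu)).symm
      rw [tendsto_iff_dist_tendsto_zero]
      have hlim : Tendsto (fun n => 2 * (A * saNorm P (B.bellman Q k))
          * saNorm P (fun z => u n z - q z)) atTop (𝓝 0) := by
        simpa only [mul_zero] using
          hau'.tendsto_saNorm.const_mul (2 * (A * saNorm P (B.bellman Q k)))
      refine squeeze_zero (fun _ => dist_nonneg) (fun n => ?_) hlim
      have hd := (isExt_of_mem hP hS.cond (hau.1 n)).sub hP hS.cond hext
      have hb := hA.residual _ _ _ hd.value hd.memLp hkP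
      have hi := (hA.isWeakBellman hd).integrable_sub hkP
      have hb' := abs_integral_le_integral_abs.trans (hn.integral_abs_le hi)
      have hwQ := hQ.isWeakBellman (hau.1 n)
      have e2 : ∫ z, B.bellman Q k z * B.bellman Q (u n) z ∂(saLaw Q)
          - ∫ w, B.bellman Q k (stateAction w) * (q (stateAction w) - v (nextState w)) ∂Q
          = ∫ w, B.bellman Q k (stateAction w) * (u n (stateAction w) - q (stateAction w)
            - (B.γ * B.value (u n) (nextState w) - v (nextState w))) ∂Q := by
        rw [integral_mul_saLaw hkm hwQ.memLp_image, ← hwQ.integral_eq _ hkm,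
          ← integral_sub (hwQ.integrable_sub hkm) i1]
        refine integral_congr_ae (Eventually.of_forall fun w => ?_)
        simp only; ring
      rw [Real.dist_eq, e2]
      linarith
    have j1 := integrable_mul_of_memLp_two (memLp_comp_stateAction hkm) hQ.memLp_outcome
    have j2 := integrable_mul_of_memLp_two (memLp_comp_stateAction hkm)
      (memLp_comp_stateAction htQ)
    rw [← horth, integral_mul_sub (memLp_comp_stateAction hkm) hQ.memLp_outcome
      (memLp_comp_stateAction htQ), e, ← integral_sub j1 i1]
    simp only [mul_sub]

/-- The Bellman operators of nearby laws are close to each other. -/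
theorem ExtBounds.saNorm_bellman_sub_le (hA : B.ExtBounds P A) (hn : IsNear P Q η)
    (hQ : B.IsLaw Q) {h : Lp ℝ ∞ B.dom} (hh : h ∈ B.H) :
    saNorm P (fun z => B.bellman P h z - B.bellman Q h z) ≤ 4 * A * η * saNorm P h := by
  have hP := hA.strong.isLaw
  have hext := isExt_of_mem hP hA.strong.cond hh
  have hQm := hQ.isLinOn_bellman.memLp h hh
  have hσ : MemLp (fun z => B.bellman P h z - B.bellman Q h z) 2 (saLaw P) :=
    hext.memLp_image.sub (memLp_of_le_two_smul (saLaw_le_two_smul hn.ge_two_smul) hQm)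
  have hσQ := memLp_of_le_two_smul (saLaw_le_two_smul hn.le_two_smul) hσ
  set σ := fun z => B.bellman P h z - B.bellman Q h z with hσdef
  obtain ⟨i1, e1, b1⟩ := hA.resid_spec hext hσ
  have hw := hQ.isWeakBellman hh
  have h1 := hn.integral_mul_self_le (memLp_comp_stateAction hσ)
  -- Under Q, T_Q(h) tested against σ equals h − γV^π(h), so ‖σ‖²_Q is the Q-mean of σ times the
  -- residual of h at P. Its P-mean vanishes, which leaves a bound of order η‖σ‖‖h‖; one factor ‖σ‖
  -- is then cancelled.
  have h2 : ∫ w, σ (stateAction w) * σ (stateAction w) ∂Q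
      = ∫ w, σ (stateAction w)
        * resid h (B.bellman P h) (fun s => B.γ * B.value h s) w ∂Q := by
    have j1 := integrable_mul_of_memLp_two (memLp_comp_stateAction hσQ)
      (memLp_comp_stateAction (memLp_of_le_two_smul (saLaw_le_two_smul hn.le_two_smul)
        hext.memLp_image))
    have j2 := integrable_mul_of_memLp_two (memLp_comp_stateAction hσQ)
      (memLp_comp_stateAction hQm)
    have j3 := hw.integrable_sub hσQ
    have h3 : ∫ w, σ (stateAction w) * σ (stateAction w) ∂Q
        = ∫ w, σ (stateAction w) * B.bellman P h (stateAction w) ∂Q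
          - ∫ w, σ (stateAction w) * B.bellman Q h (stateAction w) ∂Q := by
      rw [← integral_sub j1 j2]
      refine integral_congr_ae (Eventually.of_forall fun w => ?_)
      simp only [hσdef]; ring
    rw [h3, ← hw.integral_eq σ hσQ, ← integral_sub j1 j3]
    refine integral_congr_ae (Eventually.of_forall fun w => ?_)
    simp only [resid]; ring
  have h3 := (abs_le.1 (hn.abs_integral_sub_le i1)).2
  rw [e1, sub_zero] at h3
  rw [← saNorm_sq hσ, h2] at h1
  have h4 := mul_le_mul_of_nonneg_left b1 hn.nonneg
  have h5 : saNorm P σ * saNorm P σ ≤ saNorm P σ * (4 * A * η * saNorm P h) := by nlinarith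
  rcases (saNorm_nonneg P σ).eq_or_lt with h0 | h0
  · rw [← h0]
    have := hA.nonneg
    have := hn.nonneg
    have := saNorm_nonneg P h
    positivity
  · exact le_of_mul_le_mul_left h5 h0

end BellmanProblem

/-! ### The corrected estimating equation and the second-order expansion -/

namespace BellmanProblem

variable {𝒮 𝒜 : Type*} [MeasurableSpace 𝒮] [MeasurableSpace 𝒜] {B : BellmanProblem 𝒮 𝒜}
  {P Q : Measure (Transition 𝒮 𝒜)} {𝓜 : Set (Measure (Transition 𝒮 𝒜))}
  {f t g q tq gq q₀ t₀ g₀ u : 𝒮 × 𝒜 → ℝ} {v vq v₀ : 𝒮 → ℝ} {A η : ℝ}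

theorem saNorm_le_add_sub {f g : 𝒮 × 𝒜 → ℝ} (hf : MemLp f 2 (saLaw P))
    (hg : MemLp g 2 (saLaw P)) :
    saNorm P f ≤ saNorm P g + saNorm P (fun z => f z - g z) := by
  have h1 := eLpNorm_le_add_sub (p := 2) (by norm_num) hf hg
  rw [eLpNorm_sub_comm'] at h1
  have h2 := ENNReal.toReal_mono (ENNReal.add_ne_top.2 ⟨hg.2.ne, (hf.sub hg).2.ne⟩) h1
  rwa [ENNReal.toReal_add hg.2.ne (by exact (hf.sub hg).2.ne)] at h2

/-- The estimating function for `q`, tested against the image `t` of `f`, and corrected to first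
order, where `u` is the mean residual. -/
def crossTerm (q : 𝒮 × 𝒜 → ℝ) (vq : 𝒮 → ℝ) (u f t : 𝒮 × 𝒜 → ℝ) (v : 𝒮 → ℝ)
    (w : Transition 𝒮 𝒜) : ℝ :=
  t (stateAction w) * (outcome w - (q (stateAction w) - vq (nextState w)))
    - u (stateAction w) * resid f t v w

/-- Under P the correction has mean zero, so the mean is that of the plain estimating function. The
L¹ bound linear in ‖f‖ permits passage to the closure and costs only a factor η when P is replaced
by Q. -/
theorem ExtBounds.crossTerm_spec (hA : B.ExtBounds P A) (hq : B.IsExt P q tq vq gq)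
    (hu : MemLp u 2 (saLaw P)) (hf : B.IsExt P f t v g) :
    Integrable (crossTerm q vq u f t v) P ∧
    ∫ w, crossTerm q vq u f t v w ∂P
      = ∫ w, t (stateAction w) * outcome w ∂P - ∫ w, t (stateAction w) * tq (stateAction w) ∂P ∧
    ∫ w, |crossTerm q vq u f t v w| ∂P
      ≤ (A * (eLpNorm outcome 2 P).toReal + A ^ 2 * saNorm P q + 2 * A * saNorm P u)
        * saNorm P f := by
  have hP := hA.strong.isLaw
  have htP := memLp_comp_stateAction hf.memLp_image
  obtain ⟨i3, e3, b3⟩ := hA.resid_spec hf hu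
  have i1 := integrable_mul_of_memLp_two htP hP.memLp_outcome
  have hw := hA.isWeakBellman hq
  have i2 := hw.integrable_sub hf.memLp_image
  have e : crossTerm q vq u f t v = fun w => t (stateAction w) * outcome w
      - t (stateAction w) * (q (stateAction w) - vq (nextState w))
      - u (stateAction w) * resid f t v w := by
    funext w; simp only [crossTerm]; ring
  have i12 : Integrable (fun w => t (stateAction w) * outcome w
      - t (stateAction w) * (q (stateAction w) - vq (nextState w))) P := i1.sub i2
  refine ⟨by rw [e]; exact i12.sub i3, ?_, ?_⟩
  · rw [e, integral_sub i12 i3, integral_sub i1 i2, e3, hw.integral_eq _ hf.memLp_image, sub_zero]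
  · have b1 := integral_abs_mul_le htP hP.memLp_outcome
    rw [toReal_eLpNorm_comp_stateAction hf.memLp_image] at b1
    have b2 := hA.residual _ _ _ hq.value hq.memLp hf.memLp_image
    have b4 := hA.image _ _ hf.bellman
    have hA0 := hA.nonneg
    calc ∫ w, |crossTerm q vq u f t v w| ∂P
        ≤ ∫ w, (|t (stateAction w) * outcome w|
            + |t (stateAction w) * (q (stateAction w) - vq (nextState w))|
            + |u (stateAction w) * resid f t v w|) ∂P := by
          refine integral_mono_of_nonneg (Eventually.of_forall fun _ => abs_nonneg _)
            ((i1.abs.add i2.abs).add i3.abs) (Eventually.of_forall fun w => ?_)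
          simp only [e]
          exact (abs_sub _ _).trans (add_le_add_left (abs_sub _ _) _)
      _ ≤ A * saNorm P f * (eLpNorm outcome 2 P).toReal + A * (A * saNorm P f * saNorm P q)
            + 2 * A * (saNorm P u * saNorm P f) := by
          have i12' : Integrable (fun w => |t (stateAction w) * outcome w|
            + |t (stateAction w) * (q (stateAction w) - vq (nextState w))|) P := i1.abs.add i2.abs
          rw [integral_add i12' i3.abs, integral_add i1.abs i2.abs]
          refine add_le_add (add_le_add (b1.trans ?_) (b2.trans ?_)) b3
          · exact mul_le_mul_of_nonneg_right b4 ENNReal.toReal_nonneg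
          · exact mul_le_mul_of_nonneg_left
              (mul_le_mul_of_nonneg_right b4 (saNorm_nonneg _ _)) hA0
      _ = _ := by ring

/-- Let σ = T_P(h) − T_Q(h). The normal equation under Q removes T_Q(h), and under Q the correction
has mean E_Q[uσ]. What remains is the Q-mean of σ times the sum of Y₀ − r_P, the residual of q₀, and
minus (q − q₀) − (v_q − v₀). The first two products have P-mean zero and give O(η‖σ‖), the third is
O(‖q − q₀‖‖σ‖), and ‖σ‖ ≤ 4Aη‖h‖. -/
theorem ExtBounds.abs_integral_crossTerm_mem_le (hA : B.ExtBounds P A) (hn : IsNear P Q η)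
    (hQ : B.IsLaw Q) (hq₀ : B.IsExt P q₀ t₀ v₀ g₀) (hq : B.IsExt P q tq vq gq)
    (horth : ∀ h ∈ B.H, ∫ w, B.bellman Q h (stateAction w)
      * (outcome w - (q (stateAction w) - vq (nextState w))) ∂Q = 0)
    {h : Lp ℝ ∞ B.dom} (hh : h ∈ B.H) :
    |∫ w, crossTerm q vq (fun z => rewardFn P z - t₀ z) h (B.bellman P h)
        (fun s => B.γ * B.value h s) w ∂Q|
      ≤ 4 * A * η * (2 * A * saNorm P (fun z => q z - q₀ z)
        + η * ((eLpNorm outcome 2 P).toReal + saNorm P (rewardFn P) + 2 * A * saNorm P q₀))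
        * saNorm P h := by
  have hP := hA.strong.isLaw
  have hc := hA.strong.cond
  have hA0 := hA.nonneg
  have hη0 := hn.nonneg
  have hle := saLaw_le_two_smul hn.le_two_smul
  have hge := saLaw_le_two_smul hn.ge_two_smul
  have hext := isExt_of_mem hP hc hh
  have hd := hq.sub hP hc hq₀
  have hr := hP.memLp_rewardFn
  have hu : MemLp (fun z => rewardFn P z - t₀ z) 2 (saLaw P) := hr.sub hq₀.memLp_image
  have hTQ := hQ.isLinOn_bellman.memLp h hh
  have hTQP := memLp_of_le_two_smul hge hTQ
  have hσ : MemLp (fun z => B.bellman P h z - B.bellman Q h z) 2 (saLaw P) :=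
    hext.memLp_image.sub hTQP
  have bσ := hA.saNorm_bellman_sub_le hn hQ hh
  set σ := fun z => B.bellman P h z - B.bellman Q h z with hσdef
  have hσP := memLp_comp_stateAction hσ
  have hwq := hA.isWeakBellman hq
  have hwd := hA.isWeakBellman hd
  have hwQ := hQ.isWeakBellman hh
  have huQ := memLp_of_le_two_smul hle hu
  have a1 : Integrable (fun w => σ (stateAction w) * outcome w) P :=
    integrable_mul_of_memLp_two hσP hP.memLp_outcome
  have a2 : Integrable (fun w => σ (stateAction w) * rewardFn P (stateAction w)) P :=
    integrable_mul_of_memLp_two hσP (memLp_comp_stateAction hr)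
  obtain ⟨a3, z3, b3⟩ := hA.resid_spec hq₀ hσ
  have a4 := hwd.integrable_sub hσ
  have b4 := hA.residual _ _ _ hd.value hd.memLp hσ
  have a12 : Integrable (fun w => σ (stateAction w) * outcome w
      - σ (stateAction w) * rewardFn P (stateAction w)) P := a1.sub a2
  have z12 : ∫ w, (σ (stateAction w) * outcome w
      - σ (stateAction w) * rewardFn P (stateAction w)) ∂P = 0 := by
    rw [integral_sub a1 a2, hP.integral_mul_rewardFn hσ, sub_self]
  have b12 : ∫ w, |σ (stateAction w) * outcome w
      - σ (stateAction w) * rewardFn P (stateAction w)| ∂P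
      ≤ saNorm P σ * ((eLpNorm outcome 2 P).toReal + saNorm P (rewardFn P)) := by
    have c1 := integral_abs_mul_le hσP hP.memLp_outcome
    rw [toReal_eLpNorm_comp_stateAction hσ] at c1
    have c2 := integral_abs_mul_le_saNorm hσ hr
    calc _ ≤ ∫ w, (|σ (stateAction w) * outcome w|
          + |σ (stateAction w) * rewardFn P (stateAction w)|) ∂P :=
        integral_mono_of_nonneg (Eventually.of_forall fun _ => abs_nonneg _)
          (a1.abs.add a2.abs) (Eventually.of_forall fun w => abs_sub _ _)
      _ ≤ _ := by
        rw [integral_add a1.abs a2.abs, mul_add]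
        exact add_le_add c1 c2
  have d12 := hn.abs_integral_sub_le a12
  have d3 := hn.abs_integral_sub_le a3
  have d4 := abs_integral_le_integral_abs.trans (hn.integral_abs_le a4)
  rw [z12, sub_zero] at d12
  rw [z3, sub_zero] at d3
  have k1 : Integrable (fun w => B.bellman Q h (stateAction w)
      * (outcome w - (q (stateAction w) - vq (nextState w)))) Q := by
    refine ((integrable_mul_of_memLp_two (memLp_comp_stateAction hTQ) hQ.memLp_outcome).sub
      (hn.integrable (hwq.integrable_sub hTQP))).congr (Eventually.of_forall fun w => ?_)
    simp only [Pi.sub_apply]; ring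
  have k2 := hn.integrable a12
  have k3 := hn.integrable a3
  have k4 := hn.integrable a4
  have k5 := integrable_mul_of_memLp_two (memLp_comp_stateAction huQ) (memLp_comp_stateAction hTQ)
  have k6 := hwQ.integrable_sub huQ
  have e : ∫ w, crossTerm q vq (fun z => rewardFn P z - t₀ z) h (B.bellman P h)
        (fun s => B.γ * B.value h s) w ∂Q
      = ∫ w, (σ (stateAction w) * outcome w
          - σ (stateAction w) * rewardFn P (stateAction w)) ∂Q
        + ∫ w, σ (stateAction w) * resid q₀ t₀ v₀ w ∂Q
        - ∫ w, σ (stateAction w) * (q (stateAction w) - q₀ (stateAction w)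
          - (vq (nextState w) - v₀ (nextState w))) ∂Q := by
    have z : ∫ w, (rewardFn P (stateAction w) - t₀ (stateAction w))
        * B.bellman Q h (stateAction w) ∂Q
        - ∫ w, (rewardFn P (stateAction w) - t₀ (stateAction w))
        * (h (stateAction w) - B.γ * B.value h (nextState w)) ∂Q = 0 :=
      sub_eq_zero.2 (hwQ.integral_eq _ huQ).symm
    rw [← add_zero (∫ w, (σ (stateAction w) * outcome w
          - σ (stateAction w) * rewardFn P (stateAction w)) ∂Q), ← horth h hh,
      ← sub_zero (_ + _ - _), ← z, ← integral_add k2 k1, ← integral_sub k5 k6]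
    have k21 : Integrable (fun w => σ (stateAction w) * outcome w
        - σ (stateAction w) * rewardFn P (stateAction w) + B.bellman Q h (stateAction w)
        * (outcome w - (q (stateAction w) - vq (nextState w)))) Q := k2.add k1
    have k56 : Integrable (fun w => (rewardFn P (stateAction w) - t₀ (stateAction w))
        * B.bellman Q h (stateAction w) - (rewardFn P (stateAction w) - t₀ (stateAction w))
        * (h (stateAction w) - B.γ * B.value h (nextState w))) Q := k5.sub k6
    have k213 : Integrable (fun w => σ (stateAction w) * outcome w
        - σ (stateAction w) * rewardFn P (stateAction w) + B.bellman Q h (stateAction w)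
        * (outcome w - (q (stateAction w) - vq (nextState w)))
        + σ (stateAction w) * resid q₀ t₀ v₀ w) Q := k21.add k3
    rw [← integral_add k21 k3, ← integral_sub k213 k4, ← integral_sub (by exact k213.sub k4) k56]
    refine integral_congr_ae (Eventually.of_forall fun w => ?_)
    simp only [crossTerm, resid, hσdef]
    ring
  rw [e]
  have hσ0 := saNorm_nonneg P σ
  have hsum : saNorm P σ * (2 * A * saNorm P (fun z => q z - q₀ z)
      + η * ((eLpNorm outcome 2 P).toReal + saNorm P (rewardFn P) + 2 * A * saNorm P q₀))
      ≤ 4 * A * η * saNorm P h * (2 * A * saNorm P (fun z => q z - q₀ z)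
      + η * ((eLpNorm outcome 2 P).toReal + saNorm P (rewardFn P) + 2 * A * saNorm P q₀)) := by
    refine mul_le_mul_of_nonneg_right bσ ?_
    have := saNorm_nonneg P (fun z => q z - q₀ z)
    have := saNorm_nonneg P (rewardFn P)
    have := saNorm_nonneg P q₀
    have : 0 ≤ (eLpNorm (outcome : Transition 𝒮 𝒜 → ℝ) 2 P).toReal := ENNReal.toReal_nonneg
    positivity
  have m12 := mul_le_mul_of_nonneg_left b12 hη0
  have m3 := mul_le_mul_of_nonneg_left b3 hη0
  refine (abs_sub _ _).trans ((add_le_add_left (abs_add_le _ _) _).trans ?_)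
  linarith

/-- The cross term is linear in (f, t, v) and bounded in L¹(P) by a multiple of ‖f‖, so the estimate
on H extends to the closure. -/
theorem ExtBounds.abs_integral_crossTerm_le (hA : B.ExtBounds P A) (hn : IsNear P Q η)
    (hQ : B.IsLaw Q) (hq₀ : B.IsExt P q₀ t₀ v₀ g₀) (hq : B.IsExt P q tq vq gq)
    (horth : ∀ h ∈ B.H, ∫ w, B.bellman Q h (stateAction w)
      * (outcome w - (q (stateAction w) - vq (nextState w))) ∂Q = 0)
    (hf : B.IsExt P f t v g) :
    |∫ w, crossTerm q vq (fun z => rewardFn P z - t₀ z) f t v w ∂Q|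
      ≤ 4 * A * η * (2 * A * saNorm P (fun z => q z - q₀ z)
        + η * ((eLpNorm outcome 2 P).toReal + saNorm P (rewardFn P) + 2 * A * saNorm P q₀))
        * saNorm P f := by
  have hP := hA.strong.isLaw
  have hc := hA.strong.cond
  have hu : MemLp (fun z => rewardFn P z - t₀ z) 2 (saLaw P) :=
    hP.memLp_rewardFn.sub hq₀.memLp_image
  obtain ⟨h, ha, -, -⟩ := hf.bellman
  set K := 4 * A * η * (2 * A * saNorm P (fun z => q z - q₀ z)
        + η * ((eLpNorm outcome 2 P).toReal + saNorm P (rewardFn P) + 2 * A * saNorm P q₀)) with hK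
  have hK0 : 0 ≤ K := by
    have := hA.nonneg
    have := hn.nonneg
    have := saNorm_nonneg P (fun z => q z - q₀ z)
    have := saNorm_nonneg P (rewardFn P)
    have := saNorm_nonneg P q₀
    have : 0 ≤ (eLpNorm (outcome : Transition 𝒮 𝒜 → ℝ) 2 P).toReal := ENNReal.toReal_nonneg
    positivity
  set c := A * (eLpNorm outcome 2 P).toReal + A ^ 2 * saNorm P q
    + 2 * A * saNorm P (fun z => rewardFn P z - t₀ z) with hcdef
  have hlim : Tendsto (fun n => K * (saNorm P f + saNorm P (fun z => h n z - f z))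
      + 2 * (c * saNorm P (fun z => h n z - f z))) atTop (𝓝 (K * saNorm P f)) := by
    have h1 := (tendsto_const_nhds (x := saNorm P f)).add ha.tendsto_saNorm
    have h2 := (h1.const_mul K).add ((ha.tendsto_saNorm.const_mul c).const_mul 2)
    simpa only [add_zero, mul_zero] using h2
  refine ge_of_tendsto' hlim fun n => ?_
  have hh := isExt_of_mem hP hc (ha.1 n)
  have hd := hh.sub hP hc hf
  obtain ⟨i1, -, -⟩ := hA.crossTerm_spec hq hu hh
  obtain ⟨i2, -, b2⟩ := hA.crossTerm_spec hq hu hd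
  have e : ∫ w, crossTerm q vq (fun z => rewardFn P z - t₀ z) f t v w ∂Q
      = ∫ w, crossTerm q vq (fun z => rewardFn P z - t₀ z) (h n) (B.bellman P (h n))
        (fun s => B.γ * B.value (h n) s) w ∂Q
      - ∫ w, crossTerm q vq (fun z => rewardFn P z - t₀ z) (fun z => h n z - f z)
        (fun z => B.bellman P (h n) z - t z) (fun s => B.γ * B.value (h n) s - v s) w ∂Q := by
    rw [← integral_sub (hn.integrable i1) (hn.integrable i2)]
    refine integral_congr_ae (Eventually.of_forall fun w => ?_)
    simp only [crossTerm, resid]; ring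
  have m1 := hA.abs_integral_crossTerm_mem_le hn hQ hq₀ hq horth (ha.1 n)
  have m2 := abs_integral_le_integral_abs.trans (hn.integral_abs_le i2)
  have m3 := mul_le_mul_of_nonneg_left (saNorm_le_add_sub hh.memLp hf.memLp) hK0
  rw [e]
  refine (abs_sub _ _).trans (add_le_add (m1.trans m3) (m2.trans ?_))
  exact mul_le_mul_of_nonneg_left b2 (by norm_num)

/-- The projection depends continuously, in fact at a linear rate, on the law. -/
theorem ExtBounds.saNorm_projection_sub_le (hA : B.ExtBounds P A) (hn : IsNear P Q η)
    (hQ : B.IsLaw Q) (hp₀ : B.IsBellmanProjection P q₀ t₀) (hq₀ : B.IsExt P q₀ t₀ v₀ g₀)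
    (hq : B.IsExt P q tq vq gq)
    (horth : ∀ h ∈ B.H, ∫ w, B.bellman Q h (stateAction w)
      * (outcome w - (q (stateAction w) - vq (nextState w))) ∂Q = 0)
    (hη : 18 * A ^ 4 * η ≤ 1) :
    saNorm P (fun z => q z - q₀ z) ≤ 2 * A ^ 2 * (A * (eLpNorm outcome 2 P).toReal
      + A ^ 2 * saNorm P q₀ + 2 * A * saNorm P (fun z => rewardFn P z - t₀ z)
      + 2 * A * ((eLpNorm outcome 2 P).toReal + saNorm P (rewardFn P) + 2 * A * saNorm P q₀))
      * η := by
  have hP := hA.strong.isLaw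
  have hc := hA.strong.cond
  have hA0 := hA.nonneg
  have hη0 := hn.nonneg
  have hη2 := hn.le_half
  have hu : MemLp (fun z => rewardFn P z - t₀ z) 2 (saLaw P) :=
    hP.memLp_rewardFn.sub hq₀.memLp_image
  have hd := hq.sub hP hc hq₀
  obtain ⟨i1, e1, b1⟩ := hA.crossTerm_spec hq hu hd
  have b2 := hA.abs_integral_crossTerm_le hn hQ hq₀ hq horth hd
  have b3 := hn.abs_integral_sub_le i1
  have ho := hp₀.orthogonal hP hd.bellman
  have hdP := memLp_comp_stateAction hd.memLp_image
  rw [integral_mul_sub hdP hP.memLp_outcome (memLp_comp_stateAction hq₀.memLp_image)] at ho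
  -- At f = q − q₀ the normal equation under P replaces the outcome by t₀, and the P-mean of the
  -- cross term becomes −‖T_P(q − q₀)‖². Its smallness under Q thus controls q − q₀.
  have e2 : saNorm P (fun z => tq z - t₀ z) ^ 2
      = -∫ w, crossTerm q vq (fun z => rewardFn P z - t₀ z) (fun z => q z - q₀ z)
        (fun z => tq z - t₀ z) (fun s => vq s - v₀ s) w ∂P := by
    rw [saNorm_sq hd.memLp_image, e1, integral_mul_sub hdP (memLp_comp_stateAction hq.memLp_image)
      (memLp_comp_stateAction hq₀.memLp_image)]
    linarith
  have b4 := hA.inverse _ _ hd.bellman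
  have b5 := saNorm_le_add_sub hq.memLp hq₀.memLp
  set D := saNorm P (fun z => q z - q₀ z) with hD
  have hD0 : 0 ≤ D := saNorm_nonneg _ _
  set Y := (eLpNorm (outcome : Transition 𝒮 𝒜 → ℝ) 2 P).toReal
  set R := saNorm P (rewardFn P)
  set N := saNorm P q₀
  set U := saNorm P (fun z => rewardFn P z - t₀ z)
  set S := saNorm P (fun z => tq z - t₀ z) with hSdef
  have hS0 : 0 ≤ S := saNorm_nonneg _ _
  have hY0 : 0 ≤ Y := ENNReal.toReal_nonneg
  have hR0 : 0 ≤ R := saNorm_nonneg _ _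
  have hN0 : 0 ≤ N := saNorm_nonneg _ _
  have hU0 : 0 ≤ U := saNorm_nonneg _ _
  have s1 : S ^ 2 ≤ η * ((A * Y + A ^ 2 * (N + D) + 2 * A * U) * D)
      + 4 * A * η * (2 * A * D + η * (Y + R + 2 * A * N)) * D := by
    have h1 := (abs_le.1 b3).2
    have h2 := (abs_le.1 b2).1
    have h3 : η * ∫ w, |crossTerm q vq (fun z => rewardFn P z - t₀ z) (fun z => q z - q₀ z)
        (fun z => tq z - t₀ z) (fun s => vq s - v₀ s) w| ∂P
        ≤ η * ((A * Y + A ^ 2 * (N + D) + 2 * A * U) * D) := by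
      refine mul_le_mul_of_nonneg_left (b1.trans ?_) hη0
      gcongr
    linarith
  have s2 : D ^ 2 ≤ A ^ 2 * S ^ 2 := by
    rw [← mul_pow]
    exact pow_le_pow_left₀ hD0 b4 2
  have s3 : η * (Y + R + 2 * A * N) ≤ 1 / 2 * (Y + R + 2 * A * N) :=
    mul_le_mul_of_nonneg_right hη2 (by positivity)
  set E := A * Y + A ^ 2 * N + 2 * A * U + 2 * A * (Y + R + 2 * A * N) with hE
  -- Here 9 = 1 + 8: one A²D comes from ‖q‖ ≤ ‖q₀‖ + D, eight from 4A·2A. The spare factor η ≤ 1/2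
  -- turns 4A into the 2A in E.
  have s4 : S ^ 2 ≤ η * (E + 9 * A ^ 2 * D) * D := by
    refine s1.trans ?_
    have : 4 * A * η * (2 * A * D + η * (Y + R + 2 * A * N)) * D
        ≤ 4 * A * η * (2 * A * D + 1 / 2 * (Y + R + 2 * A * N)) * D := by gcongr
    refine (add_le_add_right this _).trans_eq ?_
    rw [hE]; ring
  have s5 : D * D ≤ D * (A ^ 2 * η * (E + 9 * A ^ 2 * D)) := by
    have := mul_le_mul_of_nonneg_left s4 (sq_nonneg A)
    linarith
  -- After division by D, the assumption 18A⁴η ≤ 1 absorbs the term 9A⁴ηD into D/2; this is the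
  -- origin of the leading 2.
  rcases hD0.eq_or_lt with h0 | h0
  · rw [← h0]; positivity
  · have s6 := le_of_mul_le_mul_left s5 h0
    have s7 := mul_le_mul_of_nonneg_right hη hD0
    linarith

/-- The parameter has a first order expansion around `P`, with a remainder that is quadratic in the
distance of the densities. -/
theorem StrongCondition.exists_quadratic_bound (hS : B.StrongCondition P) {η₀ : NuisanceFns 𝒮 𝒜}
    (hη₀ : B.IsNuisance P η₀) :
    ∃ C δ : ℝ, 0 < δ ∧ ∀ (Q : Measure (Transition 𝒮 𝒜)) (η : ℝ), B.IsLaw Q → B.ConditionAt Q →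
      IsNear P Q η → η ≤ δ →
      |B.target Q - B.target P - ∫ w, influenceFn η₀ (B.target P) w ∂Q| ≤ C * η ^ 2 := by
  obtain ⟨A, hA⟩ := hS.exists_extBounds
  have hP := hS.isLaw
  have hc := hS.cond
  have hA0 := hA.nonneg
  have hp₀ := hη₀.projection
  have hq₀ : B.IsExt P η₀.q η₀.Tq η₀.Vq η₀.mq := ⟨hp₀.1, hη₀.value_q, hη₀.integrand_q⟩
  obtain ⟨_, haα, _⟩ := hη₀.riesz.1
  obtain ⟨gα, hgα⟩ := hS.exists_integrandExt haα
  have hα : B.IsExt P η₀.α η₀.Tα η₀.Vα gα := ⟨hη₀.riesz.1, hη₀.value_α, hgα⟩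
  have hu : MemLp (fun z => rewardFn P z - η₀.Tq z) 2 (saLaw P) :=
    hP.memLp_rewardFn.sub hq₀.memLp_image
  set F := (eLpNorm (outcome : Transition 𝒮 𝒜 → ℝ) 2 P).toReal + saNorm P (rewardFn P)
    + 2 * A * saNorm P η₀.q with hF
  set E := 2 * A ^ 2 * (A * (eLpNorm outcome 2 P).toReal
      + A ^ 2 * saNorm P η₀.q + 2 * A * saNorm P (fun z => rewardFn P z - η₀.Tq z)
      + 2 * A * F) with hE
  -- Eη bounds ‖q_Q − q_P‖. The first summand comes from the cross term at α, the second from the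
  -- centered term in q_Q − q_P; the choice of δ secures 18A⁴η ≤ 1.
  refine ⟨4 * A * (2 * A * E + F) * saNorm P η₀.α + (A * saNorm P η₀.Tα + A) * E,
    1 / (18 * A ^ 4 + 1), by positivity, fun Q η hQ hcQ hn hη => ?_⟩
  have hη0 := hn.nonneg
  obtain ⟨q, tq, vq, gq, hq, htar, horth⟩ := hA.exists_projection_near hn hQ hcQ
  have hη' : 18 * A ^ 4 * η ≤ 1 := by
    rw [le_div_iff₀ (by positivity)] at hη
    linarith
  have hDle := hA.saNorm_projection_sub_le hn hQ hp₀ hq₀ hq horth hη'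
  rw [← hF, ← hE] at hDle
  have hΦ := hA.abs_integral_crossTerm_le hn hQ hq₀ hq horth hα
  rw [← hF] at hΦ
  have hd := hq.sub hP hc hq₀
  obtain ⟨iG, -, -⟩ := hA.crossTerm_spec hq hu hα
  have hwd := hA.isWeakBellman hd
  have iU := hwd.integrable_sub hα.memLp_image
  have bU := hA.residual _ _ _ hd.value hd.memLp hα.memLp_image
  have ig := hd.integrable
  have bg := hA.integrand _ _ hd.integrand
  have iX : Integrable (fun w => η₀.Tα (stateAction w)
      * (q (stateAction w) - η₀.q (stateAction w) - (vq (nextState w) - η₀.Vq (nextState w)))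
      - (gq (stateAction w) - η₀.mq (stateAction w))) P := iU.sub ig
  -- By the weak Bellman identity and the Riesz identity at q_Q − q_P, both parts have mean ⟨T_P(α),
  -- T_P(q_Q − q_P)⟩. So the Q-mean is at most η times an L¹ norm of order η.
  have zX : ∫ w, (η₀.Tα (stateAction w)
      * (q (stateAction w) - η₀.q (stateAction w) - (vq (nextState w) - η₀.Vq (nextState w)))
      - (gq (stateAction w) - η₀.mq (stateAction w))) ∂P = 0 := by
    have hgm : AEStronglyMeasurable (fun z => gq z - η₀.mq z) (saLaw P) := by
      obtain ⟨_, _, h, _⟩ := hd.integrand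
      exact h.1
    rw [integral_sub iU ig, hwd.integral_eq _ hα.memLp_image, sub_eq_zero,
      ← integral_saLaw P hgm, hd.integrand.integral_eq hP hc hη₀.riesz hd.bellman,
      integral_mul_saLaw hα.memLp_image hd.memLp_image]
  have bX := hn.abs_integral_sub_le iX
  rw [zX, sub_zero] at bX
  have bX' : ∫ w, |η₀.Tα (stateAction w)
      * (q (stateAction w) - η₀.q (stateAction w) - (vq (nextState w) - η₀.Vq (nextState w)))
      - (gq (stateAction w) - η₀.mq (stateAction w))| ∂P
      ≤ A * (saNorm P η₀.Tα * saNorm P (fun z => q z - η₀.q z))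
        + A * saNorm P (fun z => q z - η₀.q z) := by
    refine (integral_mono_of_nonneg (Eventually.of_forall fun _ => abs_nonneg _)
      (iU.abs.add ig.abs) (Eventually.of_forall fun w => abs_sub _ _)).trans ?_
    simp only [Pi.add_apply]
    rw [integral_add iU.abs ig.abs]
    exact add_le_add bU bg
  have hrQ : ∀ᵐ w ∂Q, η₀.r (stateAction w) = rewardFn P (stateAction w) :=
    hn.ac.ae_le ((stateAction_quasi P).ae hη₀.reward)
  have := hQ.prob
  -- Exchanging q_P for q_Q splits the influence function into the cross term at α, the centered
  -- term above, and m(q_Q) − Ψ(P); the last has Q-mean Ψ(Q) − Ψ(P).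
  have e : ∫ w, influenceFn η₀ (B.target P) w ∂Q
      = ∫ w, crossTerm q vq (fun z => rewardFn P z - η₀.Tq z) η₀.α η₀.Tα η₀.Vα w ∂Q
      + ∫ w, (η₀.Tα (stateAction w)
      * (q (stateAction w) - η₀.q (stateAction w) - (vq (nextState w) - η₀.Vq (nextState w)))
      - (gq (stateAction w) - η₀.mq (stateAction w))) ∂Q
      + ∫ w, gq (stateAction w) ∂Q - ∫ _, B.target P ∂Q := by
    have j1 := hn.integrable iG
    have j2 := hn.integrable iX
    have j3 := hn.integrable hq.integrable
    have j12 : Integrable (fun w =>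
      crossTerm q vq (fun z => rewardFn P z - η₀.Tq z) η₀.α η₀.Tα η₀.Vα w
      + (η₀.Tα (stateAction w)
      * (q (stateAction w) - η₀.q (stateAction w) - (vq (nextState w) - η₀.Vq (nextState w)))
      - (gq (stateAction w) - η₀.mq (stateAction w)))) Q := j1.add j2
    rw [← integral_add j1 j2, ← integral_add j12 j3,
      ← integral_sub (by exact j12.add j3) (integrable_const _)]
    refine integral_congr_ae ?_
    filter_upwards [hrQ] with w hw
    simp only [influenceFn, crossTerm, resid, hw]
    ring
  rw [e, ← htar, integral_const, probReal_univ, one_smul]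
  set Φ := ∫ w, crossTerm q vq (fun z => rewardFn P z - η₀.Tq z) η₀.α η₀.Tα η₀.Vα w ∂Q
  set X := ∫ w, (η₀.Tα (stateAction w)
      * (q (stateAction w) - η₀.q (stateAction w) - (vq (nextState w) - η₀.Vq (nextState w)))
      - (gq (stateAction w) - η₀.mq (stateAction w))) ∂Q
  have e2 : B.target Q - B.target P - (Φ + X + B.target Q - B.target P) = -(Φ + X) := by ring
  rw [e2, abs_neg]
  refine (abs_add_le _ _).trans ?_
  have hα0 := saNorm_nonneg P η₀.α
  have hT0 := saNorm_nonneg P η₀.Tα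
  have c1 : 4 * A * η * (2 * A * saNorm P (fun z => q z - η₀.q z) + η * F) * saNorm P η₀.α
      ≤ 4 * A * η * (2 * A * (E * η) + η * F) * saNorm P η₀.α := by gcongr
  have c2 : η * (A * (saNorm P η₀.Tα * saNorm P (fun z => q z - η₀.q z))
        + A * saNorm P (fun z => q z - η₀.q z))
      ≤ η * (A * (saNorm P η₀.Tα * (E * η)) + A * (E * η)) := by gcongr
  have c3 := mul_le_mul_of_nonneg_left bX' hη0
  linarith

end BellmanProblem

/-! ### Regular submodels and the tangent space -/

section Scores

variable {Ω : Type*} [MeasurableSpace Ω] {P₀ : Measure Ω} {𝓜 : Set (Measure Ω)}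

theorem ae_abs_le_toReal_eLpNorm_top {μ : Measure Ω} {f : Ω → ℝ} (hf : eLpNorm f ∞ μ ≠ ∞) :
    ∀ᵐ w ∂μ, |f w| ≤ (eLpNorm f ∞ μ).toReal := by
  filter_upwards [ae_le_eLpNormEssSup (f := f) (μ := μ)] with w hw
  rw [← Real.norm_eq_abs, ← toReal_enorm]
  exact ENNReal.toReal_mono hf (by rwa [eLpNorm_exponent_top])

/-- In a nonparametric model, bounded centered functions are scores. -/
theorem IsNonparametricAt.exists_isRegularSubmodel [IsProbabilityMeasure P₀]
    (hM : ∀ P ∈ 𝓜, IsProbabilityMeasure P) (h : IsNonparametricAt 𝓜 P₀) {φ : Ω → ℝ}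
    (hφ : Measurable φ) {M : ℝ} (hb : ∀ w, |φ w| ≤ M) (h0 : ∫ w, φ w ∂P₀ = 0) :
    ∃ P : ℝ → Measure Ω, IsRegularSubmodel 𝓜 P₀ P φ := by
  obtain ⟨δ, hδ, hmem⟩ := h φ hφ ⟨M, hb⟩ h0
  have hmem' : ∀ᶠ ε in 𝓝 (0 : ℝ),
      P₀.withDensity (fun w => ENNReal.ofReal (1 + ε * φ w)) ∈ 𝓜 := by
    filter_upwards [Metric.ball_mem_nhds (0 : ℝ) hδ] with ε hε
    exact hmem ε (by simpa using hε)
  refine ⟨fun ε => P₀.withDensity (fun w => ENNReal.ofReal (1 + ε * φ w)), by simp,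
    MemLp.of_bound hφ.aestronglyMeasurable M (Eventually.of_forall hb), hmem',
    Eventually.of_forall fun ε => withDensity_absolutelyContinuous _ _, ?_⟩
  refine tendsto_const_nhds.congr' ?_
  have hsmall : ∀ᶠ ε in 𝓝 (0 : ℝ), |ε| * |M| ≤ 1 / 2 := by
    have : Tendsto (fun ε : ℝ => |ε| * |M|) (𝓝 0) (𝓝 (|0| * |M|)) :=
      (continuous_abs.tendsto 0).mul_const _
    rw [abs_zero, zero_mul] at this
    exact this.eventually (ge_mem_nhds (by norm_num))
  filter_upwards [hmem'.filter_mono nhdsWithin_le_nhds, hsmall.filter_mono nhdsWithin_le_nhds,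
    self_mem_nhdsWithin] with ε h1 h2 h3
  have hd := (isNear_withDensity (P := P₀) (η := |ε| * |M|) (hφ.const_mul ε) (fun w => by
    rw [abs_mul]
    exact mul_le_mul_of_nonneg_left ((hb w).trans (le_abs_self M)) (abs_nonneg ε)) h2
    (hM _ h1)).2
  symm
  rw [← eLpNorm_zero (ε := ℝ) (p := ∞) (μ := P₀)]
  refine eLpNorm_congr_ae ?_
  filter_upwards [hd] with w hw
  rw [hw, mul_div_cancel_left₀ _ h3, sub_self]
  rfl

/-- In a nonparametric model, the tangent space consists of all centered functions. -/
theorem IsNonparametricAt.mem_tangentSpace [IsProbabilityMeasure P₀]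
    (hM : ∀ P ∈ 𝓜, IsProbabilityMeasure P) (h : IsNonparametricAt 𝓜 P₀) {g : Ω → ℝ}
    (hg : MemLp g 2 P₀) (h0 : ∫ w, g w ∂P₀ = 0) {δ : ℝ} (hδ : 0 < δ) :
    ∃ φ ∈ Submodule.span ℝ {φ : Ω → ℝ | ∃ P : ℝ → Measure Ω, IsRegularSubmodel 𝓜 P₀ P φ},
      eLpNorm (g - φ) 2 P₀ < ENNReal.ofReal δ := by
  have hδ2 : ENNReal.ofReal (δ / 2) ≠ 0 := by simpa using hδ
  obtain ⟨s, hs, hsm⟩ := hg.exists_simpleFunc_eLpNorm_sub_lt (by norm_num) hδ2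
  have hsi : Integrable s P₀ := hsm.integrable (by norm_num)
  obtain ⟨M, hMs⟩ := s.exists_forall_norm_le
  obtain ⟨P, hP⟩ := h.exists_isRegularSubmodel hM (φ := fun w => s w - ∫ w, s w ∂P₀)
    (s.measurable.sub_const _) (M := M + |∫ w, s w ∂P₀|)
    (fun w => (abs_sub _ _).trans (add_le_add_left (hMs w) _))
    (by rw [integral_sub hsi (integrable_const _), integral_const, probReal_univ, one_smul,
      sub_self])
  refine ⟨_, Submodule.subset_span ⟨P, hP⟩, ?_⟩
  -- As g is centered, the mean of s is, up to sign, that of g − s, so centering s costs at most the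
  -- approximation error again; hence δ/2.
  have hle : eLpNorm (fun _ : Ω => ∫ w, s w ∂P₀) 2 P₀ ≤ eLpNorm (g - ⇑s) 2 P₀ := by
    rw [eLpNorm_const _ (by norm_num) (IsProbabilityMeasure.ne_zero P₀), measure_univ,
      ENNReal.one_rpow, mul_one]
    have e : ∫ w, s w ∂P₀ = -∫ w, (g - ⇑s) w ∂P₀ := by
      simp only [Pi.sub_apply]
      rw [integral_sub (hg.integrable (by norm_num)) hsi, h0]; ring
    rw [e, enorm_neg]
    refine (enorm_integral_le_lintegral_enorm _).trans ?_
    rw [← eLpNorm_one_eq_lintegral_enorm]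
    exact eLpNorm_le_eLpNorm_of_exponent_le (by norm_num) (hg.sub hsm).1
  have e : (g - fun w => s w - ∫ w, s w ∂P₀) = (g - ⇑s) + fun _ => ∫ w, s w ∂P₀ := by
    funext w
    simp only [Pi.sub_apply, Pi.add_apply]; ring
  rw [e]
  calc _ ≤ eLpNorm (g - ⇑s) 2 P₀ + eLpNorm (fun _ : Ω => ∫ w, s w ∂P₀) 2 P₀ :=
        eLpNorm_add_le (hg.sub hsm).1 (by fun_prop) (by norm_num)
    _ < ENNReal.ofReal (δ / 2) + ENNReal.ofReal (δ / 2) :=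
        ENNReal.add_lt_add hs (hle.trans_lt hs)
    _ = ENNReal.ofReal δ := by
        rw [← ENNReal.ofReal_add (by positivity) (by positivity), add_halves]

/-- The difference quotient of the density is eventually within 1 of φ in L^∞, so L = 1 + ‖φ‖_∞
works. The point ε = 0 is left out, as the quotient carries no information there. -/
theorem IsRegularSubmodel.eventually_isNear {P : ℝ → Measure Ω} {φ : Ω → ℝ}
    (hM : ∀ P ∈ 𝓜, IsProbabilityMeasure P) [hP₀ : IsProbabilityMeasure P₀]
    (h : IsRegularSubmodel 𝓜 P₀ P φ) :
    ∃ L : ℝ, 0 ≤ L ∧ ∀ᶠ ε in 𝓝[≠] (0 : ℝ), IsNear P₀ (P ε) (L * |ε|) := by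
  refine ⟨1 + (eLpNorm φ ∞ P₀).toReal, by positivity, ?_⟩
  set L := 1 + (eLpNorm φ ∞ P₀).toReal
  have hsmall : ∀ᶠ ε in 𝓝 (0 : ℝ), L * |ε| ≤ 1 / 2 := by
    have : Tendsto (fun ε : ℝ => L * |ε|) (𝓝 0) (𝓝 (L * |0|)) :=
      (continuous_abs.tendsto 0).const_mul _
    rw [abs_zero, mul_zero] at this
    exact this.eventually (ge_mem_nhds (by norm_num))
  filter_upwards [h.mem.filter_mono nhdsWithin_le_nhds,
    h.dominated.filter_mono nhdsWithin_le_nhds, hsmall.filter_mono nhdsWithin_le_nhds,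
    h.differentiable.eventually (ge_mem_nhds zero_lt_one), self_mem_nhdsWithin]
    with ε h1 h2 h3 h4 h5
  refine ⟨hP₀, hM _ h1, h2, h3, ?_⟩
  filter_upwards [ae_abs_le_toReal_eLpNorm_top (h4.trans_lt ENNReal.one_lt_top).ne,
    ae_abs_le_toReal_eLpNorm_top h.score_bounded.2.ne] with w hw hw'
  have h6 : (eLpNorm (fun w => (((P ε).rnDeriv P₀ w).toReal - 1) / ε - φ w) ∞ P₀).toReal ≤ 1 := by
    simpa using ENNReal.toReal_mono ENNReal.one_ne_top h4
  have h7 : |(((P ε).rnDeriv P₀ w).toReal - 1) / ε| ≤ L := by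
    have := abs_add_le ((((P ε).rnDeriv P₀ w).toReal - 1) / ε - φ w) (φ w)
    rw [sub_add_cancel] at this
    linarith
  rwa [abs_div, div_le_iff₀ (abs_pos.2 h5)] at h7

end Scores

/-! ### Pathwise derivative -/

namespace BellmanProblem

variable {𝒮 𝒜 : Type*} [MeasurableSpace 𝒮] [MeasurableSpace 𝒜] {B : BellmanProblem 𝒮 𝒜}
  {P : Measure (Transition 𝒮 𝒜)} {𝓜 : Set (Measure (Transition 𝒮 𝒜))} {η : NuisanceFns 𝒮 𝒜}

/-- Centering: the first term has mean zero by the normal equation, the second by the weak Bellman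
identity for α, and the mean of m(q) is Ψ(P). -/
theorem StrongCondition.influenceFn_spec (hS : B.StrongCondition P) (hη : B.IsNuisance P η) :
    Integrable (influenceFn η (B.target P)) P ∧ ∫ w, influenceFn η (B.target P) w ∂P = 0 := by
  have hP := hS.isLaw
  have hwα := hS.isWeakBellman hη.riesz.1 hη.value_α
  have hwq := hS.isWeakBellman hη.projection.1 hη.value_q
  have hr : MemLp η.r 2 (saLaw P) := hP.memLp_rewardFn.ae_eq hη.reward.symm
  have hm : Integrable η.mq (saLaw P) := by obtain ⟨_, _, h, _⟩ := hη.integrand_q; exact h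
  obtain ⟨h1, h2⟩ := integral_influenceFn hP (B.target P) hwα hwq hwα.memLp_image
    hwq.memLp_image hr hm
  refine ⟨h1, ?_⟩
  have ho := hη.projection.orthogonal hP hη.riesz.1
  have hαP := memLp_comp_stateAction hwα.memLp_image
  rw [integral_mul_sub hαP hP.memLp_outcome (memLp_comp_stateAction hwq.memLp_image),
    ← hP.integral_mul_rewardFn hwα.memLp_image, ← integral_mul_saLaw hwα.memLp_image
    hP.memLp_rewardFn, ← integral_mul_saLaw hwα.memLp_image hwq.memLp_image] at ho
  rw [h2, ho, hη.integrand_q.integral_eq hP hS.cond hη.riesz hη.projection.1,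
    target_eq hP hS.cond hη.riesz hη.projection,
    integral_mul_saLaw hwα.memLp_image hwq.memLp_image]
  simp

/-- With η = L|ε|, the quadratic remainder divided by ε vanishes. What is left is the mean of the
influence function G against (dP_ε/dP − 1)/ε; as G is only known to be integrable, convergence of
this quotient in L^∞ is what is used. -/
theorem StrongCondition.representsDerivative (h𝓜 : B.IsModel 𝓜) (hS : B.StrongCondition P)
    (hc : B.ConditionNear 𝓜 P) (hη : B.IsNuisance P η) :
    RepresentsDerivative 𝓜 B.target P (influenceFn η (B.target P)) := by
  intro Pε φ hreg
  have := hS.isLaw.prob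
  obtain ⟨hint, hzero⟩ := hS.influenceFn_spec hη
  obtain ⟨C, δ, hδ, hquad⟩ := hS.exists_quadratic_bound hη
  obtain ⟨L, hL, hnear⟩ := hreg.eventually_isNear h𝓜.isProbabilityMeasure
  obtain ⟨δ', hδ', hcond⟩ := hc
  set G := influenceFn η (B.target P)
  have hLε : Tendsto (fun ε : ℝ => L * |ε|) (𝓝[≠] 0) (𝓝 0) := by
    have : Tendsto (fun ε : ℝ => L * |ε|) (𝓝 0) (𝓝 (L * |0|)) :=
      (continuous_abs.tendsto 0).const_mul _
    rw [abs_zero, mul_zero] at this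
    exact this.mono_left nhdsWithin_le_nhds
  have hE := (ENNReal.tendsto_toReal ENNReal.zero_ne_top).comp hreg.differentiable
  rw [hasDerivAt_iff_tendsto_slope_zero, tendsto_iff_dist_tendsto_zero]
  have hlim : Tendsto (fun ε : ℝ => C * L * (L * |ε|)
      + (eLpNorm (fun w => (((Pε ε).rnDeriv P w).toReal - 1) / ε - φ w) ∞ P).toReal
        * ∫ w, |G w| ∂P) (𝓝[≠] 0) (𝓝 0) := by
    simpa using (hLε.const_mul (C * L)).add (hE.mul_const (∫ w, |G w| ∂P))
  refine squeeze_zero' (Eventually.of_forall fun _ => dist_nonneg) ?_ hlim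
  filter_upwards [hnear, hreg.mem.filter_mono nhdsWithin_le_nhds,
    hLε.eventually (ge_mem_nhds hδ), hLε.eventually (gt_mem_nhds (sq_pos_of_pos hδ')),
    hreg.differentiable.eventually (ge_mem_nhds zero_lt_one), self_mem_nhdsWithin]
    with ε h1 h2 h3 h4 h5 h6
  have h6' : ε ≠ 0 := h6
  have hq := hquad (Pε ε) (L * |ε|) (h𝓜.isLaw h2) (hcond _ h2 (h1.hellingerDist_lt hδ' h4)) h1 h3
  have e1 : ∫ w, G w ∂(Pε ε) = ∫ w, (((Pε ε).rnDeriv P w).toReal - 1) * G w ∂P := by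
    rw [← h1.integral_sub hint, hzero, sub_zero]
  have hi := h1.integrable_mul hint
  have hφi : Integrable (fun w => G w * φ w) P := by
    refine (hint.bdd_mul hreg.score_bounded.1
      (ae_abs_le_toReal_eLpNorm_top hreg.score_bounded.2.ne)).congr
      (Eventually.of_forall fun w => ?_)
    exact mul_comm _ _
  have e2 : ε⁻¹ * ∫ w, G w ∂(Pε ε) - ∫ w, G w * φ w ∂P
      = ∫ w, ((((Pε ε).rnDeriv P w).toReal - 1) / ε - φ w) * G w ∂P := by
    rw [e1, ← integral_const_mul, ← integral_sub (hi.const_mul _) hφi]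
    refine integral_congr_ae (Eventually.of_forall fun w => ?_)
    simp only [div_eq_inv_mul]; ring
  have b2 : |ε⁻¹ * ∫ w, G w ∂(Pε ε) - ∫ w, G w * φ w ∂P|
      ≤ (eLpNorm (fun w => (((Pε ε).rnDeriv P w).toReal - 1) / ε - φ w) ∞ P).toReal
        * ∫ w, |G w| ∂P := by
    rw [e2, ← integral_const_mul, ← Real.norm_eq_abs]
    refine norm_integral_le_of_norm_le (hint.abs.const_mul _) ?_
    filter_upwards [ae_abs_le_toReal_eLpNorm_top (h5.trans_lt ENNReal.one_lt_top).ne] with w hw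
    rw [norm_mul]
    exact mul_le_mul_of_nonneg_right hw (abs_nonneg _)
  rw [zero_add, hreg.base, Real.dist_eq, smul_eq_mul]
  have e3 : ε⁻¹ * (B.target (Pε ε) - B.target P) - ∫ w, G w * φ w ∂P
      = ε⁻¹ * (B.target (Pε ε) - B.target P - ∫ w, G w ∂(Pε ε))
        + (ε⁻¹ * ∫ w, G w ∂(Pε ε) - ∫ w, G w * φ w ∂P) := by ring
  rw [e3]
  refine (abs_add_le _ _).trans (add_le_add ?_ b2)
  rw [abs_mul, abs_inv, inv_mul_le_iff₀ (abs_pos.2 h6')]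
  refine hq.trans_eq ?_
  ring

end BellmanProblem

theorem mainTheorem1 {𝒮 𝒜 : Type*} [MeasurableSpace 𝒮] [MeasurableSpace 𝒜]
    (B : BellmanProblem 𝒮 𝒜) (𝓜 : Set (Measure (Transition 𝒮 𝒜))) (h𝓜 : B.IsModel 𝓜) :
    -- at every law satisfying the condition, representer, projection and parameter are well defined
    (∀ P ∈ 𝓜, B.ConditionAt P →
      (∃ α t : 𝒮 × 𝒜 → ℝ, B.IsRieszRepresenter P α t) ∧ ∃! ψ : ℝ, B.IsTargetValue P ψ) ∧
    (∀ P₀ ∈ 𝓜, IsNonparametricAt 𝓜 P₀ → B.ConditionNear 𝓜 P₀ →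
      (∃ η : NuisanceFns 𝒮 𝒜, B.IsNuisance P₀ η) ∧
      ∀ η : NuisanceFns 𝒮 𝒜, B.IsNuisance P₀ η →
        -- pathwise derivative and efficient influence function
        Integrable (influenceFn η (B.target P₀)) P₀ ∧
        RepresentsDerivative 𝓜 B.target P₀ (influenceFn η (B.target P₀)) ∧
        (MemLp (influenceFn η (B.target P₀)) 2 P₀ →
          IsEfficientInfluenceFunction 𝓜 B.target P₀ (influenceFn η (B.target P₀))) ∧
        -- von Mises expansion
        ∀ P ∈ 𝓜, ∀ η' : NuisanceFns 𝒮 𝒜, B.IsNuisance P η' →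
          MemLp η'.Tα 2 (saLaw P₀) → MemLp η'.Tq 2 (saLaw P₀) → MemLp η'.r 2 (saLaw P₀) →
          ∀ T₀α T₀q : 𝒮 × 𝒜 → ℝ,
            B.BellmanExt P₀ η'.α T₀α → B.ValueExt P₀ η'.α η'.Vα →
            B.BellmanExt P₀ η'.q T₀q → B.ValueExt P₀ η'.q η'.Vq →
            B.IntegrandExt P₀ η'.q η'.mq →
            Integrable (influenceFn η' (B.target P)) P₀ ∧
            B.target P - B.target P₀ =
              -(∫ w, influenceFn η' (B.target P) w ∂P₀)
              + ((∫ z, (η'.Tα z - η.Tα z) * (η.Tq z - T₀q z) ∂(saLaw P₀))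
                + ∫ z, (η'.Tα z - T₀α z) * (η.r z - η'.r z + η'.Tq z - η.Tq z) ∂(saLaw P₀))) ∧
    -- functional von Mises expansion with arbitrary nuisance functions
    (∀ P₀ ∈ 𝓜, B.ConditionAt P₀ →
      ∀ α₀ T₀α₀ q₀ T₀q₀ : 𝒮 × 𝒜 → ℝ,
        B.IsRieszRepresenter P₀ α₀ T₀α₀ → B.IsBellmanProjection P₀ q₀ T₀q₀ →
      ∀ q ∈ B.H, ∀ α ∈ B.H, ∀ (r : Lp ℝ ∞ B.dom) (T : Lp ℝ ∞ B.dom → Lp ℝ ∞ B.dom),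
      ∀ P ∈ 𝓜, B.bellman P q =ᵐ[saLaw P] rewardFn P →
      ∀ ψ : ℝ, ψ = ∫ z, B.m q z ∂(saLaw P) →
        (B.ConditionAt P → B.target P = ψ) ∧
        Integrable (influenceFn (B.estimatedNuisance T α q r) ψ) P₀ ∧
        ψ - B.target P₀ =
          -(∫ w, influenceFn (B.estimatedNuisance T α q r) ψ w ∂P₀)
          + ((∫ z, (B.bellman P₀ α z - T₀α₀ z) * (T₀q₀ z - B.bellman P₀ q z) ∂(saLaw P₀))
            + (∫ z, (T α z - B.bellman P₀ α z) * (rewardFn P₀ z - r z) ∂(saLaw P₀))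
            + ∫ z, (T α z - B.bellman P₀ α z) * (T q z - B.bellman P₀ q z) ∂(saLaw P₀))) := by
  refine ⟨fun P hP hc => ⟨hc.exists_isRieszRepresenter (h𝓜.isLaw hP),
    hc.existsUnique_isTargetValue (h𝓜.isLaw hP)⟩, fun P₀ hP₀ hnp hnear => ?_,
    fun P₀ hP₀ hc α₀ T₀α₀ q₀ T₀q₀ hα₀ hq₀ q hq α hα r T P hP hb ψ hψ => ?_⟩
  · have hS := hnear.strongCondition h𝓜 hP₀ hnp
    have hL := hS.isLaw
    have := hL.prob
    refine ⟨hS.exists_isNuisance, fun η hη => ?_⟩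
    obtain ⟨hint, hzero⟩ := hS.influenceFn_spec hη
    have hder := hS.representsDerivative h𝓜 hnear hη
    refine ⟨hint, hder, fun h2 => ⟨h2, hzero, hder, fun δ hδ =>
      hnp.mem_tangentSpace h𝓜.isProbabilityMeasure h2 hzero hδ⟩, ?_⟩
    intro P _ η' _ hTα hTq hr T₀α T₀q hα hvα hq hvq hm
    have hwα := hS.isWeakBellman hα hvα
    have hwq := hS.isWeakBellman hq hvq
    have hmi : Integrable η'.mq (saLaw P₀) := by obtain ⟨_, _, h, _⟩ := hm; exact h
    refine ⟨(BellmanProblem.integral_influenceFn hL _ hwα hwq hTα hTq hr hmi).1, ?_⟩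
    rw [BellmanProblem.vonMises_expansion hL hS.cond hη.riesz hη.projection (B.target P) hwα hwq
      hTα hTq hr hmi (hm.integral_eq hL hS.cond hη.riesz hq) hα]
    have e : ∫ z, (η'.Tα z - T₀α z) * (rewardFn P₀ z - η'.r z + η'.Tq z - η.Tq z) ∂(saLaw P₀)
        = ∫ z, (η'.Tα z - T₀α z) * (η.r z - η'.r z + η'.Tq z - η.Tq z) ∂(saLaw P₀) := by
      refine integral_congr_ae ?_
      filter_upwards [hη.reward] with z hz
      rw [hz]
    rw [e]
  · have hL := h𝓜.isLaw hP₀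
    subst hψ
    exact ⟨fun hcP => hcP.target_eq_of_bellman_eq (h𝓜.isLaw hP) hq hb,
      BellmanProblem.vonMises_estimated hL hc hα₀ hq₀ hq hα r T _⟩
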